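/- Let $T$ be a locally compact Polish space, let $\sigma$ be a non-atomic Radon measure on $T$ with $\sigma(O)>0$ for every non-empty open set $O\subset T$, and let $\lambda\in C(T)$ be real-valued. Let $\mathbb F=\mathbb R\oplus\bigoplus_{n\ge1}L^2(T^n,\sigma^{\otimes n})$ be the (real) full Fock space and let $\omega(t)=\partial_t^\dagger+\lambda(t)\,\partial_t^\dagger\partial_t+\partial_t$ be the free Gauss–Poisson noise in $\mathbb F$ (the free Meixner noise with $\eta\equiv0$). Here $\partial_t^\dagger$ and $\partial_t$ are the creation and annihilation operators at the point $t$; that is, for $f\in C_0(T)$ (continuous with compact support) $\langle\omega,f\rangle$ is the bounded operator $$(\langle\omega,f\rangle g)= f\otimes g+\lambda(t_1)f(t_1)g(t_1,\dots,t_n)+\int_T f(s)\,g(s,\cdot)\,\sigma(ds),\qquad g\in L^2(T^n,\sigma^{\otimes n}),$$ where the last two terms are absent for $n=0$. For $f\in C_0(T^n)$ let $\langle\omega^{\otimes n},f\rangle$ be the bounded operator in $\mathbb F$ that is linear in $f$, given by $\langle\omega^{\otimes n},f_1\otimes\dots\otimes f_n\rangle=\langle\omega,f_1\rangle\cdots\langle\omega,f_n\rangle$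 on products, and extended to all $f$ by continuity (uniform convergence with supports in a fixed compact set). Let $\mathbf{CP}$ be the space of all continuous polynomials, i.e. of all finite sums $\sum_n\langle\omega^{\otimes n},f^{(n)}\rangle$ with $f^{(n)}\in C_0(T^n)$. The orthogonal polynomials $\langle P^{(n)}(\omega),f^{(n)}\rangle$ are given by $P^{(0)}(\omega)=\mathbf 1$, $P^{(1)}(\omega)(t)=\omega(t)$ and, for $n\ge2$, $$P^{(n)}(\omega)(t_1,\dots,t_n)=\omega(t_1)P^{(n-1)}(\omega)(t_2,\dots,t_n)-\delta(t_1,t_2)\lambda(t_1)P^{(n-1)}(\omega)(t_2,\dots,t_n)-\delta(t_1,t_2)P^{(n-2)}(\omega)(t_3,\dots,t_n),$$ where $\delta$ denotes delta functions with respect to $\sigma$: $\int_{T^l}\delta(t_1,\dots,t_l)h(t_1,\dots,t_l)\,\sigma(dt_1)\cdots\sigma(dt_l)=\int_T h(s,\dots,s)\,\sigma(ds)$. Every element of $\mathbf{CP}$ has a unique representation as a finite sum $\sum_n\langle\omega^{\otimes n},f^{(n)}\rangle$, and a unique one as a finite sum $\sum_n\langle P^{(n)}(\omega),f^{(n)}\rangle$,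 with $f^{(n)}\in C_0(T^n)$. For $t\in T$ define linear operators $\partial_t$ and $D_t$ on $\mathbf{CP}$ by $$\partial_t\langle P^{(n)}(\omega),f^{(n)}\rangle=\langle P^{(n-1)}(\omega),f^{(n)}(t,\cdot)\rangle,\qquad D_t\langle\omega^{\otimes n},f^{(n)}\rangle=\langle\omega^{\otimes(n-1)},f^{(n)}(t,\cdot)\rangle\qquad(n\ge1),$$ and by $0$ for $n=0$. Let $NC_{\ge2}(1,\dots,n)$ be the set of non-crossing partitions of $\{1,\dots,n\}$ all of whose blocks have at least two elements, for such a partition $\zeta$ put $$W^-(\zeta)(t_1,\dots,t_n)=\prod_{\{i_1,\dots,i_l\}\in\zeta}\lambda(t_{i_1})^{l-2}\,\delta(t_{i_1},\dots,t_{i_l}),$$ and let $\mathbb G$ be the linear operator on $\mathbf{CP}$ $$\mathbb G=\mathbf 1+\sum_{n=2}^\infty\ \sum_{\zeta\in NC_{\ge2}(1,\dots,n)}\int_{T^n}\sigma(dt_1)\cdots\sigma(dt_n)\,W^-(\zeta)(t_1,\dots,t_n)\,D_{t_1}\cdots D_{t_n}$$ (all but finitely many terms vanish on each element of $\mathbf{CP}$).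 For $l,e\in\mathbb R$ let $\Psi_{l,e}(z)=z/(1+lz+ez^2)$, and let $\Psi_{l,e}^{-1}$ be its inverse with respect to composition as a formal power series. Theorem. For every $t\in T$ the operator $D_t\mathbb G$ is locally nilpotent on $\mathbf{CP}$ (for each $A\in\mathbf{CP}$ one has $(D_t\mathbb G)^kA=0$ for all large $k$), the operator $\mathbf 1-\lambda(t)D_t\mathbb G$ is invertible on $\mathbf{CP}$, and on $\mathbf{CP}$ $$\partial_t=\Psi_{\lambda(t),0}^{-1}(D_t\mathbb G)=\frac{D_t\mathbb G}{\mathbf 1-\lambda(t)D_t\mathbb G}=\sum_{k=1}^\infty\lambda(t)^{k-1}(D_t\mathbb G)^k,$$ where on each element of $\mathbf{CP}$ all but finitely many terms of the power series vanish. In particular, $\partial_t=D_t\mathbb G$ if $\lambda(t)=0$. -/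

import Mathlib

open MeasureTheory DirectSum CompactlySupported
set_option linter.unusedSectionVars false

namespace FreeMeixner

noncomputable section

section

section TestFunctions

/-- Continuous real functions with compact support on `T ^ n`. -/
abbrev Test (T : Type*) [TopologicalSpace T] (n : ℕ) : Type _ := C_c(Fin n → T, ℝ)

/-- Finite sequences `(f⁽⁰⁾, f⁽¹⁾, …)` of test functions, `f⁽ⁿ⁾` on `T ^ n`. -/
abbrev TestSeq (T : Type*) [TopologicalSpace T] : Type _ := ⨁ n : ℕ, Test T n

theorem eq_zero_of_notMem_image {S Y : Type*} [TopologicalSpace Y] (f : C_c(Y, ℝ))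
    {pS : Y → S} {y : Y} (h : pS y ∉ pS '' tsupport f) : f y = 0 := by
  by_contra h'
  exact h ⟨y, subset_tsupport _ h', rfl⟩

theorem hasCompactSupport_of_leftInverse {X Y : Type*} [TopologicalSpace X] [TopologicalSpace Y]
    [T2Space X] (f : C_c(Y, ℝ)) (e : X → Y) (p : Y → X) (hp : Continuous p)
    (hpe : ∀ x, p (e x) = x) (w : X → ℝ) : HasCompactSupport fun x => w x * f (e x) := by
  refine HasCompactSupport.intro (f.hasCompactSupport.isCompact.image hp) fun x hx => ?_
  rw [eq_zero_of_notMem_image f (pS := p) (by rwa [hpe]), mul_zero]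

theorem integrable_slice {S X Y : Type*} [TopologicalSpace S] [TopologicalSpace X]
    [TopologicalSpace Y] [MeasurableSpace S] [OpensMeasurableSpace S] [T2Space S]
    (μ : Measure S) [IsFiniteMeasureOnCompacts μ]
    (f : C_c(Y, ℝ)) {e : S → X → Y} (he : Continuous (Function.uncurry e))
    {pS : Y → S} (hpS : Continuous pS) (hS : ∀ s x, pS (e s x) = s)
    {w : S → ℝ} (hw : Continuous w) (x : X) : Integrable (fun s => w s * f (e s x)) μ := by
  have h1 : Continuous fun s => e s x := he.comp (by fun_prop : Continuous fun s => (s, x))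
  refine Continuous.integrable_of_hasCompactSupport (by fun_prop) ?_
  exact hasCompactSupport_of_leftInverse f (fun s => e s x) pS hpS (fun s => hS s x) w

theorem continuous_integral_slice {S X Y : Type*} [TopologicalSpace S] [TopologicalSpace X]
    [TopologicalSpace Y] [MeasurableSpace S] [OpensMeasurableSpace S]
    (μ : Measure S) [IsFiniteMeasureOnCompacts μ]
    (f : C_c(Y, ℝ)) {e : S → X → Y} (he : Continuous (Function.uncurry e))
    {pS : Y → S} (hpS : Continuous pS) (hS : ∀ s x, pS (e s x) = s)
    {w : S → ℝ} (hw : Continuous w) : Continuous fun x => ∫ s, w s * f (e s x) ∂μ := by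
  rw [← continuousOn_univ]
  refine continuousOn_integral_of_compact_support (f := fun x s => w s * f (e s x))
    (f.hasCompactSupport.isCompact.image hpS) ?_ fun x s _ hs => ?_
  · have : Continuous fun z : X × S => e z.2 z.1 := he.comp continuous_swap
    have h2 : Continuous fun z : X × S => w z.2 * f (e z.2 z.1) := by fun_prop
    exact h2.continuousOn
  · rw [eq_zero_of_notMem_image f (pS := pS) (by rwa [hS]), mul_zero]

theorem hasCompactSupport_integral_slice {S X Y : Type*} [TopologicalSpace X] [R1Space X]
    [TopologicalSpace Y] [MeasurableSpace S] (μ : Measure S)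
    (f : C_c(Y, ℝ)) {e : S → X → Y} {pX : Y → X} (hpX : Continuous pX)
    (hX : ∀ s x, pX (e s x) = x) (w : S → ℝ) :
    HasCompactSupport fun x => ∫ s, w s * f (e s x) ∂μ := by
  refine HasCompactSupport.intro (f.hasCompactSupport.isCompact.image hpX) fun x hx => ?_
  rw [integral_eq_zero_of_ae]
  refine Filter.Eventually.of_forall fun s => ?_
  simp [eq_zero_of_notMem_image f (pS := pX) (y := e s x) (by rwa [hX])]

variable {T : Type*} [TopologicalSpace T] [T2Space T]

/-- `f ↦ f (t, ·)`. -/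
def slice (t : T) (n : ℕ) : Test T (n + 1) →ₗ[ℝ] Test T n where
  toFun f :=
    { toFun := fun x => f (Fin.cons t x)
      continuous_toFun := by fun_prop
      hasCompactSupport' := by
        simpa using hasCompactSupport_of_leftInverse f (fun x : Fin n → T => Fin.cons t x) Fin.tail
          (by unfold Fin.tail; fun_prop) (fun x => Fin.tail_cons _ _) (fun _ => 1) }
  map_add' _ _ := rfl
  map_smul' _ _ := rfl

/-- The smearing of `c(t_p) δ(t_p, t_{p+1})`: restriction to the diagonal `t_p = t_{p+1}`,
weighted with `c`. -/
def diag (c : C(T, ℝ)) {n : ℕ} (p : Fin (n + 1)) : Test T (n + 2) →ₗ[ℝ] Test T (n + 1) where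
  toFun f :=
    { toFun := fun x => c (x p) * f (fun i => x (p.predAbove i))
      continuous_toFun := by fun_prop
      hasCompactSupport' := hasCompactSupport_of_leftInverse f
        (fun (x : Fin (n + 1) → T) i => x (p.predAbove i)) (fun y i => y (p.castSucc.succAbove i))
        (by fun_prop) (fun x => funext fun i => by simp) _ }
  map_add' f g := by ext x; simp [mul_add]
  map_smul' a f := by ext x; simp; ring

theorem continuous_insert₂ {n : ℕ} (p : Fin (n + 1)) :
    Continuous (Function.uncurry fun (s : T) (x : Fin n → T) =>
      (p.castSucc.insertNth s (p.insertNth s x : Fin (n + 1) → T) : Fin (n + 2) → T)) := by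
  have h : Continuous fun z : T × (Fin n → T) => (p.insertNth z.1 z.2 : Fin (n + 1) → T) :=
    Continuous.finInsertNth p continuous_fst continuous_snd
  exact Continuous.finInsertNth p.castSucc continuous_fst h

variable [SecondCountableTopology T] [LocallyCompactSpace T] [MeasurableSpace T] [BorelSpace T]
  (σ : Measure T) [IsFiniteMeasureOnCompacts σ]

/-- The smearing of `δ(t_p, t_{p+1})` integrated with respect to `σ`:
`f ↦ ∫ f(x_0, …, x_{p-1}, s, s, x_p, …) σ(ds)`. -/
def contract {n : ℕ} (p : Fin (n + 1)) : Test T (n + 2) →ₗ[ℝ] Test T n where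
  toFun f :=
    { toFun := fun x =>
        ∫ s, f (p.castSucc.insertNth s (p.insertNth s x : Fin (n + 1) → T) : Fin (n + 2) → T) ∂σ
      continuous_toFun := by
        simpa using continuous_integral_slice σ f (continuous_insert₂ p)
          (pS := fun y => y p.castSucc) (by fun_prop) (fun s x => by simp) (w := fun _ => 1)
          (by fun_prop)
      hasCompactSupport' := by
        simpa using hasCompactSupport_integral_slice σ f
          (e := fun s x =>
            (p.castSucc.insertNth s (p.insertNth s x : Fin (n + 1) → T) : Fin (n + 2) → T))
          (pX := fun y => p.removeNth (p.castSucc.removeNth y))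
          (by unfold Fin.removeNth; fun_prop) (fun s x => by simp) (fun _ => 1) }
  map_add' f g := by
    ext x
    have h (f : Test T (n + 2)) := integrable_slice σ f (continuous_insert₂ p)
          (pS := fun y => y p.castSucc) (by fun_prop) (fun s x => by simp) (w := fun _ => 1)
          (by fun_prop) x
    simpa using integral_add (h f) (h g)
  map_smul' a f := by
    ext x
    simp [integral_const_mul]

end TestFunctions

section FockSpace

variable {T : Type*} [TopologicalSpace T] [T2Space T]
  [SecondCountableTopology T] [LocallyCompactSpace T] [MeasurableSpace T] [BorelSpace T]
  (σ : Measure T) [IsFiniteMeasureOnCompacts σ] (c : C(T, ℝ))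

/-- The full Fock space `ℝ ⊕ ⨁_{n ≥ 1} L²(T ^ n, σ ^ n)` (Hilbert space direct sum; for `n = 0`
the space `L²(T ^ 0)` is the real line). -/
abbrev Fock : Type _ := lp (fun n : ℕ => Lp ℝ 2 (Measure.pi fun _ : Fin n => σ)) 2

/-- The class in `L²(T ^ n, σ ^ n)` of a test function. -/
def toL2 (n : ℕ) : Test T n →ₗ[ℝ] Lp ℝ 2 (Measure.pi fun _ : Fin n => σ) where
  toFun f := (f.continuous.memLp_of_hasCompactSupport f.hasCompactSupport).toLp f
  map_add' _ _ := rfl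
  map_smul' _ _ := rfl

/-- A finite sequence of test functions as a vector of the Fock space. -/
def toFock : TestSeq T →ₗ[ℝ] Fock σ :=
  DirectSum.toModule ℝ ℕ _ fun n =>
    lp.lsingle 2 n ∘ₗ toL2 σ n

/-- `f ⊗ g`, where the first `n` variables belong to `f` and the other `m` variables to `g`. -/
def tensor (m n : ℕ) : Test T n →ₗ[ℝ] Test T m →ₗ[ℝ] Test T (m + n) :=
  LinearMap.mk₂ ℝ (fun f g =>
    { toFun := fun x => f (fun i => x ⟨i, by omega⟩) * g (fun i => x ⟨n + i, by omega⟩)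
      continuous_toFun := by fun_prop
      hasCompactSupport' := by
        let A := (fun x : Fin (m + n) → T => ((fun i : Fin n => x ⟨i, by omega⟩),
          (fun i : Fin m => x ⟨n + i, by omega⟩)))
        let B := (fun (z : (Fin n → T) × (Fin m → T)) (i : Fin (m + n)) =>
          if h : i < n then z.1 ⟨i, h⟩ else z.2 ⟨i - n, by omega⟩)
        have hB : Continuous B := by
          refine continuous_pi fun i => ?_
          by_cases h : i < n
          · simp only [B, h, dite_true]; fun_prop
          · simp only [B, h, dite_false]; fun_prop
        have hBA : ∀ x, B (A x) = x := by
          intro x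
          funext i
          by_cases h : i < n
          · simp [A, B, h]
          · simp only [A, B, h, dite_false]
            congr 2
            omega
        refine HasCompactSupport.intro
          ((f.hasCompactSupport.isCompact.prod g.hasCompactSupport.isCompact).image hB)
          fun x hx => ?_
        by_contra h0
        refine hx ⟨A x, ⟨subset_tsupport _ (left_ne_zero_of_mul h0),
          subset_tsupport _ (right_ne_zero_of_mul h0)⟩, hBA x⟩ })
    (fun _ _ _ => by ext; simp [add_mul]) (fun _ _ _ => by ext; simp; ring)
    (fun _ _ _ => by ext; simp [mul_add]) (fun _ _ _ => by ext; simp; ring)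

/-- `N` variables, the first `j` of which are still to be paired with `ω(t_1) ⋯ ω(t_j)` while the
others are the variables of a vector of the Fock space. The operator
`ω(t_j) = ∂†(t_j) + λ(t_j) ∂†(t_j) ∂(t_j) + ∂(t_j)` acts first: its creation part turns `t_j` into
the first variable of the vector, its neutral part identifies `t_j` with that first variable and
multiplies by `λ`, and its annihilation part sets both equal and integrates. The last two parts
kill the vectors without variables. -/
def act : (j N : ℕ) → Test T N →ₗ[ℝ] TestSeq T
  | 0, N => DirectSum.lof ℝ ℕ (fun n => Test T n) N
  | j + 1, N + 2 => act j (N + 2) +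
      if h : j < N + 1 then act j (N + 1) ∘ₗ diag c ⟨j, h⟩ + act j N ∘ₗ contract σ ⟨j, h⟩ else 0
  | j + 1, N => act j N

/-- `⟨ω^{⊗ n}, f⟩` on the finite sequences of test functions. -/
def wordCore (n : ℕ) (f : Test T n) : TestSeq T →ₗ[ℝ] TestSeq T :=
  DirectSum.toModule ℝ ℕ _ fun m => act σ c n (m + n) ∘ₗ tensor m n f

end FockSpace

end

section

variable {T : Type*} [TopologicalSpace T] [T2Space T]

@[simp] theorem slice_apply (t : T) (n : ℕ) (f : Test T (n + 1)) (x : Fin n → T) :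
    slice t n f x = f (Fin.cons t x) := rfl

@[simp] theorem diag_apply (c : C(T, ℝ)) {n : ℕ} (p : Fin (n + 1)) (f : Test T (n + 2))
    (x : Fin (n + 1) → T) : diag c p f x = c (x p) * f (fun i => x (p.predAbove i)) := rfl

variable [SecondCountableTopology T] [LocallyCompactSpace T] [MeasurableSpace T] [BorelSpace T]
  (σ : Measure T) [IsFiniteMeasureOnCompacts σ] (c : C(T, ℝ))

theorem contract_apply {n : ℕ} (p : Fin (n + 1)) (f : Test T (n + 2)) (x : Fin n → T) :
    contract σ p f x = ∫ s, f (p.castSucc.insertNth s (p.insertNth s x : Fin (n + 1) → T) :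
      Fin (n + 2) → T) ∂σ := rfl

@[simp] theorem tensor_apply (m n : ℕ) (f : Test T n) (g : Test T m) (x : Fin (m + n) → T) :
    tensor m n f g x = f (fun i => x ⟨i, by omega⟩) * g (fun i => x ⟨n + i, by omega⟩) := rfl

theorem insert₂_apply {n : ℕ} (p : Fin (n + 1)) (s : T) (x : Fin n → T) (i : Fin (n + 2)) :
    (p.castSucc.insertNth s (p.insertNth s x : Fin (n + 1) → T) : Fin (n + 2) → T) i =
      if h : (i : ℕ) < p then x ⟨i, by omega⟩ else
        if h2 : (i : ℕ) ≤ p + 1 then s else x ⟨i - 2, by omega⟩ := by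
  rcases lt_trichotomy (i : ℕ) p with h | h | h
  · have h1 : i = p.castSucc.succAbove (p.succAbove ⟨i, by omega⟩) := by
      ext; simp [Fin.succAbove, Fin.lt_def, h]
    rw [dif_pos h]
    conv_lhs => rw [h1]
    simp
  · have h1 : i = p.castSucc := by ext; simpa using h
    rw [dif_neg (by omega), dif_pos (by omega)]
    conv_lhs => rw [h1]
    simp
  · by_cases h2 : (i : ℕ) = p + 1
    · have h1 : i = p.castSucc.succAbove p := by
        ext; simp [h2]
      rw [dif_neg (by omega), dif_pos (by omega)]
      conv_lhs => rw [h1]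
      rw [Fin.insertNth_apply_succAbove, Fin.insertNth_apply_same]
    · have h1 : i = p.castSucc.succAbove (p.succAbove ⟨i - 2, by omega⟩) := by
        ext
        have h3 : ¬ ((i : ℕ) - 2 < p) := by omega
        have h4 : ¬ ((i : ℕ) - 2 + 1 < p) := by omega
        simp [Fin.succAbove, Fin.lt_def, h3, h4]
        omega
      rw [dif_neg (by omega), dif_neg (by omega)]
      conv_lhs => rw [h1]
      simp

theorem diag_tensor {N : ℕ} (j : ℕ) (h : j < N + 1) (χ : Test T 1) (f : Test T (N + 2)) :
    diag c ⟨j + 1, by omega⟩ (tensor (N + 2) 1 χ f) = tensor (N + 1) 1 χ (diag c ⟨j, h⟩ f) := by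
  ext x
  have h1 : (fun i : Fin (N + 2) => x ((⟨j + 1, by omega⟩ : Fin (N + 2)).predAbove
      ⟨1 + i, by omega⟩)) = fun i => x ⟨1 + ((⟨j, h⟩ : Fin (N + 1)).predAbove i), by omega⟩ := by
    funext i
    congr 1
    ext
    simp only [Fin.predAbove, Fin.lt_def]
    by_cases h3 : j < i
    · simp [h3, add_comm 1]
      omega
    · simp [h3, add_comm 1]
  have h2 : (fun i : Fin 1 => x ((⟨j + 1, by omega⟩ : Fin (N + 2)).predAbove
      ⟨i, by omega⟩)) = fun i : Fin 1 => x ⟨i, by omega⟩ := by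
    funext i
    congr 1
    ext
    simp [Fin.predAbove]
  have h3 : x ⟨j + 1, by omega⟩ = x ⟨1 + j, by omega⟩ := by
    congr 2; omega
  rw [diag_apply, tensor_apply, tensor_apply, diag_apply, h1, h2, h3]
  ring

theorem contract_tensor {N : ℕ} (j : ℕ) (h : j < N + 1) (χ : Test T 1) (f : Test T (N + 2)) :
    contract σ ⟨j + 1, by omega⟩ (tensor (N + 2) 1 χ f) =
      tensor N 1 χ (contract σ ⟨j, h⟩ f) := by
  ext x
  simp only [contract_apply, tensor_apply]
  rw [← integral_const_mul]
  congr 1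
  funext s
  congr 2
  · funext i
    rw [insert₂_apply]
    simp
  · funext i
    rw [insert₂_apply, insert₂_apply]
    have e1 : (1 + (i : ℕ) < j + 1) ↔ (i : ℕ) < j := by omega
    have e2 : (1 + (i : ℕ) ≤ j + 1 + 1) ↔ (i : ℕ) ≤ j + 1 := by omega
    simp only [e1, e2]
    split_ifs with h1 h2
    · rfl
    · rfl
    · congr 2
      omega

theorem act_zero (N : ℕ) (f : Test T N) :
    act σ c 0 N f = DirectSum.lof ℝ ℕ (fun n => Test T n) N f := by
  cases N with
  | zero => rfl
  | succ N => cases N <;> rfl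

theorem act_succ_one (j : ℕ) (f : Test T 1) : act σ c (j + 1) 1 f = act σ c j 1 f := rfl

theorem act_succ (j N : ℕ) (f : Test T (N + 2)) :
    act σ c (j + 1) (N + 2) f = act σ c j (N + 2) f +
      if h : j < N + 1 then act σ c j (N + 1) (diag c ⟨j, h⟩ f) +
        act σ c j N (contract σ ⟨j, h⟩ f) else 0 := by
  rw [act]
  by_cases h : j < N + 1 <;> simp [h]

theorem wordCore_lof (n m : ℕ) (f : Test T n) (g : Test T m) :
    wordCore σ c n f (DirectSum.lof ℝ ℕ (fun n => Test T n) m g) =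
      act σ c n (m + n) (tensor m n f g) := by
  simp [wordCore]

theorem act_tensor (χ : Test T 1) : ∀ (j N : ℕ) (_ : j ≤ N) (f : Test T N),
    act σ c (j + 1) (N + 1) (tensor N 1 χ f) = wordCore σ c 1 χ (act σ c j N f)
  | 0, N, _, f => by rw [act_zero, wordCore_lof]
  | j + 1, 1, hj, f => by
    obtain rfl : j = 0 := by omega
    rw [act_succ, act_succ_one, ← act_tensor χ 0 1 (by omega)]
    simp
  | j + 1, N + 2, hj, f => by
    rw [act_succ σ c (j + 1) (N + 1), act_succ σ c j N, act_tensor χ j (N + 2) (by omega), map_add]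
    by_cases h : j < N + 1
    · rw [dif_pos h, dif_pos (by omega), map_add, ← act_tensor χ j (N + 1) (by omega),
        ← act_tensor χ j N (by omega), diag_tensor c j h, contract_tensor σ j h]
    · rw [dif_neg h, dif_neg (by omega), map_zero]

/-- `|p m| ≤ q m` -/
def AbsLe (p q : TestSeq T) : Prop := ∀ m x, |p m x| ≤ q m x

theorem AbsLe.add {p q p' q' : TestSeq T} (h : AbsLe p q) (h' : AbsLe p' q') :
    AbsLe (p + p') (q + q') := fun m x => by
  simpa using (abs_add_le _ _).trans (add_le_add (h m x) (h' m x))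

theorem AbsLe.zero : AbsLe (0 : TestSeq T) 0 := fun m x => by simp

theorem act_absLe : ∀ (j N : ℕ) (f g : Test T N) (_ : ∀ x, |f x| ≤ g x),
    AbsLe (act σ c j N f) (act σ |c| j N g)
  | 0, N, f, g, h => by
    rw [act_zero, act_zero]
    intro m x
    by_cases hm : m = N
    · subst hm
      simpa using h x
    · simp [DirectSum.lof_eq_of, DirectSum.of_eq_of_ne _ _ _ hm]
  | j + 1, 0, f, g, h => act_absLe j 0 f g h
  | j + 1, 1, f, g, h => act_absLe j 1 f g h
  | j + 1, N + 2, f, g, h => by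
    rw [act_succ, act_succ]
    refine (act_absLe j _ f g h).add ?_
    split_ifs with hj
    · refine (act_absLe j _ _ _ fun x => ?_).add (act_absLe j _ _ _ fun x => ?_)
      · simp only [diag_apply, abs_mul, ContinuousMap.abs_apply]
        exact mul_le_mul_of_nonneg_left (h _) (abs_nonneg _)
      · rw [contract_apply, contract_apply]
        refine abs_integral_le_integral_abs.trans (integral_mono_of_nonneg ?_ ?_ ?_)
        · exact Filter.Eventually.of_forall fun s => abs_nonneg _
        · have := integrable_slice σ g (continuous_insert₂ ⟨j, hj⟩)
            (pS := fun y => y (Fin.castSucc ⟨j, hj⟩)) (by fun_prop) (fun s x => by simp)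
            (w := fun _ => 1) (by fun_prop) x
          simpa using this
        · exact Filter.Eventually.of_forall fun s => h _
    · exact AbsLe.zero

end

section

variable {T : Type*} [TopologicalSpace T] [T2Space T]
variable [SecondCountableTopology T] [LocallyCompactSpace T] [MeasurableSpace T] [BorelSpace T]
  (σ : Measure T) [IsFiniteMeasureOnCompacts σ] (c : C(T, ℝ))

theorem norm_toL2_sq (n : ℕ) (f : Test T n) :
    ‖toL2 σ n f‖ ^ 2 = ∫ x, f x ^ 2 ∂Measure.pi fun _ => σ := by
  rw [← real_inner_self_eq_norm_sq, L2.inner_def]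
  refine integral_congr_ae ?_
  have h : (toL2 σ n f : (Fin n → T) → ℝ) =ᵐ[Measure.pi fun _ => σ] f :=
    MemLp.coeFn_toLp (f.continuous.memLp_of_hasCompactSupport f.hasCompactSupport)
  filter_upwards [h] with x hx
  rw [hx]
  simp [pow_two]

theorem norm_toL2_le {n m : ℕ} (f : Test T n) (g : Test T m) {C : ℝ} (hC : 0 ≤ C)
    (h : ∫ x, f x ^ 2 ∂Measure.pi (fun _ => σ) ≤ C ^ 2 * ∫ x, g x ^ 2 ∂Measure.pi fun _ => σ) :
    ‖toL2 σ n f‖ ≤ C * ‖toL2 σ m g‖ := by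
  rw [← pow_le_pow_iff_left₀ (norm_nonneg _) (by positivity) two_ne_zero, mul_pow, norm_toL2_sq,
    norm_toL2_sq]
  exact h

theorem integrable_sq (n : ℕ) (f : Test T n) :
    Integrable (fun x => f x ^ 2) (Measure.pi fun _ : Fin n => σ) := by
  refine Continuous.integrable_of_hasCompactSupport (by fun_prop) ?_
  exact f.hasCompactSupport.comp_left (g := fun y : ℝ => y ^ 2) (by simp)

theorem integral_succ (n : ℕ) (g : T → (Fin n → T) → ℝ) :
    ∫ x : Fin (n + 1) → T, g (x 0) (Fin.tail x) ∂Measure.pi (fun _ => σ) =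
      ∫ z : T × (Fin n → T), g z.1 z.2 ∂σ.prod (Measure.pi fun _ => σ) := by
  have h := (measurePreserving_piFinSuccAbove (fun _ : Fin (n + 1) => σ) 0)
  rw [← h.integral_comp' (fun z : T × (Fin n → T) => g z.1 z.2)]
  rfl

theorem tensor_one_apply (m : ℕ) (χ : Test T 1) (f : Test T m) (x : Fin (m + 1) → T) :
    tensor m 1 χ f x = χ (fun _ => x 0) * f (Fin.tail x) := by
  rw [tensor_apply]
  congr 2
  · funext i
    congr 1
    ext
    simp
  · funext i
    simp only [Fin.tail]
    congr 1
    ext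
    simp [add_comm]

theorem norm_create_le (m : ℕ) (χ : Test T 1) (f : Test T m) :
    ‖toL2 σ (m + 1) (tensor m 1 χ f)‖ ≤ √(∫ s, χ (fun _ => s) ^ 2 ∂σ) * ‖toL2 σ m f‖ := by
  refine norm_toL2_le σ _ _ (Real.sqrt_nonneg _) ?_
  rw [Real.sq_sqrt (integral_nonneg fun s => sq_nonneg _)]
  simp only [tensor_one_apply, mul_pow]
  rw [integral_succ σ m (fun s y => χ (fun _ => s) ^ 2 * f y ^ 2),
    integral_prod_mul (fun s => χ (fun _ => s) ^ 2) fun y => f y ^ 2]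

theorem diag_zero_tensor (m : ℕ) (χ : Test T 1) (f : Test T (m + 1)) (x : Fin (m + 1) → T) :
    diag c (0 : Fin (m + 1)) (tensor (m + 1) 1 χ f) x = c (x 0) * χ (fun _ => x 0) * f x := by
  rw [diag_apply, tensor_one_apply, mul_assoc]
  congr 3

theorem norm_neutral_le (m : ℕ) (χ : Test T 1) (f : Test T (m + 1)) {Λ : ℝ}
    (hΛ : ∀ s, |c s * χ (fun _ => s)| ≤ Λ) (h0 : 0 ≤ Λ) :
    ‖toL2 σ (m + 1) (diag c (0 : Fin (m + 1)) (tensor (m + 1) 1 χ f))‖ ≤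
      Λ * ‖toL2 σ (m + 1) f‖ := by
  refine norm_toL2_le σ _ _ h0 ?_
  rw [← integral_const_mul]
  refine integral_mono (integrable_sq σ _ _) ((integrable_sq σ _ _).const_mul _) fun x => ?_
  simp only [diag_zero_tensor, mul_pow (_ * _)]
  exact mul_le_mul_of_nonneg_right (sq_le_sq' (neg_le_of_abs_le (hΛ _)) (le_of_abs_le (hΛ _)))
    (sq_nonneg _)

theorem contract_zero_tensor (m : ℕ) (χ : Test T 1) (f : Test T (m + 1)) (x : Fin m → T) :
    contract σ (0 : Fin (m + 1)) (tensor (m + 1) 1 χ f) x =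
      ∫ s, χ (fun _ => s) * f (Fin.cons s x) ∂σ := by
  rw [contract_apply]
  congr 1
  funext s
  rw [tensor_one_apply]
  simp

theorem sq_integral_mul_le {X : Type*} [MeasurableSpace X] (μ : Measure X) (u v : X → ℝ)
    (hu : Integrable (fun x => u x ^ 2) μ) (hv : Integrable (fun x => v x ^ 2) μ)
    (huv : Integrable (fun x => u x * v x) μ) :
    (∫ x, u x * v x ∂μ) ^ 2 ≤ (∫ x, u x ^ 2 ∂μ) * ∫ x, v x ^ 2 ∂μ := by
  have key (t : ℝ) : 0 ≤ (∫ x, u x ^ 2 ∂μ) * (t * t) + (2 * ∫ x, u x * v x ∂μ) * t +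
      ∫ x, v x ^ 2 ∂μ := by
    have h : ∫ x, (t * u x + v x) ^ 2 ∂μ = (∫ x, u x ^ 2 ∂μ) * (t * t) +
        (2 * ∫ x, u x * v x ∂μ) * t + ∫ x, v x ^ 2 ∂μ := by
      have : (fun x => (t * u x + v x) ^ 2) =
          fun x => (u x ^ 2 * (t * t) + (u x * v x) * (2 * t)) + v x ^ 2 := by
        funext x; ring
      have i1 : Integrable (fun x => u x ^ 2 * (t * t) + (u x * v x) * (2 * t)) μ :=
        (hu.mul_const _).add (huv.mul_const _)
      rw [this, integral_add i1 hv,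
        integral_add (hu.mul_const _) (huv.mul_const _), integral_mul_const, integral_mul_const]
      ring
    rw [← h]
    exact integral_nonneg fun x => sq_nonneg _
  have := discrim_le_zero key
  rw [discrim] at this
  nlinarith

theorem norm_annihilate_le (m : ℕ) (χ : Test T 1) (f : Test T (m + 1)) :
    ‖toL2 σ m (contract σ (0 : Fin (m + 1)) (tensor (m + 1) 1 χ f))‖ ≤
      √(∫ s, χ (fun _ => s) ^ 2 ∂σ) * ‖toL2 σ (m + 1) f‖ := by
  refine norm_toL2_le σ _ _ (Real.sqrt_nonneg _) ?_
  rw [Real.sq_sqrt (integral_nonneg fun s => sq_nonneg _)]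
  have hint : Integrable (fun z : T × (Fin m → T) => f (Fin.cons z.1 z.2) ^ 2)
      (σ.prod (Measure.pi fun _ => σ)) := by
    have h := (measurePreserving_piFinSuccAbove (fun _ : Fin (m + 1) => σ) 0)
    rw [← h.integrable_comp_emb (MeasurableEquiv.measurableEmbedding _)]
    convert integrable_sq σ _ f using 2 with x
    simp
  have e1 : ∫ x, f x ^ 2 ∂Measure.pi (fun _ => σ) =
      ∫ x : Fin m → T, ∫ s, f (Fin.cons s x) ^ 2 ∂σ ∂Measure.pi (fun _ => σ) := by
    rw [← integral_prod_symm _ hint, ← integral_succ σ m fun s y => f (Fin.cons s y) ^ 2]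
    simp
  rw [e1, ← integral_const_mul]
  refine integral_mono (integrable_sq σ _ _) (hint.integral_prod_right.const_mul _) fun x => ?_
  simp only [contract_zero_tensor]
  have hcs : Continuous fun s : T => (Fin.cons s x : Fin (m + 1) → T) := by fun_prop
  have hs (g : Test T (m + 1)) : HasCompactSupport fun s : T => g (Fin.cons s x) := by
    simpa using hasCompactSupport_of_leftInverse g (fun s : T => (Fin.cons s x : Fin (m + 1) → T))
      (fun y => y 0) (by fun_prop) (fun s => by simp) fun _ => 1
  have hχ : HasCompactSupport fun s : T => χ (fun _ => s) := by
    simpa using hasCompactSupport_of_leftInverse χ (fun (s : T) (_ : Fin 1) => s)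
      (fun y => y 0) (by fun_prop) (fun s => by simp) fun _ => 1
  refine sq_integral_mul_le σ _ _ ?_ ?_ ?_
  · exact Continuous.integrable_of_hasCompactSupport (by fun_prop)
      (hχ.comp_left (g := fun y : ℝ => y ^ 2) (by simp))
  · exact Continuous.integrable_of_hasCompactSupport (by fun_prop)
      ((hs f).comp_left (g := fun y : ℝ => y ^ 2) (by simp))
  · exact Continuous.integrable_of_hasCompactSupport (by fun_prop) (hs f).mul_left

end

section

variable {T : Type*} [TopologicalSpace T] [T2Space T]
variable [SecondCountableTopology T] [LocallyCompactSpace T] [MeasurableSpace T] [BorelSpace T]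
  (σ : Measure T) [IsFiniteMeasureOnCompacts σ] (c : C(T, ℝ))

theorem toFock_apply (p : TestSeq T) (m : ℕ) : toFock σ p m = toL2 σ m (p m) := by
  induction p using DirectSum.induction_on with
  | zero => simp
  | of i f =>
    rw [← DirectSum.lof_eq_of ℝ, toFock, DirectSum.toModule_lof]
    by_cases h : m = i
    · subst h
      rw [DirectSum.lof_apply]
      exact lp.single_apply_self 2 m _
    · rw [DirectSum.lof_eq_of, DirectSum.of_eq_of_ne _ _ _ h, map_zero]
      exact lp.single_apply_ne 2 i _ h
  | add p q hp hq => simp [hp, hq]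

theorem hasSum_toFock (p : TestSeq T) :
    HasSum (fun m => ‖toL2 σ m (p m)‖ ^ 2) (‖toFock σ p‖ ^ 2) := by
  have := lp.hasSum_norm (p := 2) (by norm_num) (toFock σ p)
  simpa [toFock_apply] using this

theorem norm_toFock_le_of_up (p q : TestSeq T) {C : ℝ} (hC : 0 ≤ C) (h0 : q 0 = 0)
    (h : ∀ m, ‖toL2 σ (m + 1) (q (m + 1))‖ ≤ C * ‖toL2 σ m (p m)‖) :
    ‖toFock σ q‖ ≤ C * ‖toFock σ p‖ := by
  rw [← pow_le_pow_iff_left₀ (norm_nonneg _) (by positivity) two_ne_zero, mul_pow]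
  have hq := (hasSum_toFock σ q)
  rw [← hasSum_nat_add_iff' 1] at hq
  simp only [Finset.range_one, Finset.sum_singleton, h0, map_zero, norm_zero] at hq
  have := hasSum_le (fun m => ?_) hq ((hasSum_toFock σ p).mul_left (C ^ 2))
  · simpa using this
  · rw [← mul_pow]
    exact pow_le_pow_left₀ (norm_nonneg _) (h m) 2

theorem norm_toFock_le_of_same (p q : TestSeq T) {C : ℝ} (hC : 0 ≤ C)
    (h : ∀ m, ‖toL2 σ m (q m)‖ ≤ C * ‖toL2 σ m (p m)‖) :
    ‖toFock σ q‖ ≤ C * ‖toFock σ p‖ := by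
  rw [← pow_le_pow_iff_left₀ (norm_nonneg _) (by positivity) two_ne_zero, mul_pow]
  refine hasSum_le (fun m => ?_) (hasSum_toFock σ q) ((hasSum_toFock σ p).mul_left (C ^ 2))
  rw [← mul_pow]
  exact pow_le_pow_left₀ (norm_nonneg _) (h m) 2

theorem norm_toFock_le_of_down (p q : TestSeq T) {C : ℝ} (hC : 0 ≤ C)
    (h : ∀ m, ‖toL2 σ m (q m)‖ ≤ C * ‖toL2 σ (m + 1) (p (m + 1))‖) :
    ‖toFock σ q‖ ≤ C * ‖toFock σ p‖ := by
  rw [← pow_le_pow_iff_left₀ (norm_nonneg _) (by positivity) two_ne_zero, mul_pow]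
  have hp := (hasSum_toFock σ p)
  rw [← hasSum_nat_add_iff' 1] at hp
  simp only [Finset.range_one, Finset.sum_singleton] at hp
  have := hasSum_le (fun m => ?_) (hasSum_toFock σ q) (hp.mul_left (C ^ 2))
  · refine this.trans (mul_le_mul_of_nonneg_left ?_ (sq_nonneg _))
    linarith [sq_nonneg ‖toL2 σ 0 (p 0)‖]
  · rw [← mul_pow]
    exact pow_le_pow_left₀ (norm_nonneg _) (h m) 2

/-- creation part of `⟨ω, χ⟩` -/
def createCore (χ : Test T 1) : TestSeq T →ₗ[ℝ] TestSeq T :=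
  DirectSum.toModule ℝ ℕ _ fun m =>
    DirectSum.lof ℝ ℕ (fun n => Test T n) (m + 1) ∘ₗ tensor m 1 χ

/-- neutral part of `⟨ω, χ⟩` -/
def neutralCore (χ : Test T 1) : TestSeq T →ₗ[ℝ] TestSeq T :=
  DirectSum.toModule ℝ ℕ _ fun
    | 0 => 0
    | m + 1 => DirectSum.lof ℝ ℕ (fun n => Test T n) (m + 1) ∘ₗ diag c 0 ∘ₗ tensor (m + 1) 1 χ

/-- annihilation part of `⟨ω, χ⟩` -/
def annihilateCore (χ : Test T 1) : TestSeq T →ₗ[ℝ] TestSeq T :=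
  DirectSum.toModule ℝ ℕ _ fun
    | 0 => 0
    | m + 1 => DirectSum.lof ℝ ℕ (fun n => Test T n) m ∘ₗ contract σ 0 ∘ₗ tensor (m + 1) 1 χ

theorem wordCore_one (χ : Test T 1) :
    wordCore σ c 1 χ = createCore χ + neutralCore c χ + annihilateCore σ χ := by
  refine DirectSum.linearMap_ext ℝ fun m => LinearMap.ext fun f => ?_
  cases m with
  | zero =>
    simp only [LinearMap.comp_apply, LinearMap.add_apply, wordCore_lof]
    simp [createCore, neutralCore, annihilateCore, act_succ_one, act_zero]
  | succ m =>
    simp only [LinearMap.comp_apply, LinearMap.add_apply, wordCore_lof]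
    rw [act_succ]
    simp [createCore, neutralCore, annihilateCore, act_zero, add_assoc]

theorem lof_apply (i m : ℕ) (f : Test T i) :
    DirectSum.lof ℝ ℕ (fun n => Test T n) i f m = if h : i = m then h ▸ f else 0 := by
  by_cases h : i = m
  · subst h; simp
  · simp [h, DirectSum.lof_eq_of, DirectSum.of_eq_of_ne _ _ _ (Ne.symm h)]

theorem eq_sum_lof (q : TestSeq T) (s : Finset ℕ) (hs : ∀ m ∉ s, q m = 0) :
    q = ∑ m ∈ s, DirectSum.lof ℝ ℕ (fun n => Test T n) m (q m) := by
  refine DFinsupp.ext fun k => ?_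
  rw [DFinsupp.finsetSum_apply]
  by_cases hk : k ∈ s
  · rw [Finset.sum_eq_single k, DirectSum.lof_apply]
    · intro b _ hb
      rw [DirectSum.lof_eq_of, DirectSum.of_eq_of_ne _ _ _ hb.symm]
    · exact fun h => absurd hk h
  · rw [hs k hk, Finset.sum_eq_zero]
    intro b hb
    rw [DirectSum.lof_eq_of, DirectSum.of_eq_of_ne]
    rintro rfl
    exact hk hb

theorem createCore_zero (χ : Test T 1) (p : TestSeq T) : createCore χ p 0 = 0 := by
  induction p using DirectSum.induction_on with
  | zero => simp
  | of i f => 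
    rw [← DirectSum.lof_eq_of ℝ, createCore, DirectSum.toModule_lof, LinearMap.comp_apply,
      lof_apply, dif_neg (by omega)]
  | add p q hp hq => simp [hp, hq]

theorem createCore_succ (χ : Test T 1) (p : TestSeq T) (m : ℕ) :
    createCore χ p (m + 1) = tensor m 1 χ (p m) := by
  induction p using DirectSum.induction_on with
  | zero => simp
  | of i f => 
    rw [← DirectSum.lof_eq_of ℝ, createCore, DirectSum.toModule_lof, LinearMap.comp_apply]
    by_cases h : i = m
    · subst h; simp
    · rw [lof_apply, lof_apply, dif_neg (by omega), dif_neg h, map_zero]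
  | add p q hp hq => simp [hp, hq]

theorem neutralCore_zero (χ : Test T 1) (p : TestSeq T) : neutralCore c χ p 0 = 0 := by
  induction p using DirectSum.induction_on with
  | zero => simp
  | of i f => 
    rw [← DirectSum.lof_eq_of ℝ, neutralCore, DirectSum.toModule_lof]
    cases i with
    | zero => simp
    | succ i => rw [LinearMap.comp_apply, lof_apply, dif_neg (by omega)]
  | add p q hp hq => simp [hp, hq]

theorem neutralCore_succ (χ : Test T 1) (p : TestSeq T) (m : ℕ) :
    neutralCore c χ p (m + 1) = diag c (0 : Fin (m + 1)) (tensor (m + 1) 1 χ (p (m + 1))) := by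
  induction p using DirectSum.induction_on with
  | zero => simp
  | of i f => 
    rw [← DirectSum.lof_eq_of ℝ, neutralCore, DirectSum.toModule_lof]
    cases i with
    | zero => simp [lof_apply]
    | succ i =>
      rw [LinearMap.comp_apply]
      by_cases h : i = m
      · subst h; simp
      · rw [lof_apply, lof_apply, dif_neg (by omega), dif_neg (by omega), map_zero, map_zero]
  | add p q hp hq => simp [hp, hq]

theorem annihilateCore_apply (χ : Test T 1) (p : TestSeq T) (m : ℕ) :
    annihilateCore σ χ p m = contract σ (0 : Fin (m + 1)) (tensor (m + 1) 1 χ (p (m + 1))) := by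
  induction p using DirectSum.induction_on with
  | zero => simp
  | of i f => 
    rw [← DirectSum.lof_eq_of ℝ, annihilateCore, DirectSum.toModule_lof]
    cases i with
    | zero => simp [lof_apply]
    | succ i =>
      rw [LinearMap.comp_apply]
      by_cases h : i = m
      · subst h; simp
      · rw [lof_apply, lof_apply, dif_neg (by omega), dif_neg (by omega), map_zero, map_zero]
  | add p q hp hq => simp [hp, hq]

theorem wordCore_one_bound (χ : Test T 1) :
    ∃ C, 0 ≤ C ∧ ∀ p, ‖toFock σ (wordCore σ c 1 χ p)‖ ≤ C * ‖toFock σ p‖ := by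
  have hχ : HasCompactSupport fun s : T => c s * χ (fun _ => s) := by
    exact hasCompactSupport_of_leftInverse χ (fun (s : T) (_ : Fin 1) => s)
      (fun y => y 0) (by fun_prop) (fun s => by simp) c
  obtain ⟨Λ, hΛ⟩ := Continuous.bounded_above_of_compact_support (by fun_prop) hχ
  set a := √(∫ s, χ (fun _ => s) ^ 2 ∂σ) with ha
  have ha0 : 0 ≤ a := Real.sqrt_nonneg _
  refine ⟨a + |Λ| + a, by positivity, fun p => ?_⟩
  rw [wordCore_one, LinearMap.add_apply, LinearMap.add_apply, map_add, map_add, add_mul, add_mul]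
  refine (norm_add_le _ _).trans (add_le_add ((norm_add_le _ _).trans (add_le_add ?_ ?_)) ?_)
  · refine norm_toFock_le_of_up σ _ _ ha0 (createCore_zero χ p) fun m => ?_
    rw [createCore_succ]
    exact norm_create_le σ m χ _
  · refine norm_toFock_le_of_same σ _ _ (abs_nonneg _) fun m => ?_
    cases m with
    | zero => rw [neutralCore_zero]; simp; positivity
    | succ m =>
      rw [neutralCore_succ]
      exact norm_neutral_le σ c m χ _ (fun s => (hΛ s).trans (le_abs_self _)) (abs_nonneg _)
  · refine norm_toFock_le_of_down σ _ _ ha0 fun m => ?_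
    rw [annihilateCore_apply]
    exact norm_annihilate_le σ m χ _

theorem norm_le_of_absLe {p q : TestSeq T} (h : AbsLe p q) : ‖toFock σ p‖ ≤ ‖toFock σ q‖ := by
  have := norm_toFock_le_of_same σ q p zero_le_one fun m => ?_
  · simpa using this
  · refine norm_toL2_le σ _ _ zero_le_one ?_
    rw [one_pow, one_mul]
    refine integral_mono (integrable_sq σ _ _) (integrable_sq σ _ _) fun x => ?_
    exact sq_le_sq' (by linarith [neg_abs_le (p m x), h m x]) ((le_abs_self _).trans (h m x))

/-- absolute values of all entries -/
def absSeq (p : TestSeq T) : TestSeq T :=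
  DFinsupp.mapRange (fun n (f : Test T n) => f ⊔ -f) (fun n => by simp) p

theorem absSeq_apply (p : TestSeq T) (m : ℕ) (x : Fin m → T) : absSeq p m x = |p m x| := by
  have : absSeq p m = p m ⊔ -p m := DFinsupp.mapRange_apply _ _ _ _
  rw [this]; rfl

theorem norm_absSeq (p : TestSeq T) : ‖toFock σ (absSeq p)‖ ≤ ‖toFock σ p‖ := by
  have := norm_toFock_le_of_same σ p (absSeq p) zero_le_one fun m => ?_
  · simpa using this
  · refine norm_toL2_le σ _ _ zero_le_one ?_
    simp [absSeq_apply]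

/-- `χ ⊗ ⋯ ⊗ χ ⊗ f` -/
def tensorPow (χ : Test T 1) (m : ℕ) (f : Test T m) : (n : ℕ) → Test T (m + n)
  | 0 => f
  | n + 1 => tensor (m + n) 1 χ (tensorPow χ m f n)

theorem act_tensorPow (χ : Test T 1) (m : ℕ) (f : Test T m) (n : ℕ) :
    act σ c n (m + n) (tensorPow χ m f n) =
      ((wordCore σ c 1 χ) ^ n) (DirectSum.lof ℝ ℕ (fun n => Test T n) m f) := by
  induction n with
  | zero => exact act_zero σ c m f
  | succ n ih =>
    have := act_tensor σ c χ n (m + n) (by omega) (tensorPow χ m f n)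
    rw [pow_succ', Module.End.mul_apply, ← ih]
    exact this

theorem tensorPow_apply (χ : Test T 1) (m : ℕ) (f : Test T m) (n : ℕ) (x : Fin (m + n) → T) :
    tensorPow χ m f n x = (∏ i : Fin n, χ fun _ => x ⟨i, by omega⟩) *
      f fun i => x ⟨n + i, by omega⟩ := by
  induction n with
  | zero => 
    simp [tensorPow]
  | succ n ih =>
    have := tensor_one_apply (m + n) χ (tensorPow χ m f n) x
    rw [tensorPow, this, ih, Fin.prod_univ_succ, mul_assoc]
    congr 2
    simp only [Fin.tail]
    congr 1
    funext i
    congr 1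
    ext
    simp
    omega

theorem wordCore_bound (K : Set T) (hK : IsCompact K) (n : ℕ) :
    ∃ C, 0 ≤ C ∧ ∀ (f : Test T n) (M : ℝ), 0 ≤ M → (∀ x, |f x| ≤ M) →
      (∀ x, f x ≠ 0 → ∀ i, x i ∈ K) → ∀ p,
      ‖toFock σ (wordCore σ c n f p)‖ ≤ C * M * ‖toFock σ p‖ := by
  obtain ⟨χ₀, h1, -, hc, h01⟩ :=
    exists_continuous_one_zero_of_isCompact hK isClosed_empty (Set.disjoint_empty K)
  have hχ : HasCompactSupport fun x : Fin 1 → T => χ₀ (x 0) := by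
    simpa using hasCompactSupport_of_leftInverse (⟨χ₀, hc⟩ : C_c(T, ℝ))
      (fun x : Fin 1 → T => x 0) (fun s _ => s) (by fun_prop)
      (fun x => by funext i; rw [Subsingleton.elim i 0]) fun _ => 1
  let χ : Test T 1 := { toFun := fun x => χ₀ (x 0), hasCompactSupport' := hχ }
  have hχ0 (x : Fin 1 → T) : 0 ≤ χ x := (h01 _).1
  have hχ1 (x : Fin 1 → T) (hx : x 0 ∈ K) : χ x = 1 := h1 hx
  obtain ⟨C, hC0, hC⟩ := wordCore_one_bound σ |c| χ
  have hpow (n : ℕ) (p : TestSeq T) :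
      ‖toFock σ (((wordCore σ |c| 1 χ) ^ n) p)‖ ≤ C ^ n * ‖toFock σ p‖ := by
    induction n with
    | zero => simp
    | succ n ih =>
      rw [pow_succ', Module.End.mul_apply, pow_succ', mul_assoc]
      exact (hC _).trans (mul_le_mul_of_nonneg_left ih hC0)
  refine ⟨C ^ n, by positivity, fun f M hM hfM hfK p => ?_⟩
  have hdom : AbsLe (wordCore σ c n f p) (M • ((wordCore σ |c| 1 χ) ^ n) (absSeq p)) := by
    have key (m : ℕ) (g h : Test T m) (hgh : ∀ x, |g x| ≤ h x) :
        AbsLe (wordCore σ c n f (DirectSum.lof ℝ ℕ (fun n => Test T n) m g))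
          (M • ((wordCore σ |c| 1 χ) ^ n) (DirectSum.lof ℝ ℕ (fun n => Test T n) m h)) := by
      rw [wordCore_lof, ← act_tensorPow, ← map_smul]
      refine act_absLe σ c _ _ _ _ fun x => ?_
      rw [tensor_apply, CompactlySupportedContinuousMap.smul_apply, tensorPow_apply, abs_mul,
        smul_eq_mul, ← mul_assoc]
      refine mul_le_mul ?_ (hgh _) (abs_nonneg _)
        (mul_nonneg hM (Finset.prod_nonneg fun i _ => hχ0 _))
      by_cases h0 : f (fun i => x ⟨i, by omega⟩) = 0
      · rw [h0, abs_zero]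
        exact mul_nonneg hM (Finset.prod_nonneg fun i _ => hχ0 _)
      · rw [Finset.prod_eq_one fun i _ => hχ1 _ (hfK _ h0 i), mul_one]
        exact hfM _
    classical
    let s := DFinsupp.support p
    have hp := eq_sum_lof p s fun m hm => by simpa [s] using hm
    have hq := eq_sum_lof (absSeq p) s fun m hm => by
      ext x
      have : p m = 0 := by simpa [s] using hm
      simp [absSeq_apply, this]
    rw [hq]
    conv => rhs; rw [map_sum, Finset.smul_sum]
    conv => lhs; rw [hp, map_sum]
    clear_value s
    clear hp hq
    induction s using Finset.induction_on with
    | empty => simpa using AbsLe.zero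
    | insert a s ha ih =>
      rw [Finset.sum_insert ha, Finset.sum_insert ha]
      exact (key a _ _ fun x => (absSeq_apply p a x).ge).add ih
  refine (norm_le_of_absLe σ hdom).trans ?_
  rw [map_smul, norm_smul, Real.norm_of_nonneg hM, mul_comm (C ^ n), mul_assoc]
  exact mul_le_mul_of_nonneg_left ((hpow n _).trans
    (mul_le_mul_of_nonneg_left (norm_absSeq σ p) (by positivity))) hM

theorem denseRange_toL2 (n : ℕ) : DenseRange (toL2 σ n (T := T)) := by
  refine Metric.denseRange_iff.2 fun v ε hε => ?_
  obtain ⟨g, hg, hgε, hgc, hgm⟩ := (Lp.memLp v).exists_hasCompactSupport_eLpNorm_sub_le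
    (by norm_num) (ε := ENNReal.ofReal (ε / 2)) (by simpa using hε)
  let G : Test T n := { toFun := g, continuous_toFun := hgc, hasCompactSupport' := hg }
  refine ⟨G, ?_⟩
  have h1 : v = (Lp.memLp v).toLp v := (Lp.toLp_coeFn v _).symm
  have h2 : toL2 σ n G = hgm.toLp g := rfl
  rw [h2, dist_eq_norm]
  conv_lhs => rw [h1]
  rw [← MemLp.toLp_sub, Lp.norm_toLp]
  refine lt_of_le_of_lt (ENNReal.toReal_le_of_le_ofReal (by positivity) hgε) (by linarith)

theorem denseRange_toFock : DenseRange (toFock σ (T := T)) := by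
  rw [DenseRange, ← LinearMap.coe_range, Submodule.dense_iff_topologicalClosure_eq_top, eq_top_iff]
  intro v _
  have hs := lp.hasSum_single (p := 2) (by norm_num) v
  refine Submodule.isClosed_topologicalClosure _ |>.mem_of_tendsto hs
    (Filter.Eventually.of_forall fun s => Submodule.sum_mem _ fun n _ => ?_)
  have hc : Continuous fun w : Lp ℝ 2 (Measure.pi fun _ : Fin n => σ) =>
    (lp.single 2 n w : Fock σ) := 
    (lp.isometry_single (p := 2)
      (E := fun n : ℕ => Lp ℝ 2 (Measure.pi fun _ : Fin n => σ)) n).continuous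
  have : lp.single 2 n (v n) ∈ closure (Set.range (toFock σ (T := T))) := by
    refine closure_mono ?_ (image_closure_subset_closure_image hc ⟨v n, denseRange_toL2 σ n _, rfl⟩)
    rintro _ ⟨_, ⟨f, rfl⟩, rfl⟩
    refine ⟨DirectSum.lof ℝ ℕ (fun n => Test T n) n f, ?_⟩
    rw [toFock, DirectSum.toModule_lof]
    rfl
  rw [← LinearMap.coe_range, ← Submodule.topologicalClosure_coe] at this
  exact this

end

section

variable {T : Type*} [TopologicalSpace T] [T2Space T]
variable [SecondCountableTopology T] [LocallyCompactSpace T] [MeasurableSpace T] [BorelSpace T]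
  (σ : Measure T) [IsFiniteMeasureOnCompacts σ] (c : C(T, ℝ))

theorem exists_compact_bound {n : ℕ} (f : Test T n) : ∃ (K : Set T) (M : ℝ), IsCompact K ∧ 0 ≤ M ∧
    (∀ x, |f x| ≤ M) ∧ ∀ x, f x ≠ 0 → ∀ i, x i ∈ K := by
  obtain ⟨M, hM⟩ := Continuous.bounded_above_of_compact_support f.continuous f.hasCompactSupport
  refine ⟨⋃ i, (fun x : Fin n → T => x i) '' tsupport f, |M|, ?_, abs_nonneg _,
    fun x => (hM x).trans (le_abs_self _), fun x hx i => ?_⟩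
  · exact isCompact_iUnion fun i => f.hasCompactSupport.isCompact.image (by fun_prop)
  · exact Set.mem_iUnion.2 ⟨i, x, subset_tsupport _ hx, rfl⟩

/-- Continuous extension of `A` along `e`, which is meant to have dense range: the bounded operator
with `extendCore e A (e x) = A x`, if there is one. -/
def extendCore {β : ℕ → Type*} [∀ n, AddCommGroup (β n)] [∀ n, Module ℝ (β n)] {H : Type*}
    [NormedAddCommGroup H] [NormedSpace ℝ H] [CompleteSpace H] (e A : (⨁ n, β n) →ₗ[ℝ] H) :
    H →L[ℝ] H :=
  A.extendOfNorm e

theorem extendCore_apply {β : ℕ → Type*} [∀ n, AddCommGroup (β n)] [∀ n, Module ℝ (β n)]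
    {H : Type*} [NormedAddCommGroup H] [NormedSpace ℝ H] [CompleteSpace H]
    (e A : (⨁ n, β n) →ₗ[ℝ] H) (he : DenseRange e) (h : ∃ C, ∀ x, ‖A x‖ ≤ C * ‖e x‖)
    (x : ⨁ n, β n) : extendCore e A (e x) = A x :=
  LinearMap.extendOfNorm_eq he h x

theorem norm_extendCore_le {β : ℕ → Type*} [∀ n, AddCommGroup (β n)] [∀ n, Module ℝ (β n)]
    {H : Type*} [NormedAddCommGroup H] [NormedSpace ℝ H] [CompleteSpace H]
    (e A : (⨁ n, β n) →ₗ[ℝ] H) (he : DenseRange e) {C : ℝ} (hC : 0 ≤ C)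
    (h : ∀ x, ‖A x‖ ≤ C * ‖e x‖) : ‖extendCore e A‖ ≤ C :=
  LinearMap.opNorm_extendOfNorm_le he hC h

theorem wordCore_bounded (n : ℕ) (f : Test T n) :
    ∃ C, ∀ p, ‖(toFock σ ∘ₗ wordCore σ c n f) p‖ ≤ C * ‖toFock σ p‖ := by
  obtain ⟨K, M, hK, hM0, hM, hfK⟩ := exists_compact_bound f
  obtain ⟨C, -, hC⟩ := wordCore_bound σ c K hK n
  exact ⟨C * M, fun p => hC f M hM0 hM hfK p⟩

theorem wordCore_add (n : ℕ) (f g : Test T n) :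
    wordCore σ c n (f + g) = wordCore σ c n f + wordCore σ c n g := by
  refine DirectSum.linearMap_ext ℝ fun m => LinearMap.ext fun h => ?_
  simp only [LinearMap.comp_apply, LinearMap.add_apply, wordCore_lof, map_add]

theorem wordCore_smul (n : ℕ) (a : ℝ) (f : Test T n) :
    wordCore σ c n (a • f) = a • wordCore σ c n f := by
  refine DirectSum.linearMap_ext ℝ fun m => LinearMap.ext fun h => ?_
  simp only [LinearMap.comp_apply, LinearMap.smul_apply, wordCore_lof, map_smul]

theorem extendCore_wordCore (n : ℕ) (f : Test T n) (p : TestSeq T) :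
    extendCore (toFock σ) (toFock σ ∘ₗ wordCore σ c n f) (toFock σ p) =
      toFock σ (wordCore σ c n f p) :=
  extendCore_apply (β := Test T) _ _ (denseRange_toFock σ) (wordCore_bounded σ c n f) p

theorem clm_ext {A B : Fock σ →L[ℝ] Fock σ} (h : ∀ p, A (toFock σ p) = B (toFock σ p)) : A = B :=
  ContinuousLinearMap.coeFn_injective
    ((denseRange_toFock σ).equalizer A.continuous B.continuous (funext h))

/-- The bounded operator `⟨ω^{⊗ n}, f⟩` in the Fock space, as a linear function of `f`. -/
def monomial (n : ℕ) : Test T n →ₗ[ℝ] Fock σ →L[ℝ] Fock σ where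
  toFun f := extendCore (toFock σ) (toFock σ ∘ₗ wordCore σ c n f)
  map_add' f g := clm_ext σ fun p => by
    rw [_root_.add_apply, extendCore_wordCore, extendCore_wordCore, extendCore_wordCore,
      wordCore_add, LinearMap.add_apply, map_add]
  map_smul' a f := clm_ext σ fun p => by
    rw [RingHom.id_apply, _root_.smul_apply, extendCore_wordCore, extendCore_wordCore,
      wordCore_smul, LinearMap.smul_apply, map_smul]

theorem monomial_toFock (n : ℕ) (f : Test T n) (p : TestSeq T) :
    monomial σ c n f (toFock σ p) = toFock σ (wordCore σ c n f p) :=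
  extendCore_wordCore σ c n f p

theorem monomial_bound (K : Set T) (hK : IsCompact K) (n : ℕ) :
    ∃ C, 0 ≤ C ∧ ∀ (f : Test T n) (M : ℝ), 0 ≤ M → (∀ x, |f x| ≤ M) →
      (∀ x, f x ≠ 0 → ∀ i, x i ∈ K) → ‖monomial σ c n f‖ ≤ C * M := by
  obtain ⟨C, hC0, hC⟩ := wordCore_bound σ c K hK n
  exact ⟨C, hC0, fun f M hM0 hM hfK => norm_extendCore_le (β := Test T) _ _ (denseRange_toFock σ)
    (by positivity) fun p => hC f M hM0 hM hfK p⟩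

theorem monomial_zero (f : Test T 0) : monomial σ c 0 f = f Fin.elim0 • 1 := by
  refine clm_ext σ fun p => ?_
  rw [monomial_toFock, _root_.smul_apply, one_apply_eq_self, ← map_smul]
  congr 1
  suffices wordCore σ c 0 f = f Fin.elim0 • LinearMap.id by rw [this]; rfl
  refine DirectSum.linearMap_ext ℝ fun m => LinearMap.ext fun g => ?_
  rw [LinearMap.comp_apply, wordCore_lof, LinearMap.comp_apply, LinearMap.smul_apply,
    LinearMap.id_apply, ← map_smul]
  refine (act_zero σ c m _).trans (congrArg _ ?_)
  ext x
  rw [CompactlySupportedContinuousMap.smul_apply, tensor_apply, smul_eq_mul]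
  congr 2
  · exact Subsingleton.elim _ _
  · funext i
    congr 1
    ext
    simp

/-- `⟨ω^{⊗ (n+1)}, χ ⊗ f⟩ = ⟨ω, χ⟩ ⟨ω^{⊗ n}, f⟩` -/
theorem monomial_tensor (n : ℕ) (χ : Test T 1) (f : Test T n) :
    monomial σ c (n + 1) (tensor n 1 χ f) = monomial σ c 1 χ * monomial σ c n f := by
  refine clm_ext σ fun p => ?_
  rw [mul_apply_eq_comp, monomial_toFock, monomial_toFock, monomial_toFock]
  congr 1
  suffices wordCore σ c (n + 1) (tensor n 1 χ f) = wordCore σ c 1 χ ∘ₗ wordCore σ c n f by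
    rw [this]; rfl
  refine DirectSum.linearMap_ext ℝ fun m => LinearMap.ext fun g => ?_
  rw [LinearMap.comp_apply, wordCore_lof, LinearMap.comp_apply, LinearMap.comp_apply, wordCore_lof,
    ← act_tensor σ c χ n (m + n) (by omega)]
  refine congrArg (act σ c (n + 1) (m + n + 1)) ?_
  ext x
  have e1 := tensor_one_apply n χ f (fun i => x ⟨i, by omega⟩)
  have e2 := tensor_one_apply (m + n) χ (tensor m n f g) x
  rw [e2]
  have e3 : (tensor m (n + 1) (tensor n 1 χ f) g) x = tensor n 1 χ f (fun i => x ⟨i, by omega⟩) *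
    g (fun i => x ⟨(n + 1) + i, by omega⟩) := rfl
  rw [e3, e1, tensor_apply, mul_assoc]
  congr 3
  funext i
  simp only [Fin.tail]
  congr 1
  ext
  simp
  omega

/-- The polynomial `∑ n, ⟨ω^{⊗ n}, f⁽ⁿ⁾⟩`. -/
def polynomial : TestSeq T →ₗ[ℝ] Fock σ →L[ℝ] Fock σ :=
  DirectSum.toModule ℝ ℕ _ (monomial σ c)

/-- The space `CP` of continuous polynomials in `ω`. -/
def CP : Submodule ℝ (Fock σ →L[ℝ] Fock σ) := LinearMap.range (polynomial σ c)

theorem polynomial_lof (n : ℕ) (f : Test T n) :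
    polynomial σ c (DirectSum.lof ℝ ℕ (fun n => Test T n) n f) = monomial σ c n f := by
  simp [polynomial]

theorem act_top : ∀ (j N : ℕ) (f : Test T N),
    act σ c j N f N = f ∧ ∀ m, N < m → act σ c j N f m = 0
  | 0, N, f => by
    rw [act_zero]
    refine ⟨by simp, fun m hm => ?_⟩
    rw [lof_apply, dif_neg (by omega)]
  | j + 1, 0, f => act_top j 0 f
  | j + 1, 1, f => act_top j 1 f
  | j + 1, N + 2, f => by
    rw [act_succ]
    have h1 := act_top j (N + 2) f
    by_cases h : j < N + 1
    · have h2 := act_top j (N + 1) (diag c ⟨j, h⟩ f)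
      have h3 := act_top j N (contract σ ⟨j, h⟩ f)
      rw [dif_pos h]
      constructor
      · simp [h1.1, h2.2 (N + 2) (by omega), h3.2 (N + 2) (by omega)]
      · intro m hm
        simp [h1.2 m hm, h2.2 m (by omega), h3.2 m (by omega)]
    · rw [dif_neg h, add_zero]
      exact h1

theorem toL2_injective [σ.IsOpenPosMeasure] (n : ℕ) : Function.Injective (toL2 σ n (T := T)) := by
  rw [injective_iff_map_eq_zero]
  intro f hf
  have h : (toL2 σ n f : (Fin n → T) → ℝ) =ᵐ[Measure.pi fun _ => σ] f :=
    MemLp.coeFn_toLp (f.continuous.memLp_of_hasCompactSupport f.hasCompactSupport)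
  rw [hf] at h
  have h2 : (f : (Fin n → T) → ℝ) =ᵐ[Measure.pi fun _ => σ] fun _ => 0 :=
    h.symm.trans (Lp.coeFn_zero _ _ _)
  have := Continuous.ae_eq_iff_eq (Measure.pi fun _ : Fin n => σ) f.continuous continuous_const
    |>.1 h2
  ext x
  exact congrFun this x

theorem toFock_injective [σ.IsOpenPosMeasure] : Function.Injective (toFock σ (T := T)) := by
  rw [injective_iff_map_eq_zero]
  intro p hp
  refine DFinsupp.ext fun m => toL2_injective σ m ?_
  have := toFock_apply σ p m
  rw [hp] at this
  simpa using this.symm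

theorem eq_zero_of_polynomial_eq_zero [σ.IsOpenPosMeasure] (p : TestSeq T)
    (hp : polynomial σ c p = 0) : p = 0 := by
  classical
  by_contra hne
  have hs : (DFinsupp.support p).Nonempty := by
    rw [Finset.nonempty_iff_ne_empty]
    simpa using hne
  set n := (DFinsupp.support p).max' hs
  have hn : p n ≠ 0 := by simpa using (DFinsupp.support p).max'_mem hs
  have hlt (m : ℕ) (hm : m ∈ DFinsupp.support p) : m ≤ n := Finset.le_max' _ m hm
  let one : Test T 0 := { toFun := fun _ => 1, hasCompactSupport' := HasCompactSupport.of_compactSpace _ }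
  let Ω : TestSeq T := DirectSum.lof ℝ ℕ (fun n => Test T n) 0 one
  have h1 : polynomial σ c p (toFock σ Ω) = 0 := by rw [hp]; rfl
  rw [eq_sum_lof p (DFinsupp.support p) (fun m hm => by simpa using hm), map_sum,
    _root_.sum_apply] at h1
  simp only [polynomial_lof, monomial_toFock, Ω, wordCore_lof] at h1
  rw [← map_sum, ← map_zero (toFock σ)] at h1
  have h2 := toFock_injective σ h1
  have h3 := DFinsupp.ext_iff.1 h2 (0 + n)
  rw [DFinsupp.finsetSum_apply, Finset.sum_eq_single n, (act_top σ c n (0 + n) _).1] at h3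
  · apply hn
    ext x
    have h4 := DFunLike.congr_fun h3 (fun i : Fin (0 + n) => x ⟨i, by omega⟩)
    rw [tensor_apply] at h4
    simpa [one] using h4
  · intro m hm hmn
    exact (act_top σ c m (0 + m) _).2 _ (by have := hlt m hm; omega)
  · intro h
    exact absurd (by simpa using hn) h

theorem polynomial_injective [σ.IsOpenPosMeasure] : Function.Injective (polynomial σ c) :=
  (injective_iff_map_eq_zero _).2 (eq_zero_of_polynomial_eq_zero σ c)

/-- A continuous polynomial has exactly one representation as `∑ n, ⟨ω^{⊗ n}, f⁽ⁿ⁾⟩`. -/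
def polynomialEquiv [σ.IsOpenPosMeasure] : TestSeq T ≃ₗ[ℝ] CP σ c :=
  LinearEquiv.ofInjective (polynomial σ c) (polynomial_injective σ c)

/-- `⟨ω^{⊗ j} ⊗ P^{(r)}(ω), f⟩` for a test function `f` of `N = j + r` variables (no other value of
`N` is of interest), where the kernels `P^{(r)}(ω)` are given by the recursion
`P^{(0)}(ω) = 1`, `P^{(1)}(ω)(t) = ω(t)`,
`P^{(r)}(ω)(t_1, …, t_r) = ω(t_1) P^{(r-1)}(ω)(t_2, …, t_r)`
`  - δ(t_1, t_2) λ(t_1) P^{(r-1)}(ω)(t_2, …, t_r) - δ(t_1, t_2) P^{(r-2)}(ω)(t_3, …, t_r)`. -/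
def mixed : (r j N : ℕ) → Test T N →ₗ[ℝ] Fock σ →L[ℝ] Fock σ
  | r + 2, j, N + 2 => mixed (r + 1) (j + 1) (N + 2) -
      if h : j < N + 1 then
        mixed (r + 1) j (N + 1) ∘ₗ diag c ⟨j, h⟩ + mixed r j N ∘ₗ contract σ ⟨j, h⟩
      else 0
  | _, _, N => monomial σ c N

/-- `∑ n, ⟨P^{(n)}(ω), f⁽ⁿ⁾⟩` -/
def orthPolynomial : TestSeq T →ₗ[ℝ] Fock σ →L[ℝ] Fock σ :=
  DirectSum.toModule ℝ ℕ _ fun n => mixed σ c n 0 n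

theorem mixed_eq : ∀ (r j N : ℕ) (f : Test T N), ∃ q : TestSeq T, (∀ m, N ≤ m → q m = 0) ∧
    mixed σ c r j N f = monomial σ c N f + polynomial σ c q
  | 0, j, N, f => ⟨0, by simp, by rw [mixed] <;> simp⟩
  | 1, j, N, f => ⟨0, by simp, by rw [mixed] <;> simp⟩
  | r + 2, j, 0, f => ⟨0, by simp, by rw [mixed] <;> simp⟩
  | r + 2, j, 1, f => ⟨0, by simp, by rw [mixed] <;> simp⟩
  | r + 2, j, N + 2, f => by
    obtain ⟨q1, h1, e1⟩ := mixed_eq (r + 1) (j + 1) (N + 2) f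
    by_cases h : j < N + 1
    · obtain ⟨q2, h2, e2⟩ := mixed_eq (r + 1) j (N + 1) (diag c ⟨j, h⟩ f)
      obtain ⟨q3, h3, e3⟩ := mixed_eq r j N (contract σ ⟨j, h⟩ f)
      refine ⟨q1 - (DirectSum.lof ℝ ℕ (fun n => Test T n) (N + 1) (diag c ⟨j, h⟩ f) + q2 +
        (DirectSum.lof ℝ ℕ (fun n => Test T n) N (contract σ ⟨j, h⟩ f) + q3)), fun m hm => ?_, ?_⟩
      · simp [h1 m hm, h2 m (by omega), h3 m (by omega), lof_apply, show N + 1 ≠ m by omega,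
          show N ≠ m by omega]
      · rw [mixed, dif_pos h]
        simp only [LinearMap.sub_apply, LinearMap.add_apply, LinearMap.comp_apply, e1, e2, e3,
          map_sub, map_add, polynomial_lof]
        abel
    · exact ⟨q1, h1, by rw [mixed, dif_neg h, sub_zero, e1]⟩

theorem orthPolynomial_lof (n : ℕ) (f : Test T n) :
    orthPolynomial σ c (DirectSum.lof ℝ ℕ (fun n => Test T n) n f) = mixed σ c n 0 n f := by
  simp [orthPolynomial]

theorem exists_orthPolynomial_eq (n : ℕ) : ∀ p : TestSeq T, (∀ m, n ≤ m → p m = 0) →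
    ∃ q : TestSeq T, (∀ m, n ≤ m → q m = 0) ∧ polynomial σ c p = orthPolynomial σ c q := by
  induction n with
  | zero =>
    intro p hp
    obtain rfl : p = 0 := DFinsupp.ext fun m => hp m (by omega)
    exact ⟨0, by simp, by simp⟩
  | succ n ih =>
    intro p hp
    obtain ⟨q, hq, e⟩ := mixed_eq σ c n 0 n (p n)
    obtain ⟨q', hq', e'⟩ := ih (p - DirectSum.lof ℝ ℕ (fun n => Test T n) n (p n) - q) fun m hm => by
      by_cases h : n = m
      · subst h; simp [hq]
      · simp [hp m (by omega), hq m hm, lof_apply, h]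
    refine ⟨q' + DirectSum.lof ℝ ℕ (fun n => Test T n) n (p n), fun m hm => ?_, ?_⟩
    · simp [hq' m (by omega), lof_apply, show n ≠ m by omega]
    · rw [map_add, orthPolynomial_lof, e, ← e', map_sub, map_sub, polynomial_lof]
      abel

theorem exists_polynomial_eq (n : ℕ) (p : TestSeq T) (hp : ∀ m, n < m → p m = 0) :
    ∃ q : TestSeq T, (∀ m, n < m → q m = 0) ∧ q n = p n ∧
      orthPolynomial σ c p = polynomial σ c q := by
  choose q hq e using fun m => mixed_eq σ c m 0 m (p m)
  refine ⟨p + ∑ m ∈ Finset.range (n + 1), q m, fun m hm => ?_, ?_, ?_⟩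
  · rw [DirectSum.add_apply, DFinsupp.finsetSum_apply, hp m hm, Finset.sum_eq_zero, zero_add]
    intro k hk
    exact hq k m (by simp at hk; omega)
  · rw [DirectSum.add_apply, DFinsupp.finsetSum_apply, Finset.sum_eq_zero, add_zero]
    intro k hk
    exact hq k n (by simp at hk; omega)
  · have hp' := eq_sum_lof p (Finset.range (n + 1)) fun m hm => hp m (by simp at hm; omega)
    conv_lhs => rw [hp', map_sum]
    rw [map_add, map_sum]
    conv_rhs => rw [hp', map_sum]
    rw [← Finset.sum_add_distrib]
    refine Finset.sum_congr rfl fun m _ => ?_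
    rw [orthPolynomial_lof, e, polynomial_lof]

theorem orthPolynomial_injective [σ.IsOpenPosMeasure] :
    Function.Injective (orthPolynomial σ c) := by
  rw [injective_iff_map_eq_zero]
  intro p hp
  classical
  by_contra hne
  have hs : (DFinsupp.support p).Nonempty := by
    rw [Finset.nonempty_iff_ne_empty]
    simpa using hne
  set n := (DFinsupp.support p).max' hs
  have hn : p n ≠ 0 := by simpa using (DFinsupp.support p).max'_mem hs
  obtain ⟨q, -, hqn, e⟩ := exists_polynomial_eq σ c n p fun m hm => by
    by_contra h
    exact absurd (Finset.le_max' (DFinsupp.support p) m (by simpa using h)) (by omega)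
  rw [hp] at e
  have := eq_zero_of_polynomial_eq_zero σ c q e.symm
  rw [this] at hqn
  exact hn hqn.symm

theorem exists_degree (p : TestSeq T) : ∃ n, ∀ m, n ≤ m → p m = 0 := by
  classical
  refine ⟨(DFinsupp.support p).sup id + 1, fun m hm => ?_⟩
  by_contra h
  have : m ≤ (DFinsupp.support p).sup id :=
    Finset.le_sup (f := id) (by simpa using h : m ∈ DFinsupp.support p)
  omega

theorem range_orthPolynomial : LinearMap.range (orthPolynomial σ c) = CP σ c := by
  refine le_antisymm ?_ ?_
  · rintro _ ⟨p, rfl⟩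
    obtain ⟨n, hn⟩ := exists_degree p
    obtain ⟨q, -, -, e⟩ := exists_polynomial_eq σ c n p fun m hm => hn m hm.le
    exact ⟨q, e.symm⟩
  · rintro _ ⟨p, rfl⟩
    obtain ⟨n, hn⟩ := exists_degree p
    obtain ⟨q, -, e⟩ := exists_orthPolynomial_eq σ c n p hn
    exact ⟨q, e.symm⟩

/-- A continuous polynomial has exactly one representation as `∑ n, ⟨P^{(n)}(ω), f⁽ⁿ⁾⟩`. -/
def orthPolynomialEquiv [σ.IsOpenPosMeasure] : TestSeq T ≃ₗ[ℝ] CP σ c :=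
  LinearEquiv.ofInjective (orthPolynomial σ c) (orthPolynomial_injective σ c) ≪≫ₗ
    LinearEquiv.ofEq _ _ (range_orthPolynomial σ c)

/-- `f⁽ⁿ⁾ ↦ f⁽ⁿ⁾(t, ·)` for `n ≥ 1` and `f⁽⁰⁾ ↦ 0`. -/
def shiftSeq (t : T) : TestSeq T →ₗ[ℝ] TestSeq T :=
  DirectSum.toModule ℝ ℕ _ fun
    | 0 => 0
    | n + 1 => DirectSum.lof ℝ ℕ (fun n => Test T n) n ∘ₗ slice t n

/-- The annihilation operator at the point `t`:
`∂_t ⟨P^{(n)}(ω), f⟩ = ⟨P^{(n-1)}(ω), f(t, ·)⟩`. -/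
def annihilation [σ.IsOpenPosMeasure] (t : T) : Module.End ℝ (CP σ c) :=
  (orthPolynomialEquiv σ c).conj (shiftSeq t)

/-- The free derivative at the point `t`: `D_t ⟨ω^{⊗ n}, f⟩ = [n]_0 ⟨ω^{⊗ (n-1)}, f(t, ·)⟩`. -/
def freeDeriv [σ.IsOpenPosMeasure] (t : T) : Module.End ℝ (CP σ c) :=
  (polynomialEquiv σ c).conj (shiftSeq t)

end

section

/-- Non-crossing partitions of `{1, …, n}`: there are no `a < b < c < d` with `a, c` in one block
and `b, d` in another one. -/
def IsNonCrossing {n : ℕ} (ζ : Finpartition (Finset.univ : Finset (Fin n))) : Prop :=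
  ∀ B ∈ ζ.parts, ∀ B' ∈ ζ.parts, B ≠ B' →
    ∀ a ∈ B, ∀ b ∈ B', ∀ c ∈ B, ∀ d ∈ B', ¬ (a < b ∧ b < c ∧ c < d)

open Classical in
/-- Non-crossing partitions of `{1, …, n}` all of whose blocks have at least two elements. -/
def NC₂ (n : ℕ) : Finset (Finpartition (Finset.univ : Finset (Fin n))) :=
  Finset.univ.filter fun ζ => IsNonCrossing ζ ∧ ∀ B ∈ ζ.parts, 2 ≤ B.card

/-- The block that contains `i`. -/
def block {n : ℕ} (ζ : Finpartition (Finset.univ : Finset (Fin n))) (i : Fin n) : ζ.parts :=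
  ⟨ζ.part i, ζ.part_mem.2 (Finset.mem_univ i)⟩

theorem block_surjective {n : ℕ} (ζ : Finpartition (Finset.univ : Finset (Fin n))) :
    Function.Surjective (block ζ) := by
  rintro ⟨B, hB⟩
  obtain ⟨i, hi⟩ := ζ.nonempty_of_mem_parts hB
  exact ⟨i, Subtype.ext (ζ.part_eq_of_mem hB hi)⟩

variable {T : Type*} [TopologicalSpace T] [T2Space T]
variable [SecondCountableTopology T] [LocallyCompactSpace T] [MeasurableSpace T] [BorelSpace T]
  (σ : Measure T) [IsFiniteMeasureOnCompacts σ] (c : C(T, ℝ))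

/-- `∏ λ(s_B)^{|B| - 2}`, the product over the blocks of `ζ`. -/
def weight {n : ℕ} (ζ : Finpartition (Finset.univ : Finset (Fin n))) (s : ζ.parts → T) : ℝ :=
  ∏ B : ζ.parts, c (s B) ^ (B.1.card - 2)

/-- `D_{t_1} ⋯ D_{t_n}` -/
def iterDeriv [σ.IsOpenPosMeasure] {n : ℕ} (t : Fin n → T) : Module.End ℝ (CP σ c) :=
  (List.ofFn fun i => freeDeriv σ c (t i)).prod

/-- `∫ σ(dt_1) ⋯ σ(dt_n) W⁻(ζ)(t_1, …, t_n) D_{t_1} ⋯ D_{t_n} A`: the delta functions in `W⁻(ζ)`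
leave one variable `s_B` for every block `B` of `ζ`. -/
def blockIntegral [σ.IsOpenPosMeasure] {n : ℕ}
    (ζ : Finpartition (Finset.univ : Finset (Fin n))) (A : CP σ c) : Fock σ →L[ℝ] Fock σ :=
  ∫ s : ζ.parts → T, weight c ζ s •
    (iterDeriv σ c (fun i => s (block ζ i)) A : Fock σ →L[ℝ] Fock σ) ∂Measure.pi fun _ => σ

theorem continuous_weight {n : ℕ} (ζ : Finpartition (Finset.univ : Finset (Fin n))) :
    Continuous (weight c ζ) := by
  unfold weight; fun_prop

/-- `(t, x) ↦ (t_n, …, t_1, x_1, …, x_k)` -/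
def prepend {n k N : ℕ} (h : N = k + n) (t : Fin n → T) (x : Fin k → T) (i : Fin N) : T :=
  if hi : (i : ℕ) < n then t (Fin.rev ⟨i, hi⟩) else x ⟨i - n, by omega⟩

theorem continuous_prepend {n k N : ℕ} (h : N = k + n) :
    Continuous fun z : (Fin n → T) × (Fin k → T) => prepend h z.1 z.2 := by
  refine continuous_pi fun i => ?_
  unfold prepend
  by_cases hi : (i : ℕ) < n
  · simp only [hi, dite_true]; fun_prop
  · simp only [hi, dite_false]; fun_prop

theorem prepend_snd {n k N : ℕ} (h : N = k + n) (t : Fin n → T) (x : Fin k → T) :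
    (fun i : Fin k => prepend h t x ⟨n + i, by omega⟩) = x := by
  funext i
  simp [prepend]

theorem prepend_fst {n k N : ℕ} (h : N = k + n) (t : Fin n → T) (x : Fin k → T) :
    (fun i : Fin n => prepend h t x ⟨Fin.rev i, by omega⟩) = t := by
  funext i
  have : ((Fin.rev i : Fin n) : ℕ) < n := (Fin.rev i).2
  unfold prepend
  rw [dif_pos this]
  exact congrArg t (Fin.rev_rev i)

/-- `f ↦ f(t_n, …, t_1, ·)` -/
def evalFirst {n k N : ℕ} (h : N = k + n) (t : Fin n → T) : Test T N →ₗ[ℝ] Test T k where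
  toFun f :=
    { toFun := fun x => f (prepend h t x)
      continuous_toFun := by
        have : Continuous fun x : Fin k → T => prepend h t x :=
          (continuous_prepend h).comp (by fun_prop : Continuous fun x : Fin k → T => (t, x))
        fun_prop
      hasCompactSupport' := by
        simpa using hasCompactSupport_of_leftInverse f (fun x : Fin k → T => prepend h t x)
          (fun y i => y ⟨n + i, by omega⟩) (by fun_prop) (prepend_snd h t) (fun _ => 1) }
  map_add' _ _ := rfl
  map_smul' _ _ := rfl

theorem continuous_blocks {n k N : ℕ} (ζ : Finpartition (Finset.univ : Finset (Fin n)))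
    (h : N = k + n) : Continuous (Function.uncurry fun (s : ζ.parts → T) (x : Fin k → T) =>
      prepend h (fun i => s (block ζ i)) x) :=
  (continuous_prepend h).comp (by fun_prop :
    Continuous fun z : (ζ.parts → T) × (Fin k → T) => ((fun i => z.1 (block ζ i)), z.2))

/-- a left inverse of `s ↦ (s_{B(1)}, …, s_{B(n)})` -/
def unblock {n k N : ℕ} (ζ : Finpartition (Finset.univ : Finset (Fin n))) (h : N = k + n)
    (y : Fin N → T) (B : ζ.parts) : T :=
  y ⟨Fin.rev (Function.surjInv (block_surjective ζ) B), by omega⟩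

theorem continuous_unblock {n k N : ℕ} (ζ : Finpartition (Finset.univ : Finset (Fin n)))
    (h : N = k + n) : Continuous (unblock (T := T) ζ h) := by
  unfold unblock; fun_prop

theorem unblock_prepend {n k N : ℕ} (ζ : Finpartition (Finset.univ : Finset (Fin n)))
    (h : N = k + n) (s : ζ.parts → T) (x : Fin k → T) :
    unblock ζ h (prepend h (fun i => s (block ζ i)) x) = s := by
  funext B
  exact (congrFun (prepend_fst h (fun i => s (block ζ i)) x)
    (Function.surjInv (block_surjective ζ) B)).trans
      (congrArg s (Function.surjInv_eq (block_surjective ζ) B))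

/-- the coefficient of `blockIntegral` -/
def blockContract {n k N : ℕ} (ζ : Finpartition (Finset.univ : Finset (Fin n))) (h : N = k + n) :
    Test T N →ₗ[ℝ] Test T k where
  toFun f :=
    { toFun := fun x => ∫ s : ζ.parts → T, weight c ζ s *
        f (prepend h (fun i => s (block ζ i)) x) ∂Measure.pi fun _ => σ
      continuous_toFun := continuous_integral_slice (Measure.pi fun _ : ζ.parts => σ) f
        (continuous_blocks ζ h) (continuous_unblock ζ h) (unblock_prepend ζ h)
        (continuous_weight c ζ)
      hasCompactSupport' := hasCompactSupport_integral_slice (Measure.pi fun _ : ζ.parts => σ) f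
        (e := fun s x => prepend h (fun i => s (block ζ i)) x)
        (pX := fun y i => y ⟨n + i, by omega⟩) (by fun_prop) (fun s x => prepend_snd h _ x)
        (weight c ζ) }
  map_add' f g := by
    ext x
    have hi (f : Test T N) := integrable_slice (Measure.pi fun _ : ζ.parts => σ) f
        (continuous_blocks ζ h) (continuous_unblock ζ h) (unblock_prepend ζ h)
        (continuous_weight c ζ) x
    have := integral_add (hi f) (hi g)
    simp only [← mul_add] at this
    exact this
  map_smul' a f := by
    ext x
    have := integral_const_mul (μ := Measure.pi fun _ : ζ.parts => σ) a fun s : ζ.parts → T =>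
      weight c ζ s * f (prepend h (fun i => s (block ζ i)) x)
    simp only [mul_left_comm a] at this
    exact this

section Bochner

theorem integrable_zero_fun {H S : Type*} [NormedAddCommGroup H] [MeasurableSpace S]
    (μ : Measure S) : Integrable (fun _ => (0 : H)) μ := integrable_zero _ _ _

theorem integrable_add_fun {H S : Type*} [NormedAddCommGroup H] [NormedSpace ℝ H]
    [MeasurableSpace S] {μ : Measure S} {f g : S → H} (hf : Integrable f μ)
    (hg : Integrable g μ) : Integrable (fun s => f s + g s) μ ∧
      ∫ s, (f s + g s) ∂μ = ∫ s, f s ∂μ + ∫ s, g s ∂μ :=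
  ⟨hf.add hg, integral_add hf hg⟩

/-- bounded continuous functions on `T ^ k` that vanish outside `L` -/
def supportedIn {k : ℕ} (L : Set (Fin k → T)) :
    Submodule ℝ (BoundedContinuousFunction (Fin k → T) ℝ) where
  carrier := {h | ∀ x, x ∉ L → h x = 0}
  add_mem' ha hb x hx := by simp [ha x hx, hb x hx]
  zero_mem' x _ := rfl
  smul_mem' a h hh x hx := by simp [hh x hx]

theorem isClosed_supportedIn {k : ℕ} (L : Set (Fin k → T)) :
    IsClosed (supportedIn L : Set (BoundedContinuousFunction (Fin k → T) ℝ)) := by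
  have : (supportedIn L : Set (BoundedContinuousFunction (Fin k → T) ℝ)) =
      ⋂ x, ⋂ (_ : x ∉ L), {h | h x = 0} := by
    ext h
    rw [Set.mem_iInter₂]
    rfl
  rw [this]
  refine isClosed_iInter fun x => isClosed_iInter fun _ => isClosed_eq ?_ continuous_const
  exact (BoundedContinuousFunction.evalCLM ℝ x).continuous

/-- a function supported in a compact set as a test function -/
def toTest {k : ℕ} {L : Set (Fin k → T)} (hL : IsCompact L) : supportedIn L →ₗ[ℝ] Test T k where
  toFun h :=
    { toFun := h.1
      continuous_toFun := h.1.continuous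
      hasCompactSupport' := HasCompactSupport.intro hL fun x hx => h.2 x hx }
  map_add' _ _ := rfl
  map_smul' _ _ := rfl

theorem integral_factor {H V S : Type*} [NormedAddCommGroup H] [NormedSpace ℝ H] [CompleteSpace H]
    [NormedAddCommGroup V] [NormedSpace ℝ V] [CompleteSpace V] [TopologicalSpace S]
    [MeasurableSpace S] [T2Space S] [OpensMeasurableSpace S] [SecondCountableTopology S]
    (μ : Measure S) [IsFiniteMeasureOnCompacts μ] {w : S → ℝ} (hw : Continuous w) {G : S → V}
    (hG : Continuous G) {K : Set S} (hK : IsCompact K) (hGK : ∀ s, s ∉ K → G s = 0) :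
    (∀ Φ : V →L[ℝ] H, Integrable (fun s => w s • Φ (G s)) μ ∧
      ∫ s, w s • Φ (G s) ∂μ = Φ (∫ s, w s • G s ∂μ)) ∧
    ∀ ev : V →L[ℝ] ℝ, ∫ s, w s * ev (G s) ∂μ = ev (∫ s, w s • G s ∂μ) := by
  have hGw : Integrable (fun s => w s • G s) μ :=
    (hw.smul hG).integrable_of_hasCompactSupport
      (HasCompactSupport.intro hK fun s hs => by
        rw [Pi.smul_apply', hGK s hs, smul_zero])
  refine ⟨fun Φ => ?_, fun ev => ?_⟩
  · have h1 := Φ.integrable_comp hGw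
    have h2 := Φ.integral_comp_comm hGw
    simp only [map_smul] at h1 h2
    exact ⟨h1, h2⟩
  · have h2 := ev.integral_comp_comm hGw
    simpa only [map_smul, smul_eq_mul] using h2

theorem integral_linear {H : Type*} [NormedAddCommGroup H] [NormedSpace ℝ H] [CompleteSpace H]
    {k : ℕ} (Ψ : Test T k →ₗ[ℝ] H) (hΨ : ∀ K : Set T, IsCompact K → ∃ C, 0 ≤ C ∧
      ∀ (f : Test T k) (M : ℝ), 0 ≤ M → (∀ x, |f x| ≤ M) →
      (∀ x, f x ≠ 0 → ∀ i, x i ∈ K) → ‖Ψ f‖ ≤ C * M) {S : Type*} [TopologicalSpace S] [MeasurableSpace S] [T2Space S]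
    [OpensMeasurableSpace S] [SecondCountableTopology S]
    (μ : Measure S) [IsFiniteMeasureOnCompacts μ] {N : ℕ}
    (f : Test T N) {e : S → (Fin k → T) → (Fin N → T)} (he : Continuous (Function.uncurry e))
    {pS : (Fin N → T) → S} (hpS : Continuous pS) (hS : ∀ s x, pS (e s x) = s)
    {pX : (Fin N → T) → (Fin k → T)} (hpX : Continuous pX) (hX : ∀ s x, pX (e s x) = x)
    {w : S → ℝ} (hw : Continuous w) (g : S → Test T k) (hg : ∀ s x, g s x = f (e s x))
    (f' : Test T k) (hf' : ∀ x, f' x = ∫ s, w s * f (e s x) ∂μ) :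
    Integrable (fun s => w s • Ψ (g s)) μ ∧
      ∫ s, w s • Ψ (g s) ∂μ = Ψ f' := by
  set L := pX '' tsupport f with hLdef
  have hL : IsCompact L := f.hasCompactSupport.isCompact.image hpX
  have hgL (s : S) (x : Fin k → T) (hx : x ∉ L) : g s x = 0 := by
    rw [hg]
    exact eq_zero_of_notMem_image f (pS := pX) (by rwa [hX])
  have : CompleteSpace (supportedIn L) := (isClosed_supportedIn L).completeSpace_coe
  obtain ⟨C, hC0, hC⟩ := hΨ (⋃ i, (fun x : Fin k → T => x i) '' L)
    (isCompact_iUnion fun i => hL.image (by fun_prop))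
  let Φ : supportedIn L →L[ℝ] H :=
    LinearMap.mkContinuous (E := supportedIn L) (Ψ ∘ₗ toTest hL) C fun h : supportedIn L =>
      hC _ ‖h‖ (norm_nonneg h) (fun x => h.1.norm_coe_le_norm x) fun x hx i =>
        Set.mem_iUnion.2 ⟨i, x, by_contra fun hxL => hx (h.2 x hxL), rfl⟩
  let G : S → supportedIn L := fun s => ⟨(g s).toBoundedContinuousFunction, fun x hx => hgL s x hx⟩
  have hG : Continuous G := by
    rw [continuous_iff_continuousAt]
    intro s
    rw [ContinuousAt, Metric.tendsto_nhds]
    intro ε hε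
    have h1 : ∀ᶠ s' in nhds s, ∀ x ∈ L, dist (f (e s' x)) (f (e s x)) < ε / 2 := by
      refine hL.eventually_forall_of_forall_eventually fun x _ => ?_
      have h2 : Continuous fun z : S × (Fin k → T) => dist (f (e z.1 z.2)) (f (e s z.2)) := by
        have h3 : Continuous fun z : S × (Fin k → T) => e z.1 z.2 := he
        have h4 : Continuous fun z : S × (Fin k → T) => e s z.2 :=
          he.comp (by fun_prop : Continuous fun z : S × (Fin k → T) => (s, z.2))
        fun_prop
      have h5 := h2.tendsto (s, x)
      rw [dist_self] at h5
      exact h5.eventually_lt_const (by positivity)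
    filter_upwards [h1] with s' hs'
    refine lt_of_le_of_lt ?_ (half_lt_self hε)
    refine (BoundedContinuousFunction.dist_le (by positivity)).2 fun x => ?_
    change dist (g s' x) (g s x) ≤ ε / 2
    by_cases hx : x ∈ L
    · rw [hg, hg]
      exact (hs' x hx).le
    · rw [hgL s' x hx, hgL s x hx, dist_self]
      positivity
  obtain ⟨h1, h2⟩ := integral_factor (H := H) (V := supportedIn L) μ hw hG (f.hasCompactSupport.isCompact.image hpS)
    fun s hs => by
      refine Subtype.ext (BoundedContinuousFunction.ext fun x => ?_)
      change g s x = 0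
      rw [hg]
      exact eq_zero_of_notMem_image f (pS := pS) (by rwa [hS])
  refine ⟨(h1 Φ).1, (h1 Φ).2.trans ?_⟩
  change Ψ (toTest hL _) = _
  congr 1
  ext x
  rw [hf']
  have h3 := h2 ((BoundedContinuousFunction.evalCLM ℝ x).comp (supportedIn L).subtypeL)
  have h4 (s : S) : ((BoundedContinuousFunction.evalCLM ℝ x).comp (supportedIn L).subtypeL) (G s) =
      f (e s x) := hg s x
  simp only [h4] at h3
  exact h3.symm

end Bochner

theorem shiftSeq_lof_zero (t : T) (f : Test T 0) :
    shiftSeq t (DirectSum.lof ℝ ℕ (fun n => Test T n) 0 f) = 0 := by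
  simp [shiftSeq]

theorem shiftSeq_lof_succ (t : T) (n : ℕ) (f : Test T (n + 1)) :
    shiftSeq t (DirectSum.lof ℝ ℕ (fun n => Test T n) (n + 1) f) =
      DirectSum.lof ℝ ℕ (fun n => Test T n) n (slice t n f) := by
  simp [shiftSeq]

theorem freeDeriv_monomial [σ.IsOpenPosMeasure] (t : T) (p : TestSeq T) :
    freeDeriv σ c t (polynomialEquiv σ c p) = polynomialEquiv σ c (shiftSeq t p) := by
  simp [freeDeriv, LinearEquiv.conj_apply]

theorem annihilation_orth [σ.IsOpenPosMeasure] (t : T) (p : TestSeq T) :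
    annihilation σ c t (orthPolynomialEquiv σ c p) = orthPolynomialEquiv σ c (shiftSeq t p) := by
  simp [annihilation, LinearEquiv.conj_apply]

theorem iterDeriv_succ [σ.IsOpenPosMeasure] {n : ℕ} (t : Fin (n + 1) → T) :
    iterDeriv σ c t = freeDeriv σ c (t 0) * iterDeriv σ c (fun i => t i.succ) := by
  simp [iterDeriv, List.ofFn_succ]

theorem iterDeriv_monomial [σ.IsOpenPosMeasure] {n : ℕ} (t : Fin n → T) {N k : ℕ} (h : N = k + n)
    (f : Test T N) :
    iterDeriv σ c t (polynomialEquiv σ c (DirectSum.lof ℝ ℕ (fun n => Test T n) N f)) =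
      polynomialEquiv σ c (DirectSum.lof ℝ ℕ (fun n => Test T n) k (evalFirst h t f)) := by
  induction n generalizing k with
  | zero =>
    have hk : N = k := h
    subst hk
    have : evalFirst h t f = f := by
      ext x
      change f (prepend h t x) = f x
      rfl
    rw [this]
    simp [iterDeriv]
  | succ n ih =>
    have h' : N = (k + 1) + n := by omega
    rw [iterDeriv_succ, Module.End.mul_apply, ih _ h', freeDeriv_monomial, shiftSeq_lof_succ]
    congr 2
    ext x
    change f (prepend h' (fun i => t i.succ) (Fin.cons (t 0) x)) = f (prepend h t x)
    congr 1
    funext i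
    unfold prepend
    rcases lt_trichotomy (i : ℕ) n with hi | hi | hi
    · rw [dif_pos hi, dif_pos (by omega)]
      refine congrArg t (Fin.ext ?_)
      simp [Fin.rev]
      omega
    · rw [dif_neg (by omega), dif_pos (by omega)]
      have e1 : (⟨(i : ℕ) - n, by omega⟩ : Fin (k + 1)) = 0 := by ext; simp [hi]
      rw [e1, Fin.cons_zero]
      refine congrArg t (Fin.ext ?_)
      simp [Fin.rev, hi]
    · rw [dif_neg (by omega), dif_neg (by omega)]
      have e1 : (⟨(i : ℕ) - n, by omega⟩ : Fin (k + 1)) =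
          Fin.succ ⟨(i : ℕ) - (n + 1), by omega⟩ := by
        ext; simp; omega
      rw [e1, Fin.cons_succ]

theorem iterDeriv_eq_zero [σ.IsOpenPosMeasure] {n : ℕ} (t : Fin n → T) {N : ℕ} (h : N < n)
    (f : Test T N) :
    iterDeriv σ c t (polynomialEquiv σ c (DirectSum.lof ℝ ℕ (fun n => Test T n) N f)) = 0 := by
  induction n with
  | zero => omega
  | succ n ih =>
    rw [iterDeriv_succ, Module.End.mul_apply]
    by_cases hN : N < n
    · rw [ih _ hN, map_zero]
    · rw [iterDeriv_monomial σ c _ (by omega : N = 0 + n), freeDeriv_monomial, shiftSeq_lof_zero,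
        map_zero]

/-- `blockIntegral` on the coefficients -/
def blockSeq {n : ℕ} (ζ : Finpartition (Finset.univ : Finset (Fin n))) :
    TestSeq T →ₗ[ℝ] TestSeq T :=
  DirectSum.toModule ℝ ℕ _ fun N =>
    if h : n ≤ N then DirectSum.lof ℝ ℕ (fun n => Test T n) (N - n) ∘ₗ
      blockContract σ c ζ (by omega : N = (N - n) + n) else 0

theorem blockSeq_lof {n : ℕ} (ζ : Finpartition (Finset.univ : Finset (Fin n))) (N : ℕ)
    (f : Test T N) : blockSeq σ c ζ (DirectSum.lof ℝ ℕ (fun n => Test T n) N f) =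
      if h : n ≤ N then DirectSum.lof ℝ ℕ (fun n => Test T n) (N - n)
        (blockContract σ c ζ (by omega : N = (N - n) + n) f) else 0 := by
  rw [blockSeq, DirectSum.toModule_lof]
  by_cases h : n ≤ N <;> simp [h]

theorem polynomialEquiv_coe [σ.IsOpenPosMeasure] (p : TestSeq T) :
    (polynomialEquiv σ c p : Fock σ →L[ℝ] Fock σ) = polynomial σ c p := rfl

theorem blockIntegral_aux [σ.IsOpenPosMeasure] {n : ℕ}
    (ζ : Finpartition (Finset.univ : Finset (Fin n))) (N : ℕ) (f : Test T N) :
    Integrable (fun s : ζ.parts → T => weight c ζ s • (iterDeriv σ c (fun i => s (block ζ i))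
      (polynomialEquiv σ c (DirectSum.lof ℝ ℕ (fun n => Test T n) N f)) : Fock σ →L[ℝ] Fock σ))
      (Measure.pi fun _ => σ) ∧
    blockIntegral σ c ζ (polynomialEquiv σ c (DirectSum.lof ℝ ℕ (fun n => Test T n) N f)) =
      polynomial σ c (blockSeq σ c ζ (DirectSum.lof ℝ ℕ (fun n => Test T n) N f)) := by
  unfold blockIntegral
  rw [blockSeq_lof]
  by_cases h : n ≤ N
  · have hN : N = (N - n) + n := by omega
    simp only [iterDeriv_monomial σ c _ hN, polynomialEquiv_coe, polynomial_lof, dif_pos h]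
    exact integral_linear (monomial σ c (N - n)) (fun K hK => monomial_bound σ c K hK (N - n))
      (Measure.pi fun _ : ζ.parts => σ) f (continuous_blocks ζ hN)
      (continuous_unblock ζ hN) (unblock_prepend ζ hN)
      (pX := fun y i => y ⟨n + i, by omega⟩) (by fun_prop) (fun s x => prepend_snd hN _ x)
      (continuous_weight c ζ) (fun s => evalFirst hN (fun i => s (block ζ i)) f) (fun s x => rfl)
      (blockContract σ c ζ hN f) fun x => rfl
  · simp only [iterDeriv_eq_zero σ c _ (not_le.1 h), dif_neg h, map_zero, Submodule.coe_zero,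
      smul_zero, integral_zero]
    exact ⟨integrable_zero_fun _, trivial⟩

theorem blockIntegral_eq [σ.IsOpenPosMeasure] {n : ℕ}
    (ζ : Finpartition (Finset.univ : Finset (Fin n))) (p : TestSeq T) :
    Integrable (fun s : ζ.parts → T => weight c ζ s • (iterDeriv σ c (fun i => s (block ζ i))
      (polynomialEquiv σ c p) : Fock σ →L[ℝ] Fock σ)) (Measure.pi fun _ => σ) ∧
    blockIntegral σ c ζ (polynomialEquiv σ c p) = polynomial σ c (blockSeq σ c ζ p) := by
  induction p using DirectSum.induction_on with
  | zero =>
    simp only [blockIntegral, map_zero, Submodule.coe_zero, smul_zero, integral_zero]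
    exact ⟨integrable_zero_fun _, trivial⟩
  | of N f => exact blockIntegral_aux σ c ζ N f
  | add p q hp hq =>
    simp only [map_add, Submodule.coe_add, smul_add] at hp hq ⊢
    refine ⟨(integrable_add_fun hp.1 hq.1).1, ?_⟩
    rw [← hp.2, ← hq.2]
    unfold blockIntegral
    simp only [map_add, Submodule.coe_add, smul_add]
    exact (integrable_add_fun hp.1 hq.1).2

/-- the global operator on the coefficients -/
def globalSeq : TestSeq T →ₗ[ℝ] TestSeq T :=
  DirectSum.toModule ℝ ℕ _ fun N =>
    (LinearMap.id + ∑ n ∈ Finset.Icc 2 N, ∑ ζ ∈ NC₂ n, blockSeq σ c ζ) ∘ₗ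
      DirectSum.lof ℝ ℕ (fun n => Test T n) N

theorem globalSeq_eq (M : ℕ) (p : TestSeq T) (hp : ∀ m, M < m → p m = 0) :
    globalSeq σ c p = p + ∑ n ∈ Finset.Icc 2 M, ∑ ζ ∈ NC₂ n, blockSeq σ c ζ p := by
  suffices h : ∀ (N : ℕ) (_ : N ≤ M) (f : Test T N),
      globalSeq σ c (DirectSum.lof ℝ ℕ (fun n => Test T n) N f) =
        (LinearMap.id + ∑ n ∈ Finset.Icc 2 M, ∑ ζ ∈ NC₂ n, blockSeq σ c ζ : TestSeq T →ₗ[ℝ] TestSeq T)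
          (DirectSum.lof ℝ ℕ (fun n => Test T n) N f) by
    have e := eq_sum_lof p (Finset.range (M + 1)) fun m hm => hp m (by simp at hm; omega)
    have : globalSeq σ c p = (LinearMap.id + ∑ n ∈ Finset.Icc 2 M, ∑ ζ ∈ NC₂ n, blockSeq σ c ζ :
        TestSeq T →ₗ[ℝ] TestSeq T) p := by
      rw [e, map_sum, map_sum]
      refine Finset.sum_congr rfl fun N hN => h N (by simp at hN; omega) _
    rw [this]
    simp only [LinearMap.add_apply, LinearMap.sum_apply, LinearMap.id_apply]
  intro N hN f
  rw [globalSeq, DirectSum.toModule_lof]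
  simp only [LinearMap.comp_apply, LinearMap.add_apply, LinearMap.sum_apply, LinearMap.id_apply]
  congr 1
  refine Finset.sum_subset (Finset.Icc_subset_Icc_right hN) fun n hn hn' => ?_
  refine Finset.sum_eq_zero fun ζ _ => ?_
  rw [blockSeq_lof, dif_neg]
  simp at hn hn'
  omega

theorem globalOp_aux [σ.IsOpenPosMeasure] (p : TestSeq T) :
    (polynomialEquiv σ c p : Fock σ →L[ℝ] Fock σ) +
      ∑ᶠ n ∈ Set.Ici 2, ∑ ζ ∈ NC₂ n, blockIntegral σ c ζ (polynomialEquiv σ c p) =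
    polynomialEquiv σ c (globalSeq σ c p) := by
  obtain ⟨M, hM⟩ := exists_degree p
  rw [globalSeq_eq σ c M p fun m hm => hM m hm.le]
  have h1 : ∀ n, M < n → ∑ ζ ∈ NC₂ n, blockIntegral σ c ζ (polynomialEquiv σ c p) = 0 := by
    intro n hn
    refine Finset.sum_eq_zero fun ζ _ => ?_
    rw [(blockIntegral_eq σ c ζ p).2,
      eq_sum_lof p (Finset.range M) fun m hm => hM m (by simpa using hm), map_sum,
      Finset.sum_eq_zero, map_zero]
    intro N hN
    rw [blockSeq_lof, dif_neg]
    simp at hN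
    omega
  rw [finsum_mem_eq_sum_of_inter_support_eq (t := Finset.Icc 2 M)]
  · simp only [(blockIntegral_eq σ c _ p).2, map_add, map_sum, Submodule.coe_add,
      Submodule.coe_sum, polynomialEquiv_coe]
  · ext n
    simp only [Set.mem_inter_iff, Set.mem_Ici, Function.mem_support, Finset.coe_Icc, Set.mem_Icc]
    constructor
    · rintro ⟨h2, h3⟩
      exact ⟨⟨h2, not_lt.1 fun h => h3 (h1 n h)⟩, h3⟩
    · rintro ⟨h2, h3⟩
      exact ⟨h2.1, h3⟩

/-- The global operator
`𝔾 = 1 + ∑_{n ≥ 2} ∑_{ζ ∈ NC_{≥ 2}(n)} ∫ σ(dt_1) ⋯ σ(dt_n) W⁻(ζ)(t_1, …, t_n) D_{t_1} ⋯ D_{t_n}`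
on continuous polynomials, as a function. -/
def globalFun [σ.IsOpenPosMeasure] (A : CP σ c) : CP σ c :=
  ⟨A + ∑ᶠ n ∈ Set.Ici 2, ∑ ζ ∈ NC₂ n, blockIntegral σ c ζ A, by
    obtain ⟨p, rfl⟩ := (polynomialEquiv σ c).surjective A
    rw [globalOp_aux]
    exact Subtype.prop _⟩

theorem globalFun_polynomial [σ.IsOpenPosMeasure] (p : TestSeq T) :
    globalFun σ c (polynomialEquiv σ c p) = polynomialEquiv σ c (globalSeq σ c p) :=
  Subtype.ext (globalOp_aux σ c p)

theorem globalFun_eq [σ.IsOpenPosMeasure] (A : CP σ c) :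
    globalFun σ c A = (polynomialEquiv σ c).conj (globalSeq σ c) A := by
  obtain ⟨p, rfl⟩ := (polynomialEquiv σ c).surjective A
  rw [globalFun_polynomial, LinearEquiv.conj_apply_apply, LinearEquiv.symm_apply_apply]

/-- The global operator `𝔾` as a linear map. -/
def globalOp [σ.IsOpenPosMeasure] : Module.End ℝ (CP σ c) :=
  ((polynomialEquiv σ c).conj (globalSeq σ c)).copy (globalFun σ c) (funext (globalFun_eq σ c))

end

section

/-- The power series of `Ψ_{l,e}(z) = z / (1 + l z + e z²)`. -/
def psi (l e : ℝ) : PowerSeries ℝ :=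
  PowerSeries.X * (1 + PowerSeries.C l * PowerSeries.X + PowerSeries.C e * PowerSeries.X ^ 2)⁻¹

/-- `R(N) A = ∑_k R_k N^k A` for a power series `R = ∑_k R_k z^k`, in case that only finitely many
of the vectors `N^k A` do not vanish. -/
def applySeries {V : Type*} [AddCommGroup V] [Module ℝ V] (R : PowerSeries ℝ)
    (N : Module.End ℝ V) (A : V) : V :=
  ∑ᶠ k : ℕ, PowerSeries.coeff k R • (N ^ k) A

end

end

end FreeMeixner

/-!
Everything is read off on coefficient sequences. Applying a polynomial to the vacuum `Ω` yields its
coefficients with respect to the orthogonal polynomials, because `⟨P^{(n)}(ω), f⟩ Ω = f`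
(`orthPolynomialEquiv_vacuumRep`). With `N = D_t 𝔾`, the whole theorem follows from the local
nilpotency of `N`, which lowers the degree, and from the relation `∂_t (1 - λ(t) N) = N`
(`annihilation_mul`): this relation makes `1 + λ(t) ∂_t` inverse to `1 - λ(t) N`.

Both sides of the relation are continuous in the kernel of a monomial, so that it suffices to check
it on words `⟨ω, χ_1⟩ ⋯ ⟨ω, χ_n⟩`, whose kernels are elementary tensors; these are dense by the
Stone–Weierstrass theorem (`IsRegularSeq.eq_zero`). On words the operators are explicit.

* The sum over the partitions in `NC_{≥ 2}` is the vacuum expectation of a word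
  (`vacuumCoeff_wordVec`). The letters act one after the other on a stack of open blocks; a new
  letter opens a block, or joins the last one, or closes it, and these are the three parts of the
  field operator (`partitionSum_cut`). Therefore `𝔾` replaces the prefixes of a word by their vacuum
  expectations (`globalSeq_pureTensor`).
* The relations `a(ψ) ω(χ) = ⟨ψ, χ⟩ + a(λψχ) + a(ψ) a(χ)` show that an annihilation operator turns a
  word into a combination of its proper suffixes, and that this is compatible with cutting off a
  suffix (`annihilate_mem_splittingSpan`). By induction on the length, annihilation at `t` is the
  sum, over the letters of the word, of the vacuum expectation of the prefix before the letter, the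
  value of the letter at `t`, and `1 + λ(t) ∂_t` applied to the suffix behind it
  (`shiftSeq_of_mem_splittingSpan`). This is the relation above.
-/

namespace FreeMeixner

/-! ### Non-crossing partitions with separated elements -/

section Combinatorics

variable {α : Type*} [LinearOrder α]

/-- `P` is the set of blocks of a non-crossing partition of `s` without singletons in which the
elements of `R` lie in distinct blocks. -/
structure IsSepPartition (s R : Finset α) (P : Finset (Finset α)) : Prop where
  sub : ∀ B ∈ P, B ⊆ s
  two : ∀ B ∈ P, 2 ≤ B.card
  cover : ∀ x ∈ s, ∃ B ∈ P, x ∈ B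
  disj : ∀ B ∈ P, ∀ B' ∈ P, ∀ x ∈ B, x ∈ B' → B = B'
  nc : ∀ B ∈ P, ∀ B' ∈ P, ∀ x ∈ B, ∀ y ∈ B', ∀ z ∈ B, ∀ w ∈ B', x < y → y < z → z < w → B = B'
  sep : ∀ B ∈ P, ∀ x ∈ B, ∀ y ∈ B, x ∈ R → y ∈ R → x = y

variable {s R : Finset α} {P : Finset (Finset α)} {a b : α}

/-- `a` is the last element of the initial segment `R` of `s`, and `b` is its successor in `s`. -/
structure IsCut (s R : Finset α) (a b : α) : Prop where
  sub : R ⊆ s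
  ha : a ∈ R
  hb : b ∈ s
  lt_iff : ∀ x ∈ s, x < b ↔ x ∈ R
  le : ∀ x ∈ R, x ≤ a

namespace IsCut

variable (h : IsCut s R a b)
include h

theorem lt : a < b := (h.lt_iff a (h.sub h.ha)).2 h.ha

theorem notMem : b ∉ R := fun hb => lt_irrefl b ((h.lt_iff b h.hb).2 hb)

theorem le_of_lt {x : α} (hx : x ∈ s) (hxb : x < b) : x ≤ a := h.le x ((h.lt_iff x hx).1 hxb)

end IsCut

/-- If `b` shares its block with an element of `R`, this element is `a`: otherwise the block of `a`,
which has an element beyond `b`, would be crossed. -/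
theorem IsSepPartition.mem_block (hP : IsSepPartition s R P) (h : IsCut s R a b) {B : Finset α}
    (hB : B ∈ P) (hb : b ∈ B) {x : α} (hx : x ∈ B) (hxR : x ∈ R) : a ∈ B := by
  obtain ⟨B', hB', ha⟩ := hP.cover a (h.sub h.ha)
  by_contra hne
  have hBB : B ≠ B' := fun e => hne (e ▸ ha)
  obtain ⟨d, hd, hda⟩ := Finset.exists_mem_ne (hP.two B' hB') a
  have hds := hP.sub B' hB' hd
  have hdR : d ∉ R := fun hdR => hda (hP.sep B' hB' d hd a ha hdR h.ha)
  have hdb : d ≠ b := fun e => hBB (hP.disj B hB B' hB' b hb (e ▸ hd))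
  have hbd : b < d := lt_of_le_of_ne (not_lt.1 fun hlt => hdR ((h.lt_iff d hds).1 hlt)) hdb.symm
  have hxa : x < a := lt_of_le_of_ne (h.le x hxR) fun e => hne (e ▸ hx)
  exact hBB (hP.nc B hB B' hB' x hx a ha b hb d hd hxa h.lt hbd)

theorem IsSepPartition.insert_iff (h : IsCut s R a b) :
    IsSepPartition s (insert b R) P ↔
      IsSepPartition s R P ∧ ∀ B ∈ P, ¬ (a ∈ B ∧ b ∈ B) := by
  constructor
  · intro hP
    refine ⟨⟨hP.sub, hP.two, hP.cover, hP.disj, hP.nc, fun B hB x hx y hy hxR hyR =>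
      hP.sep B hB x hx y hy (Finset.mem_insert_of_mem hxR) (Finset.mem_insert_of_mem hyR)⟩,
      fun B hB hab => h.lt.ne (hP.sep B hB a hab.1 b hab.2 (Finset.mem_insert_of_mem h.ha)
        (Finset.mem_insert_self _ _))⟩
  · rintro ⟨hP, hab⟩
    refine ⟨hP.sub, hP.two, hP.cover, hP.disj, hP.nc, fun B hB x hx y hy hxR hyR => ?_⟩
    rcases Finset.mem_insert.1 hxR with e | hx' <;> rcases Finset.mem_insert.1 hyR with e' | hy'
    · rw [e, e']
    · exact absurd ⟨hP.mem_block h hB (e ▸ hx) hy hy', e ▸ hx⟩ (hab B hB)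
    · exact absurd ⟨hP.mem_block h hB (e' ▸ hy) hx hx', e' ▸ hy⟩ (hab B hB)
    · exact hP.sep B hB x hx y hy hx' hy'

theorem IsSepPartition.singleton_iff :
    IsSepPartition s {b} P ↔ IsSepPartition s ∅ P := by
  constructor
  · exact fun hP => ⟨hP.sub, hP.two, hP.cover, hP.disj, hP.nc, by simp⟩
  · refine fun hP => ⟨hP.sub, hP.two, hP.cover, hP.disj, hP.nc, fun B hB x hx y hy hxR hyR => ?_⟩
    rw [Finset.mem_singleton.1 hxR, Finset.mem_singleton.1 hyR]

/-- Removing a block `{a, b}`. -/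
theorem IsSepPartition.erase_pair (hP : IsSepPartition s R P) (hab : {a, b} ∈ P) :
    IsSepPartition ((s.erase a).erase b) (R.erase a) (P.erase {a, b}) := by
  have hmem {B : Finset α} (hB : B ∈ P) (hne : B ≠ {a, b}) : a ∉ B ∧ b ∉ B :=
    ⟨fun ha => hne (hP.disj B hB _ hab a ha (by simp)),
      fun hb => hne (hP.disj B hB _ hab b hb (by simp))⟩
  refine ⟨fun B hB x hx => ?_, fun B hB => hP.two B (Finset.mem_of_mem_erase hB), fun x hx => ?_,
    fun B hB B' hB' => hP.disj B (Finset.mem_of_mem_erase hB) B' (Finset.mem_of_mem_erase hB'),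
    fun B hB B' hB' => hP.nc B (Finset.mem_of_mem_erase hB) B' (Finset.mem_of_mem_erase hB'),
    fun B hB x hx y hy hxR hyR => hP.sep B (Finset.mem_of_mem_erase hB) x hx y hy
      (Finset.mem_of_mem_erase hxR) (Finset.mem_of_mem_erase hyR)⟩
  · rw [Finset.mem_erase] at hB
    have := hmem hB.2 hB.1
    have hxs := hP.sub B hB.2 hx
    simp only [Finset.mem_erase]
    exact ⟨fun e => this.2 (e ▸ hx), fun e => this.1 (e ▸ hx), hxs⟩
  · simp only [Finset.mem_erase] at hx
    obtain ⟨B, hB, hxB⟩ := hP.cover x hx.2.2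
    refine ⟨B, Finset.mem_erase.2 ⟨?_, hB⟩, hxB⟩
    rintro rfl
    simp [hx.1, hx.2.1] at hxB

/-- Adding a block `{a, b}` of neighbours. -/
theorem IsSepPartition.insert_pair (h : IsCut s R a b)
    (hP : IsSepPartition ((s.erase a).erase b) (R.erase a) P) :
    IsSepPartition s R (insert {a, b} P) := by
  have hmem {B : Finset α} (hB : B ∈ P) {x : α} (hx : x ∈ B) : x ≠ b ∧ x ≠ a ∧ x ∈ s := by
    simpa using hP.sub B hB hx
  have hpair : ∀ {x : α}, x ∈ ({a, b} : Finset α) ↔ x = a ∨ x = b := by simp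
  have hbtw {x y z : α} (hx : x ∈ ({a, b} : Finset α)) (hz : z ∈ ({a, b} : Finset α)) (hy : y ∈ s)
      (hxy : x < y) (hyz : y < z) : False := by
    have hyb : y < b := by
      rcases hpair.1 hz with rfl | rfl
      exacts [hyz.trans h.lt, hyz]
    have hya := h.le_of_lt hy hyb
    rcases hpair.1 hx with rfl | rfl
    · exact absurd hxy (not_lt.2 hya)
    · exact absurd (hxy.trans hyb) (lt_irrefl _)
  refine ⟨?_, ?_, ?_, ?_, ?_, ?_⟩
  · intro B hB x hx
    rcases Finset.mem_insert.1 hB with rfl | hB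
    · rcases hpair.1 hx with rfl | rfl
      exacts [h.sub h.ha, h.hb]
    · exact (hmem hB hx).2.2
  · intro B hB
    rcases Finset.mem_insert.1 hB with rfl | hB
    · rw [Finset.card_pair h.lt.ne]
    · exact hP.two B hB
  · intro x hx
    by_cases hxab : x ∈ ({a, b} : Finset α)
    · exact ⟨_, Finset.mem_insert_self _ _, hxab⟩
    · rw [hpair, not_or] at hxab
      obtain ⟨B, hB, hxB⟩ := hP.cover x (by simp [hx, hxab.1, hxab.2])
      exact ⟨B, Finset.mem_insert_of_mem hB, hxB⟩
  · intro B hB B' hB' x hx hx'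
    rcases Finset.mem_insert.1 hB with rfl | hB <;> rcases Finset.mem_insert.1 hB' with rfl | hB'
    · rfl
    · have := hmem hB' hx'
      simp [this.1, this.2.1] at hx
    · have := hmem hB hx
      simp [this.1, this.2.1] at hx'
    · exact hP.disj B hB B' hB' x hx hx'
  · intro B hB B' hB' x hx y hy z hz w hw hxy hyz hzw
    rcases Finset.mem_insert.1 hB with rfl | hB <;> rcases Finset.mem_insert.1 hB' with rfl | hB'
    · rfl
    · exact (hbtw hx hz (hmem hB' hy).2.2 hxy hyz).elim
    · exact (hbtw hy hw (hmem hB hz).2.2 hyz hzw).elim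
    · exact hP.nc B hB B' hB' x hx y hy z hz w hw hxy hyz hzw
  · intro B hB x hx y hy hxR hyR
    rcases Finset.mem_insert.1 hB with rfl | hB
    · have hx' := (hpair.1 hx).resolve_right fun e => h.notMem (e ▸ hxR)
      have hy' := (hpair.1 hy).resolve_right fun e => h.notMem (e ▸ hyR)
      rw [hx', hy']
    · exact hP.sep B hB x hx y hy (Finset.mem_erase.2 ⟨(hmem hB hx).2.1, hxR⟩)
        (Finset.mem_erase.2 ⟨(hmem hB hy).2.1, hyR⟩)

/-- Removing `b` from the block of its left neighbour `a`, if this block has at least three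
elements. -/
theorem IsSepPartition.erase_succ (hP : IsSepPartition s R P) {B₀ : Finset α}
    (hB₀ : B₀ ∈ P) (hb : b ∈ B₀) (h3 : 3 ≤ B₀.card) :
    IsSepPartition (s.erase b) R (P.image fun B => B.erase b) := by
  have key {B B' : Finset α} : ∀ x ∈ B.erase b, x ∈ B'.erase b → B ∈ P → B' ∈ P →
      B.erase b = B'.erase b := fun x hx hx' hB hB' => by
    rw [hP.disj B hB B' hB' x (Finset.mem_of_mem_erase hx) (Finset.mem_of_mem_erase hx')]
  refine ⟨?_, ?_, ?_, ?_, ?_, ?_⟩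
  · simp only [Finset.forall_mem_image]
    exact fun B hB => Finset.erase_subset_erase _ (hP.sub B hB)
  · simp only [Finset.forall_mem_image]
    intro B hB
    by_cases hbB : b ∈ B
    · obtain rfl := hP.disj B hB B₀ hB₀ b hbB hb
      rw [Finset.card_erase_of_mem hbB]
      omega
    · rw [Finset.erase_eq_of_notMem hbB]
      exact hP.two B hB
  · intro x hx
    rw [Finset.mem_erase] at hx
    obtain ⟨B, hB, hxB⟩ := hP.cover x hx.2
    exact ⟨_, Finset.mem_image_of_mem _ hB, Finset.mem_erase.2 ⟨hx.1, hxB⟩⟩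
  · simp only [Finset.forall_mem_image]
    exact fun B hB B' hB' x hx hx' => key x hx hx' hB hB'
  · simp only [Finset.forall_mem_image, Finset.mem_erase]
    intro B hB B' hB' x hx y hy z hz w hw hxy hyz hzw
    rw [hP.nc B hB B' hB' x hx.2 y hy.2 z hz.2 w hw.2 hxy hyz hzw]
  · simp only [Finset.forall_mem_image, Finset.mem_erase]
    exact fun B hB x hx y hy => hP.sep B hB x hx.2 y hy.2

/-- Putting `b` into the block `B` if this is the block of `a`. -/
def addSucc (a b : α) (B : Finset α) : Finset α := if a ∈ B then insert b B else B

theorem mem_addSucc {B : Finset α} {x : α} : x ∈ addSucc a b B ↔ x ∈ B ∨ (a ∈ B ∧ x = b) := by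
  unfold addSucc
  split_ifs with h
  · simp [h, or_comm]
  · simp [h]

theorem erase_addSucc {B : Finset α} (hb : b ∉ B) : (addSucc a b B).erase b = B := by
  unfold addSucc
  split_ifs
  · exact Finset.erase_insert hb
  · exact Finset.erase_eq_of_notMem hb

/-- Putting `b` into the block of its left neighbour `a`. -/
theorem IsSepPartition.add_succ (h : IsCut s R a b) (hP : IsSepPartition (s.erase b) R P) :
    IsSepPartition s R (P.image (addSucc a b)) := by
  have hmem {B : Finset α} (hB : B ∈ P) {x : α} (hx : x ∈ B) : x ≠ b ∧ x ∈ s := by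
    simpa using hP.sub B hB hx
  have hab := h.lt
  have hs {B : Finset α} (hB : B ∈ P) {x : α} (hx : x ∈ addSucc a b B) : x ∈ s := by
    rcases mem_addSucc.1 hx with hx | ⟨-, rfl⟩
    exacts [(hmem hB hx).2, h.hb]
  refine ⟨?_, ?_, ?_, ?_, ?_, ?_⟩
  · simp only [Finset.forall_mem_image]
    exact fun B hB x hx => hs hB hx
  · simp only [Finset.forall_mem_image]
    exact fun B hB => (hP.two B hB).trans
      (Finset.card_le_card fun x hx => mem_addSucc.2 (Or.inl hx))
  · intro x hx
    by_cases hxb : x = b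
    · obtain ⟨B, hB, haB⟩ := hP.cover a (Finset.mem_erase.2 ⟨hab.ne, h.sub h.ha⟩)
      exact ⟨_, Finset.mem_image_of_mem _ hB, mem_addSucc.2 (Or.inr ⟨haB, hxb⟩)⟩
    · obtain ⟨B, hB, hxB⟩ := hP.cover x (Finset.mem_erase.2 ⟨hxb, hx⟩)
      exact ⟨_, Finset.mem_image_of_mem _ hB, mem_addSucc.2 (Or.inl hxB)⟩
  · simp only [Finset.forall_mem_image]
    intro B hB B' hB' x hx hx'
    rcases mem_addSucc.1 hx with hx | ⟨ha, rfl⟩ <;> rcases mem_addSucc.1 hx' with hx' | ⟨ha', he⟩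
    · rw [hP.disj B hB B' hB' x hx hx']
    · exact absurd he (hmem hB hx).1
    · exact absurd rfl (hmem hB' hx').1
    · rw [hP.disj B hB B' hB' a ha ha']
  · simp only [Finset.forall_mem_image]
    intro B hB B' hB' x hx y hy z hz w hw hxy hyz hzw
    -- in a crossing, `b` may be replaced by its left neighbour `a`
    by_cases hBB : B = B'
    · rw [hBB]
    exfalso
    have hys := hs hB' hy
    have hzs := hs hB hz
    have haa (ha : a ∈ B) (ha' : a ∈ B') : False := hBB (hP.disj B hB B' hB' a ha ha')
    have hnc := hP.nc B hB B' hB'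
    rcases mem_addSucc.1 hx with hx₁ | ⟨ha, rfl⟩
    · rcases mem_addSucc.1 hy with hy₁ | ⟨ha', rfl⟩
      · rcases mem_addSucc.1 hz with hz₁ | ⟨ha, rfl⟩
        · rcases mem_addSucc.1 hw with hw₁ | ⟨ha', rfl⟩
          · exact hBB (hnc x hx₁ y hy₁ z hz₁ w hw₁ hxy hyz hzw)
          · have hza : z < a := lt_of_le_of_ne (h.le_of_lt hzs hzw) fun e => haa (e ▸ hz₁) ha'
            exact hBB (hnc x hx₁ y hy₁ z hz₁ a ha' hxy hyz hza)
        · have hya : y < a := lt_of_le_of_ne (h.le_of_lt hys hyz) fun e => haa ha (e ▸ hy₁)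
          rcases mem_addSucc.1 hw with hw₁ | ⟨ha', rfl⟩
          · exact hBB (hnc x hx₁ y hy₁ a ha w hw₁ hxy hya (hab.trans hzw))
          · exact absurd hzw (lt_irrefl _)
      · have hxa : x < a := lt_of_le_of_ne (h.le_of_lt (hmem hB hx₁).2 hxy)
          fun e => haa (e ▸ hx₁) ha'
        rcases mem_addSucc.1 hz with hz₁ | ⟨ha, rfl⟩
        · rcases mem_addSucc.1 hw with hw₁ | ⟨-, rfl⟩
          · exact hBB (hnc x hx₁ a ha' z hz₁ w hw₁ hxa (hab.trans hyz) hzw)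
          · exact absurd (hyz.trans hzw) (lt_irrefl _)
        · exact absurd hyz (lt_irrefl _)
    · rcases mem_addSucc.1 hy with hy₁ | ⟨ha', rfl⟩
      · rcases mem_addSucc.1 hz with hz₁ | ⟨ha, rfl⟩
        · rcases mem_addSucc.1 hw with hw₁ | ⟨ha', rfl⟩
          · exact hBB (hnc a ha y hy₁ z hz₁ w hw₁ (hab.trans hxy) hyz hzw)
          · exact absurd (hxy.trans (hyz.trans hzw)) (lt_irrefl _)
        · exact absurd (hxy.trans hyz) (lt_irrefl _)
      · exact absurd hxy (lt_irrefl _)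
  · simp only [Finset.forall_mem_image]
    intro B hB x hx y hy hxR hyR
    have hx' := (mem_addSucc.1 hx).resolve_right fun e => h.notMem (e.2 ▸ hxR)
    have hy' := (mem_addSucc.1 hy).resolve_right fun e => h.notMem (e.2 ▸ hyR)
    exact hP.sep B hB x hx' y hy' hxR hyR

end Combinatorics

section Sums

variable {α : Type*} [LinearOrder α] [Fintype α] {T : Type*} [MeasurableSpace T]
  (σ : Measure T) (c : T → ℝ)

/-- `∫ λ^{|B| - 2} ∏_{i ∈ B} u_i dσ` -/
noncomputable def blockMoment (u : α → T → ℝ) (B : Finset α) : ℝ :=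
  ∫ x, c x ^ (B.card - 2) * ∏ i ∈ B, u i x ∂σ

open Classical in
/-- The sum of the products of the block moments over the non-crossing partitions of `s` without
singletons in which the elements of `R` lie in distinct blocks. -/
noncomputable def partitionSum (s R : Finset α) (u : α → T → ℝ) : ℝ :=
  ∑ P : Finset (Finset α) with IsSepPartition s R P, ∏ B ∈ P, blockMoment σ c u B

theorem blockMoment_congr {u v : α → T → ℝ} {B : Finset α} (h : ∀ i ∈ B, u i = v i) :
    blockMoment σ c u B = blockMoment σ c v B := by
  unfold blockMoment
  congr 1
  funext x
  rw [Finset.prod_congr rfl fun i hi => congrFun (h i hi) x]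

/-- The recursion for `partitionSum`: the successor `b` of the segment `R` does not share its block
with an element of `R`, or it is in the block of the last element `a` of `R`, where this block has
at least three elements, or the block is `{a, b}`. -/
theorem partitionSum_cut {s R : Finset α} {a b : α} (h : IsCut s R a b) (u : α → T → ℝ) :
    partitionSum σ c s R u = partitionSum σ c s (insert b R) u +
      (partitionSum σ c (s.erase b) R
        (Function.update u a fun x => c x * u b x * u a x) +
      (∫ x, u b x * u a x ∂σ) * partitionSum σ c ((s.erase a).erase b) (R.erase a) u) := by
  classical
  have hab := h.lt
  unfold partitionSum
  rw [← Finset.sum_filter_add_sum_filter_not _ fun P => ∀ B ∈ P, ¬ (a ∈ B ∧ b ∈ B)]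
  congr 1
  · refine Finset.sum_congr ?_ fun _ _ => rfl
    ext P
    simp [IsSepPartition.insert_iff h]
  rw [← Finset.sum_filter_add_sum_filter_not _ fun P => {a, b} ∉ P]
  congr 1
  · refine Finset.sum_nbij' (fun P => P.image fun B => B.erase b) (fun P => P.image (addSucc a b))
      ?_ ?_ ?_ ?_ ?_
    · intro P hP
      simp only [Finset.mem_filter, Finset.mem_univ, true_and] at hP ⊢
      obtain ⟨⟨hP, hex⟩, hpair⟩ := hP
      push Not at hex
      obtain ⟨B, hB, ha, hb⟩ := hex
      refine hP.erase_succ hB hb ?_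
      have hsub : ({a, b} : Finset α) ⊂ B := by
        refine Finset.ssubset_iff_subset_ne.2 ⟨?_, fun e => hpair (e ▸ hB)⟩
        simp [Finset.insert_subset_iff, ha, hb]
      have := Finset.card_lt_card hsub
      rw [Finset.card_pair hab.ne] at this
      omega
    · intro P hP
      simp only [Finset.mem_filter, Finset.mem_univ, true_and] at hP ⊢
      refine ⟨⟨hP.add_succ h, ?_⟩, ?_⟩
      · push Not
        obtain ⟨B, hB, haB⟩ := hP.cover a (Finset.mem_erase.2 ⟨hab.ne, h.sub h.ha⟩)
        exact ⟨_, Finset.mem_image_of_mem _ hB, mem_addSucc.2 (Or.inl haB),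
          mem_addSucc.2 (Or.inr ⟨haB, rfl⟩)⟩
      · intro hmem
        obtain ⟨B, hB, e⟩ := Finset.mem_image.1 hmem
        have hbB : b ∉ B := fun hb => by simpa using hP.sub B hB hb
        have h1 := erase_addSucc (a := a) hbB
        have h2 := hP.two B hB
        rw [← h1, e, Finset.card_erase_of_mem (by simp), Finset.card_pair hab.ne] at h2
        omega
    · intro P hP
      simp only [Finset.mem_filter, Finset.mem_univ, true_and] at hP
      obtain ⟨⟨hP, hex⟩, hpair⟩ := hP
      push Not at hex
      obtain ⟨B₀, hB₀, ha, hb⟩ := hex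
      rw [Finset.image_image]
      refine Eq.trans (Finset.image_congr fun B hB => ?_) Finset.image_id
      ext x
      simp only [Function.comp_apply, mem_addSucc, Finset.mem_erase, id]
      constructor
      · rintro (hx | ⟨hx, rfl⟩)
        · exact hx.2
        · rwa [hP.disj B hB B₀ hB₀ a hx.2 ha]
      · intro hx
        by_cases hxb : x = b
        · subst hxb
          rw [hP.disj B hB B₀ hB₀ x hx hb]
          exact Or.inr ⟨⟨hab.ne, ha⟩, rfl⟩
        · exact Or.inl ⟨hxb, hx⟩
    · intro P hP
      simp only [Finset.mem_filter, Finset.mem_univ, true_and] at hP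
      rw [Finset.image_image]
      refine Eq.trans (Finset.image_congr fun B hB => ?_) Finset.image_id
      exact erase_addSucc fun hb => by simpa using hP.sub B hB hb
    · intro P hP
      simp only [Finset.mem_filter, Finset.mem_univ, true_and] at hP
      obtain ⟨⟨hP, hex⟩, hpair⟩ := hP
      push Not at hex
      obtain ⟨B₀, hB₀, ha, hb⟩ := hex
      have hne {B : Finset α} (hB : B ∈ P) : ∃ x ∈ B, x ≠ b :=
        Finset.exists_mem_ne (hP.two B hB) b
      rw [Finset.prod_image]
      · refine Finset.prod_congr rfl fun B hB => ?_
        by_cases hBB : B = B₀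
        · subst hBB
          have hsub : ({a, b} : Finset α) ⊂ B := by
            refine Finset.ssubset_iff_subset_ne.2 ⟨?_, fun e => hpair (e ▸ hB)⟩
            simp [Finset.insert_subset_iff, ha, hb]
          have hcard := Finset.card_lt_card hsub
          rw [Finset.card_pair hab.ne] at hcard
          unfold blockMoment
          congr 1
          funext x
          have hab' : a ∈ B.erase b := Finset.mem_erase.2 ⟨hab.ne, ha⟩
          have hupd : ∏ i ∈ (B.erase b).erase a,
              Function.update u a (fun x => c x * u b x * u a x) i x =
              ∏ i ∈ (B.erase b).erase a, u i x :=
            Finset.prod_congr rfl fun i hi => by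
              rw [Function.update_of_ne (Finset.ne_of_mem_erase hi)]
          rw [Finset.card_erase_of_mem hb, ← Finset.mul_prod_erase _ _ hb,
            ← Finset.mul_prod_erase _ _ hab', ← Finset.mul_prod_erase _ _ hab',
            Function.update_self, hupd,
            show B.card - 2 = B.card - 1 - 2 + 1 by omega, pow_succ]
          ring
        · have hbB : b ∉ B := fun hbB => hBB (hP.disj B hB B₀ hB₀ b hbB hb)
          have haB : a ∉ B := fun haB => hBB (hP.disj B hB B₀ hB₀ a haB ha)
          rw [Finset.erase_eq_of_notMem hbB]
          refine blockMoment_congr σ c fun i hi => ?_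
          rw [Function.update_of_ne]
          rintro rfl
          exact haB hi
      · intro B hB B' hB' e
        obtain ⟨x, hx, hxb⟩ := hne hB
        refine hP.disj B hB B' hB' x hx ?_
        have : x ∈ B.erase b := Finset.mem_erase.2 ⟨hxb, hx⟩
        simp only at e
        rw [e] at this
        exact Finset.mem_of_mem_erase this
  · rw [Finset.mul_sum]
    refine Finset.sum_nbij' (fun P => P.erase {a, b}) (fun P => insert {a, b} P) ?_ ?_ ?_ ?_ ?_
    · intro P hP
      simp only [Finset.mem_filter, Finset.mem_univ, true_and, not_not] at hP ⊢
      exact hP.1.1.erase_pair hP.2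
    · intro P hP
      simp only [Finset.mem_filter, Finset.mem_univ, true_and, not_not] at hP ⊢
      refine ⟨⟨IsSepPartition.insert_pair h hP, ?_⟩, Finset.mem_insert_self _ _⟩
      push Not
      exact ⟨_, Finset.mem_insert_self _ _, by simp, by simp⟩
    · intro P hP
      simp only [Finset.mem_filter, Finset.mem_univ, true_and, not_not] at hP
      exact Finset.insert_erase hP.2
    · intro P hP
      simp only [Finset.mem_filter, Finset.mem_univ, true_and] at hP
      refine Finset.erase_insert fun hmem => ?_
      have := hP.sub _ hmem (show a ∈ {a, b} by simp)
      simp at this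
    · intro P hP
      simp only [Finset.mem_filter, Finset.mem_univ, true_and, not_not] at hP
      rw [← Finset.mul_prod_erase _ _ hP.2]
      congr 1
      unfold blockMoment
      congr 1
      funext x
      rw [Finset.card_pair hab.ne, Finset.prod_pair hab.ne, Nat.sub_self, pow_zero, one_mul,
        mul_comm]

theorem partitionSum_singleton (s : Finset α) (b : α) (u : α → T → ℝ) :
    partitionSum σ c s {b} u = partitionSum σ c s ∅ u := by
  classical
  unfold partitionSum
  refine Finset.sum_congr (Finset.filter_congr fun P _ => ?_) fun _ _ => rfl
  exact IsSepPartition.singleton_iff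

/-- If all elements are in distinct blocks, there are singletons. -/
theorem partitionSum_self {s : Finset α} (hs : s.Nonempty) (u : α → T → ℝ) :
    partitionSum σ c s s u = 0 := by
  classical
  unfold partitionSum
  rw [Finset.filter_eq_empty_iff.2, Finset.sum_empty]
  intro P _ hP
  obtain ⟨a, ha⟩ := hs
  obtain ⟨B, hB, haB⟩ := hP.cover a ha
  obtain ⟨d, hd, hda⟩ := Finset.exists_mem_ne (hP.two B hB) a
  exact hda (hP.sep B hB d hd a haB (hP.sub B hB hd) ha)

theorem partitionSum_empty (u : α → T → ℝ) : partitionSum σ c ∅ ∅ u = 1 := by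
  classical
  unfold partitionSum
  have : (Finset.univ.filter fun P : Finset (Finset α) => IsSepPartition ∅ ∅ P) = {∅} := by
    ext P
    simp only [Finset.mem_filter, Finset.mem_univ, true_and, Finset.mem_singleton]
    constructor
    · intro hP
      refine Finset.eq_empty_of_forall_notMem fun B hB => ?_
      have h1 := hP.two B hB
      rw [Finset.subset_empty.1 (hP.sub B hB)] at h1
      simp at h1
    · rintro rfl
      exact ⟨by simp, by simp, by simp, by simp, by simp, by simp⟩
  rw [this, Finset.sum_singleton, Finset.prod_empty]

/-- `partitionSum` in terms of `Finpartition`s. -/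
theorem sum_NC₂ (n : ℕ) (u : Fin n → T → ℝ) :
    ∑ ζ ∈ NC₂ n, ∏ B : ζ.parts, blockMoment σ c u B.1 =
      partitionSum σ c Finset.univ ∅ u := by
  classical
  unfold partitionSum NC₂
  have hfin (P : Finset (Finset (Fin n))) (hP : IsSepPartition Finset.univ ∅ P) :
      ∃ ζ : Finpartition (Finset.univ : Finset (Fin n)), ζ.parts = P :=
    ⟨{  parts := P
        supIndep := Finset.supIndep_iff_pairwiseDisjoint.2 fun B hB B' hB' hne =>
          Finset.disjoint_left.2 fun x hx hx' => hne (hP.disj B hB B' hB' x hx hx')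
        sup_parts := by ext x; simpa using hP.cover x (Finset.mem_univ x)
        bot_notMem := fun h => by simpa using hP.two _ h }, rfl⟩
  refine Finset.sum_bij (fun ζ _ => ζ.parts) ?_ ?_ ?_ ?_
  · intro ζ hζ
    simp only [Finset.mem_filter, Finset.mem_univ, true_and] at hζ ⊢
    refine ⟨fun B _ => Finset.subset_univ B, hζ.2, fun x _ => ?_, ?_, ?_, by simp⟩
    · exact ⟨ζ.part x, ζ.part_mem.2 (Finset.mem_univ x), ζ.mem_part (Finset.mem_univ x)⟩
    · exact fun B hB B' hB' x hx hx' => ζ.eq_of_mem_parts hB hB' hx hx'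
    · intro B hB B' hB' x hx y hy z hz w hw hxy hyz hzw
      by_contra hne
      exact hζ.1 B hB B' hB' hne x hx y hy z hz w hw ⟨hxy, hyz, hzw⟩
  · exact fun ζ _ ζ' _ e => Finpartition.ext e
  · intro P hP
    simp only [Finset.mem_filter, Finset.mem_univ, true_and] at hP
    obtain ⟨ζ, rfl⟩ := hfin P hP
    refine ⟨ζ, ?_, rfl⟩
    simp only [Finset.mem_filter, Finset.mem_univ, true_and]
    exact ⟨fun B hB B' hB' hne x hx y hy z hz w hw hlt =>
      hne (hP.nc B hB B' hB' x hx y hy z hz w hw hlt.1 hlt.2.1 hlt.2.2), hP.two⟩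
  · intro ζ _
    exact Finset.prod_coe_sort ζ.parts fun B => blockMoment σ c u B

end Sums

/-! ### Field operators and vacuum expectations -/

noncomputable section Words

variable {T : Type*} [TopologicalSpace T] [T2Space T]
  [SecondCountableTopology T] [LocallyCompactSpace T] [MeasurableSpace T] [BorelSpace T]
  (σ : Measure T) [IsFiniteMeasureOnCompacts σ] (c : C(T, ℝ))

/-- The test function `1` of no variables. -/
def oneTest : Test T 0 where
  toFun _ := 1
  hasCompactSupport' := HasCompactSupport.of_compactSpace _

@[simp] theorem oneTest_apply (x : Fin 0 → T) : oneTest x = 1 := rfl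

/-- The vacuum vector `(1, 0, 0, …)`. -/
def vacuum : TestSeq T := DirectSum.lof ℝ ℕ (fun n => Test T n) 0 oneTest

/-- `λ χ ψ` for functions `χ`, `ψ` of one variable -/
def mulLetter (χ ψ : Test T 1) : Test T 1 := diag c 0 (tensor 1 1 χ ψ)

theorem mulLetter_apply (χ ψ : Test T 1) (s : T) :
    mulLetter c χ ψ (fun _ => s) = c s * χ (fun _ => s) * ψ fun _ => s :=
  diag_zero_tensor c 0 χ ψ _

/-- `∫ χ ψ dσ` for functions `χ`, `ψ` of one variable -/
def pairing (χ ψ : Test T 1) : ℝ := ∫ s, χ (fun _ => s) * ψ (fun _ => s) ∂σ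

theorem seq_ext {p q : TestSeq T} (h : ∀ m x, p m x = q m x) : p = q :=
  DFinsupp.ext fun m => DFunLike.ext _ _ (h m)

theorem neutralCore_createCore (χ ψ : Test T 1) (p : TestSeq T) :
    neutralCore c χ (createCore ψ p) = createCore (mulLetter c χ ψ) p := by
  refine seq_ext fun m x => ?_
  cases m with
  | zero => rw [neutralCore_zero, createCore_zero]
  | succ m =>
    have h (y : T) : (fun _ : Fin 1 => y) = fun _ => y := rfl
    rw [neutralCore_succ, createCore_succ, createCore_succ, diag_zero_tensor, tensor_one_apply,
      tensor_one_apply, mulLetter_apply]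
    ring

theorem annihilateCore_createCore (χ ψ : Test T 1) (p : TestSeq T) :
    annihilateCore σ χ (createCore ψ p) = pairing σ χ ψ • p := by
  refine seq_ext fun m x => ?_
  rw [annihilateCore_apply, createCore_succ, contract_zero_tensor, DirectSum.smul_apply,
    CompactlySupportedContinuousMap.smul_apply, smul_eq_mul, pairing, ← integral_mul_const]
  congr 1
  funext s
  rw [tensor_one_apply, Fin.cons_zero, Fin.tail_cons, mul_assoc]

theorem annihilateCore_neutralCore (χ ψ : Test T 1) (p : TestSeq T) :
    annihilateCore σ χ (neutralCore c ψ p) = annihilateCore σ (mulLetter c χ ψ) p := by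
  refine seq_ext fun m x => ?_
  rw [annihilateCore_apply, annihilateCore_apply, neutralCore_succ, contract_zero_tensor,
    contract_zero_tensor]
  congr 1
  funext s
  rw [diag_zero_tensor, Fin.cons_zero, mulLetter_apply]
  ring

theorem neutralCore_vacuum (χ : Test T 1) : neutralCore c χ vacuum = 0 := by
  simp [neutralCore, vacuum]

theorem annihilateCore_vacuum (χ : Test T 1) : annihilateCore σ χ vacuum = 0 := by
  simp [annihilateCore, vacuum]

theorem wordCore_one_apply (χ : Test T 1) (p : TestSeq T) :
    wordCore σ c 1 χ p = createCore χ p + neutralCore c χ p + annihilateCore σ χ p := by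
  rw [wordCore_one]; rfl

/-- The quadratic relation between an annihilation operator and a field operator: the annihilated
variable is paired with the new letter, or it is merged with it, or it is found further to the
right and the new letter is annihilated as well. -/
theorem annihilateCore_wordCore (χ ψ : Test T 1) (p : TestSeq T) :
    annihilateCore σ χ (wordCore σ c 1 ψ p) = pairing σ χ ψ • p +
      annihilateCore σ (mulLetter c χ ψ) p + annihilateCore σ χ (annihilateCore σ ψ p) := by
  rw [wordCore_one_apply, map_add, map_add, annihilateCore_createCore, annihilateCore_neutralCore]

/-- The elementary tensor `χ_1 ⊗ ⋯ ⊗ χ_n`. -/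
def pureTensor : List (Test T 1) → TestSeq T
  | [] => vacuum
  | χ :: l => createCore χ (pureTensor l)

/-- The vector `⟨ω, χ_1⟩ ⋯ ⟨ω, χ_n⟩ Ω`. -/
def wordVec : List (Test T 1) → TestSeq T
  | [] => vacuum
  | χ :: l => wordCore σ c 1 χ (wordVec l)

theorem wordVec_eq_foldl (l : List (Test T 1)) :
    wordVec σ c l = l.reverse.foldl (fun p χ => wordCore σ c 1 χ p) vacuum := by
  rw [List.foldl_reverse]
  induction l with
  | nil => rfl
  | cons χ l ih => rw [wordVec, ih]; rfl

theorem foldl_add (l : List (Test T 1)) (p q : TestSeq T) :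
    l.foldl (fun p χ => wordCore σ c 1 χ p) (p + q) =
      l.foldl (fun p χ => wordCore σ c 1 χ p) p + l.foldl (fun p χ => wordCore σ c 1 χ p) q := by
  induction l generalizing p q with
  | nil => rfl
  | cons χ l ih => simp only [List.foldl_cons, map_add, ih]

theorem foldl_smul (l : List (Test T 1)) (r : ℝ) (p : TestSeq T) :
    l.foldl (fun p χ => wordCore σ c 1 χ p) (r • p) =
      r • l.foldl (fun p χ => wordCore σ c 1 χ p) p := by
  induction l generalizing p with
  | nil => rfl
  | cons χ l ih => simp only [List.foldl_cons, map_smul, ih]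

/-- The component of a vector in the vacuum direction. -/
def vacuumCoeff : TestSeq T →ₗ[ℝ] ℝ where
  toFun p := p 0 Fin.elim0
  map_add' _ _ := rfl
  map_smul' _ _ := rfl

theorem vacuumCoeff_vacuum : vacuumCoeff (vacuum : TestSeq T) = 1 := by
  change (vacuum : TestSeq T) 0 Fin.elim0 = 1
  rw [vacuum, DirectSum.lof_apply]
  rfl

theorem vacuumCoeff_createCore (χ : Test T 1) (p : TestSeq T) :
    vacuumCoeff (createCore χ p) = 0 := by
  change createCore χ p 0 _ = 0
  rw [createCore_zero]; rfl

theorem vacuumCoeff_neutralCore (χ : Test T 1) (p : TestSeq T) :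
    vacuumCoeff (neutralCore c χ p) = 0 := by
  change neutralCore c χ p 0 _ = 0
  rw [neutralCore_zero]; rfl

theorem vacuumCoeff_wordCore (χ : Test T 1) (p : TestSeq T) :
    vacuumCoeff (wordCore σ c 1 χ p) = vacuumCoeff (annihilateCore σ χ p) := by
  rw [wordCore_one_apply, map_add, map_add, vacuumCoeff_createCore, vacuumCoeff_neutralCore]
  simp

/-- The vacuum component of field operators acting on an elementary tensor. The variables of the
tensor are the elements of the stack, the last one first; they are in blocks that are still open,
hence in distinct ones. -/
theorem vacuumCoeff_foldl {α : Type*} [LinearOrder α] [Fintype α] (W : List α) :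
    ∀ (st : List α) (u : α → Test T 1), (st.reverse ++ W).Pairwise (· < ·) →
      vacuumCoeff ((W.map u).foldl (fun p χ => wordCore σ c 1 χ p) (pureTensor (st.map u))) =
        partitionSum σ c (st.reverse ++ W).toFinset st.toFinset fun i s => u i fun _ => s := by
  induction W with
  | nil =>
    intro st u hs
    cases st with
    | nil =>
      exact vacuumCoeff_vacuum.trans (partitionSum_empty σ c _).symm
    | cons a st =>
      have e : ((a :: st).reverse ++ []).toFinset = (a :: st).toFinset := by ext; simp
      rw [e, partitionSum_self σ c ⟨a, by simp⟩]
      exact vacuumCoeff_createCore _ _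
  | cons b W ih =>
    intro st u hs
    cases st with
    | nil =>
      have h1 : wordCore σ c 1 (u b) vacuum = pureTensor ([b].map u) := by
        rw [wordCore_one_apply, neutralCore_vacuum, annihilateCore_vacuum, add_zero, add_zero]
        rfl
      have h2 := ih [b] u (by simpa using hs)
      have h3 : ([b].reverse ++ W).toFinset = ([].reverse ++ b :: W).toFinset := by simp
      rw [h3, List.toFinset_cons, List.toFinset_nil, insert_empty_eq, partitionSum_singleton] at h2
      rw [List.map_nil, List.map_cons, List.foldl_cons, pureTensor, h1, h2]
      rfl
    | cons a st =>
      obtain ⟨hst, hW, hlt⟩ := List.pairwise_append.1 hs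
      rw [List.pairwise_reverse, List.pairwise_cons] at hst
      rw [List.pairwise_cons] at hW
      have hab : a < b := hlt a (by simp) b (by simp)
      have haW : a ∉ W := fun h => lt_irrefl a (hlt a (by simp) a (by simp [h]))
      have hbW : b ∉ W := fun h => lt_irrefl b (hW.1 b h)
      have hast : a ∉ st := fun h => lt_irrefl a (hst.1 a h)
      have hbst : b ∉ st := fun h => lt_irrefl b (hlt b (by simp [h]) b (by simp))
      have hcut : IsCut ((a :: st).reverse ++ b :: W).toFinset (a :: st).toFinset a b := by
        refine ⟨fun x hx => ?_, by simp, by simp, fun x hx => ?_, fun x hx => ?_⟩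
        · simp only [List.mem_toFinset, List.mem_append, List.mem_reverse] at hx ⊢
          exact Or.inl hx
        · simp only [List.mem_toFinset, List.mem_append, List.mem_reverse] at hx ⊢
          refine ⟨fun hxb => hx.resolve_right fun h => ?_, fun h => hlt x (List.mem_reverse.2 h) b (by simp)⟩
          rcases List.mem_cons.1 h with rfl | h
          · exact lt_irrefl _ hxb
          · exact lt_asymm hxb (hW.1 x h)
        · simp only [List.mem_toFinset, List.mem_cons] at hx
          rcases hx with rfl | hx
          exacts [le_rfl, (hst.1 x hx).le]
      rw [partitionSum_cut σ c hcut, List.map_cons, List.map_cons, List.foldl_cons]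
      have h1 : wordCore σ c 1 (u b) (pureTensor (u a :: st.map u)) =
          pureTensor ((b :: a :: st).map u) + (pureTensor (mulLetter c (u b) (u a) :: st.map u) +
            pairing σ (u b) (u a) • pureTensor (st.map u)) := by
        rw [wordCore_one_apply, pureTensor, neutralCore_createCore, annihilateCore_createCore,
          add_assoc]
        rfl
      rw [h1, foldl_add, foldl_add, foldl_smul, map_add, map_add, map_smul]
      congr 1
      · rw [ih (b :: a :: st) u (by simpa using hs)]
        congr 1
        · ext; simp
        · exact List.toFinset_cons
      congr 1
      · let u' := Function.update u a (mulLetter c (u b) (u a))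
        have hu' (L : List α) (hL : a ∉ L) : L.map u' = L.map u :=
          List.map_congr_left fun i hi => Function.update_of_ne (ne_of_mem_of_not_mem hi hL) _ _
        have h2 := ih (a :: st) u' (hs.sublist (by simp))
        rw [hu' W haW, List.map_cons, hu' st hast,
          show u' a = mulLetter c (u b) (u a) from Function.update_self ..] at h2
        rw [h2]
        have hset : ((a :: st).reverse ++ W).toFinset =
            ((a :: st).reverse ++ b :: W).toFinset.erase b := by
          ext x
          by_cases hxb : x = b
          · subst hxb
            simp [hbW, hbst, hab.ne']
          · simp [hxb]
        rw [hset]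
        congr 1
        funext i s
        by_cases hia : i = a
        · subst hia
          simp only [u', Function.update_self, mulLetter_apply]
        · simp only [u', Function.update_of_ne hia]
      · rw [ih st u (hs.sublist ?_), smul_eq_mul]
        · congr 1
          have hset : (st.reverse ++ W).toFinset =
            (((a :: st).reverse ++ b :: W).toFinset.erase a).erase b := by
            ext x
            by_cases hxb : x = b
            · subst hxb
              simp [hbW, hbst]
            · by_cases hxa : x = a
              · subst hxa
                simp [haW, hast]
              · simp [hxb, hxa]
          have hset' : st.toFinset = (a :: st).toFinset.erase a := by
            rw [List.toFinset_cons, Finset.erase_insert (by simpa using hast)]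
          rw [hset, hset']
        · rw [List.reverse_cons, List.append_assoc]
          exact List.Sublist.append (List.Sublist.refl _) (by simp)

/-- The vacuum expectation of a product of field operators as a sum over non-crossing partitions.
The letters are numbered from the right, as the rightmost one acts first; this agrees with `𝔾`, where
`D_{t_n}` acts first and takes the first variable of the kernel. -/
theorem vacuumCoeff_wordVec (l : List (Test T 1)) (n : ℕ) (hn : l.length = n) :
    vacuumCoeff (wordVec σ c l) = ∑ ζ ∈ NC₂ n, ∏ B : ζ.parts,
      blockMoment σ c (fun (i : Fin n) s => l.get (Fin.cast hn.symm i.rev) fun _ => s) B.1 := by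
  subst hn
  rw [sum_NC₂]
  have h := vacuumCoeff_foldl σ c (List.finRange l.length) [] (fun i => l.get i.rev)
    (by simpa using List.pairwise_lt_finRange _)
  have h1 : (List.finRange l.length).map (fun i => l.get i.rev) = l.reverse := by
    refine List.ext_get (by simp) fun i h1 h2 => ?_
    simp
    congr 1
    omega
  rw [h1] at h
  rw [wordVec_eq_foldl]
  refine h.trans ?_
  congr 1
  ext; simp

end Words

/-! ### Words under the global operator and the annihilation operator -/

noncomputable section GlobalWords

variable {T : Type*} [TopologicalSpace T] [T2Space T]
  [SecondCountableTopology T] [LocallyCompactSpace T] [MeasurableSpace T] [BorelSpace T]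
  (σ : Measure T) [IsFiniteMeasureOnCompacts σ] (c : C(T, ℝ))

/-- The kernel of the elementary tensor `χ_1 ⊗ ⋯ ⊗ χ_n`. -/
def pureKernel : (l : List (Test T 1)) → Test T l.length
  | [] => oneTest
  | χ :: l => tensor l.length 1 χ (pureKernel l)

theorem pureTensor_eq_lof (l : List (Test T 1)) :
    pureTensor l = DirectSum.lof ℝ ℕ (fun n => Test T n) l.length (pureKernel l) := by
  induction l with
  | nil => rfl
  | cons χ l ih => simp [pureTensor, ih, createCore, pureKernel]

theorem pureKernel_apply (l : List (Test T 1)) (x : Fin l.length → T) :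
    pureKernel l x = ∏ i : Fin l.length, l.get i fun _ => x i := by
  induction l with
  | nil => simp [pureKernel]
  | cons χ l ih =>
    have h : pureKernel (χ :: l) x = _ := tensor_one_apply l.length χ (pureKernel l) x
    rw [h, ih]
    exact (Fin.prod_univ_succ fun i : Fin (l.length + 1) => (χ :: l).get i fun _ => x i).symm

theorem lof_congr {i j : ℕ} (h : i = j) {f : Test T i} {g : Test T j}
    (hfg : ∀ x : Fin j → T, f (fun k => x (Fin.cast h k)) = g x) :
    DirectSum.lof ℝ ℕ (fun n => Test T n) i f = DirectSum.lof ℝ ℕ (fun n => Test T n) j g := by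
  subst h
  congr 1
  ext x
  exact hfg x

theorem prod_fin_split {M : Type*} [CommMonoid M] {n k N : ℕ} (h : N = k + n) (F : Fin N → M) :
    ∏ i, F i = (∏ i : Fin n, F ⟨i, by omega⟩) * ∏ i : Fin k, F ⟨n + i, by omega⟩ := by
  have h' : n + k = N := by omega
  rw [← Fin.prod_congr' F h', Fin.prod_univ_add]
  rfl

theorem prod_blocks {n : ℕ} (ζ : Finpartition (Finset.univ : Finset (Fin n)))
    (u : Fin n → T → ℝ) (s : ζ.parts → T) :
    ∏ i, u i (s (block ζ i)) = ∏ B : ζ.parts, ∏ i ∈ B.1, u i (s B) := by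
  classical
  rw [← Finset.prod_fiberwise Finset.univ (block ζ)]
  refine Finset.prod_congr rfl fun B _ => ?_
  have : (Finset.univ.filter fun i => block ζ i = B) = B.1 := by
    ext i
    simp only [Finset.mem_filter, Finset.mem_univ, true_and]
    constructor
    · rintro rfl
      exact ζ.mem_part (Finset.mem_univ i)
    · exact fun hi => Subtype.ext (ζ.part_eq_of_mem B.2 hi)
  rw [this]
  refine Finset.prod_congr rfl fun i hi => ?_
  rw [show block ζ i = B from Subtype.ext (ζ.part_eq_of_mem B.2 hi)]

/-- On an elementary tensor the integral over the block variables factorizes. -/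
theorem blockContract_prod {n k N : ℕ} (ζ : Finpartition (Finset.univ : Finset (Fin n)))
    (h : N = k + n) (f : Test T N) (F : Fin N → T → ℝ) (hf : ∀ x, f x = ∏ i, F i (x i))
    (x : Fin k → T) :
    blockContract σ c ζ h f x =
      (∏ B : ζ.parts, blockMoment σ c (fun i : Fin n => F ⟨i.rev, by omega⟩) B.1) *
        ∏ i : Fin k, F ⟨n + i, by omega⟩ (x i) := by
  have h1 : blockContract σ c ζ h f x = ∫ s : ζ.parts → T,
      (∏ B : ζ.parts, c (s B) ^ (B.1.card - 2) * ∏ i ∈ B.1, F ⟨i.rev, by omega⟩ (s B)) *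
        ∏ i : Fin k, F ⟨n + i, by omega⟩ (x i) ∂Measure.pi fun _ => σ := by
    change ∫ s : ζ.parts → T, _ ∂_ = _
    congr 1
    funext s
    rw [hf, prod_fin_split h, Finset.prod_mul_distrib,
      ← prod_blocks ζ (fun i : Fin n => F ⟨i.rev, by omega⟩) s, ← mul_assoc]
    congr 1
    · rw [weight]
      congr 1
      rw [← Equiv.prod_comp Fin.revPerm]
      refine Finset.prod_congr rfl fun i _ => ?_
      congr 1
      exact congrFun (prepend_fst h (fun i => s (block ζ i)) x) i
    · refine Finset.prod_congr rfl fun i _ => ?_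
      congr 1
      exact congrFun (prepend_snd h (fun i => s (block ζ i)) x) i
  rw [h1, integral_mul_const]
  congr 1
  exact integral_fintype_prod_eq_prod (μ := fun _ : ζ.parts => σ)
    fun (B : ζ.parts) y => c y ^ (B.1.card - 2) * ∏ i ∈ B.1, F ⟨i.rev, by omega⟩ y

theorem sum_blockSeq (l : List (Test T 1)) (n : ℕ) (hn : n ≤ l.length) :
    ∑ ζ ∈ NC₂ n, blockSeq σ c ζ (pureTensor l) =
      vacuumCoeff (wordVec σ c (l.take n)) • pureTensor (l.drop n) := by
  rw [vacuumCoeff_wordVec σ c (l.take n) n (by simp [hn]), Finset.sum_smul]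
  refine Finset.sum_congr rfl fun ζ _ => ?_
  rw [pureTensor_eq_lof, pureTensor_eq_lof, blockSeq_lof, dif_pos hn, ← map_smul]
  refine lof_congr (by simp) fun x => ?_
  rw [blockContract_prod σ c ζ _ (pureKernel l) (fun i s => l.get i fun _ => s)
    (pureKernel_apply l), CompactlySupportedContinuousMap.smul_apply, smul_eq_mul,
    pureKernel_apply]
  congr 1
  · refine Finset.prod_congr rfl fun B _ => blockMoment_congr σ c fun i _ => ?_
    funext s
    simp
  · have h : (l.drop n).length = l.length - n := by simp
    rw [← Fin.prod_congr' (fun i : Fin (l.drop n).length => (l.drop n).get i fun _ => x i) h.symm]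
    refine Finset.prod_congr rfl fun i _ => ?_
    simp

/-- The splittings of a word: the prefix is applied to the vacuum, the suffix is the index. -/
def splitting : List (Test T 1) → List (Test T 1) →₀ TestSeq T
  | [] => Finsupp.single [] vacuum
  | χ :: l => Finsupp.single (χ :: l) vacuum +
      Finsupp.mapRange.linearMap (wordCore σ c 1 χ) (splitting l)

theorem splitting_eq_sum (l : List (Test T 1)) : splitting σ c l =
    ∑ n ∈ Finset.range (l.length + 1), Finsupp.single (l.drop n) (wordVec σ c (l.take n)) := by
  induction l with
  | nil => simp [splitting, wordVec]
  | cons χ l ih =>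
    rw [splitting, ih, map_sum, List.length_cons, Finset.sum_range_succ' _ (l.length + 1), add_comm]
    simp [wordVec]

theorem splitting_nil_apply (l : List (Test T 1)) : splitting σ c l [] = wordVec σ c l := by
  induction l with
  | nil => simp [splitting, wordVec]
  | cons χ l ih => simp [splitting, wordVec, ih]

/-- `∑ ⟨prefix⟩ y(suffix)`, where the bracket is the vacuum expectation. -/
def contractPrefix (y : List (Test T 1) → TestSeq T) :
    (List (Test T 1) →₀ TestSeq T) →ₗ[ℝ] TestSeq T :=
  Finsupp.lsum ℝ fun l => vacuumCoeff.smulRight (y l)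

theorem contractPrefix_single (y : List (Test T 1) → TestSeq T) (l : List (Test T 1))
    (p : TestSeq T) : contractPrefix y (Finsupp.single l p) = vacuumCoeff p • y l := by
  simp [contractPrefix]

theorem map_contractPrefix (y : List (Test T 1) → TestSeq T) (L : TestSeq T →ₗ[ℝ] TestSeq T)
    (z : List (Test T 1) →₀ TestSeq T) :
    L (contractPrefix y z) = contractPrefix (fun l => L (y l)) z := by
  induction z using Finsupp.induction_linear with
  | zero => simp
  | add f g hf hg => simp [hf, hg]
  | single l p => rw [contractPrefix_single, contractPrefix_single, map_smul]

/-- The global operator replaces the prefixes of a word by their vacuum expectations. -/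
theorem globalSeq_pureTensor (l : List (Test T 1)) :
    globalSeq σ c (pureTensor l) = contractPrefix pureTensor (splitting σ c l) := by
  have h0 : ∀ m, l.length < m → pureTensor l m = 0 := fun m hm => by
    rw [pureTensor_eq_lof, lof_apply, dif_neg (by omega)]
  rw [globalSeq_eq σ c l.length _ h0, splitting_eq_sum, map_sum, Finset.sum_range_succ']
  simp only [contractPrefix_single]
  rw [add_comm]
  congr 1
  · rw [← Finset.sum_filter_add_sum_filter_not (Finset.range l.length) (fun n => n = 0)]
    have h1 : ∑ n ∈ Finset.range l.length with n = 0,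
        vacuumCoeff (wordVec σ c (l.take (n + 1))) • pureTensor (l.drop (n + 1)) = 0 := by
      refine Finset.sum_eq_zero fun n hn => ?_
      simp only [Finset.mem_filter, Finset.mem_range] at hn
      obtain ⟨hn, rfl⟩ := hn
      cases l with
      | nil => simp at hn
      | cons χ l =>
        have : vacuumCoeff (wordVec σ c [χ]) = 0 := by
          rw [wordVec, vacuumCoeff_wordCore, wordVec, annihilateCore_vacuum, map_zero]
        simp [this]
    rw [h1, zero_add]
    refine Finset.sum_bij' (fun n _ => n - 1) (fun n _ => n + 1) ?_ ?_ ?_ ?_ ?_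
    · intro n hn; simp at hn ⊢; omega
    · intro n hn; simp at hn ⊢; omega
    · intro n hn; simp at hn; omega
    · intro n hn; simp
    · intro n hn
      simp only [Finset.mem_Icc] at hn
      rw [sum_blockSeq σ c l n hn.2, show n - 1 + 1 = n by omega]
  · simp [wordVec, vacuumCoeff_vacuum]

/-- The span of the splittings of the words with fewer than `n` letters. -/
def splittingSpan (n : ℕ) : Submodule ℝ (List (Test T 1) →₀ TestSeq T) :=
  Submodule.span ℝ (splitting σ c '' {l | l.length < n})

theorem splittingSpan_mono {m n : ℕ} (h : m ≤ n) : splittingSpan σ c m ≤ splittingSpan σ c n :=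
  Submodule.span_mono (Set.image_mono fun _ hl => lt_of_lt_of_le hl h)

/-- Annihilating in the prefixes of a word gives the splittings of a combination of shorter words:
an annihilation operator turns a word into a combination of its proper suffixes, in a way that does
not depend on where the word is cut afterwards. -/
theorem annihilate_mem_splittingSpan (n : ℕ) : ∀ (ψ : Test T 1),
    ∀ z ∈ splittingSpan σ c (n + 1),
      Finsupp.mapRange.linearMap (annihilateCore σ ψ) z ∈ splittingSpan σ c n := by
  induction n with
  | zero =>
    intro ψ z hz
    have : splittingSpan σ c (0 + 1) ≤
        (splittingSpan σ c 0).comap (Finsupp.mapRange.linearMap (annihilateCore σ ψ)) := by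
      rw [splittingSpan, Submodule.span_le]
      rintro _ ⟨l, hl, rfl⟩
      obtain rfl : l = [] := by simpa using hl
      simp [splitting, annihilateCore_vacuum]
    exact this hz
  | succ n ih =>
    intro ψ z hz
    have : splittingSpan σ c (n + 1 + 1) ≤
        (splittingSpan σ c (n + 1)).comap (Finsupp.mapRange.linearMap (annihilateCore σ ψ)) := by
      rw [splittingSpan, Submodule.span_le]
      rintro _ ⟨l, hl, rfl⟩
      cases l with
      | nil => simp [splitting, annihilateCore_vacuum]
      | cons χ l =>
        have hl' : splitting σ c l ∈ splittingSpan σ c (n + 1) :=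
          Submodule.subset_span ⟨l, by simpa using hl, rfl⟩
        have h1 : Finsupp.mapRange.linearMap (annihilateCore σ ψ) (splitting σ c (χ :: l)) =
            pairing σ ψ χ • splitting σ c l +
              Finsupp.mapRange.linearMap (annihilateCore σ (mulLetter c ψ χ)) (splitting σ c l) +
              Finsupp.mapRange.linearMap (annihilateCore σ ψ)
                (Finsupp.mapRange.linearMap (annihilateCore σ χ) (splitting σ c l)) := by
          rw [splitting, map_add, Finsupp.mapRange.linearMap_apply, Finsupp.mapRange_single,
            annihilateCore_vacuum, Finsupp.single_zero, zero_add]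
          ext1 l'
          simp [annihilateCore_wordCore]
        rw [SetLike.mem_coe, Submodule.mem_comap, h1]
        refine Submodule.add_mem _ (Submodule.add_mem _ (Submodule.smul_mem _ _ hl') ?_) ?_
        · exact splittingSpan_mono σ c (Nat.le_succ n) (ih _ _ hl')
        · exact splittingSpan_mono σ c (Nat.le_succ n)
            (ih _ _ (splittingSpan_mono σ c (Nat.le_succ n) (ih _ _ hl')))
    exact this hz

theorem shiftSeq_apply (t : T) (p : TestSeq T) (m : ℕ) :
    shiftSeq t p m = slice t m (p (m + 1)) := by
  induction p using DirectSum.induction_on with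
  | zero => simp
  | of i f =>
    rw [← DirectSum.lof_eq_of ℝ]
    cases i with
    | zero => rw [shiftSeq_lof_zero, lof_apply, dif_neg (by omega)]; simp
    | succ i =>
      rw [shiftSeq_lof_succ]
      by_cases h : i = m
      · subst h; simp
      · rw [lof_apply, lof_apply, dif_neg h, dif_neg (by omega), map_zero]
  | add p q hp hq => simp [hp, hq]

theorem shiftSeq_vacuum (t : T) : shiftSeq t vacuum = 0 := shiftSeq_lof_zero t _

theorem shiftSeq_createCore (t : T) (χ : Test T 1) (p : TestSeq T) :
    shiftSeq t (createCore χ p) = χ (fun _ => t) • p := by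
  refine seq_ext fun m x => ?_
  rw [shiftSeq_apply, slice_apply, createCore_succ, tensor_one_apply, Fin.tail_cons]
  rfl

theorem shiftSeq_neutralCore (t : T) (χ : Test T 1) (p : TestSeq T) :
    shiftSeq t (neutralCore c χ p) = χ (fun _ => t) • c t • shiftSeq t p := by
  refine seq_ext fun m x => ?_
  rw [shiftSeq_apply, slice_apply, neutralCore_succ, diag_zero_tensor]
  simp only [Fin.cons_zero, DirectSum.smul_apply, CompactlySupportedContinuousMap.smul_apply,
    shiftSeq_apply, slice_apply, smul_eq_mul]
  ring

/-- What annihilation at `t` yields if it meets the first letter of a word, or a letter that is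
merged with it. -/
def firstLetter (t : T) : List (Test T 1) → TestSeq T
  | [] => 0
  | χ :: l => χ (fun _ => t) • (wordVec σ c l + c t • shiftSeq t (wordVec σ c l))

/-- Annihilation at `t` of a word splits off a prefix by its vacuum expectation. -/
theorem shiftSeq_of_mem_splittingSpan (t : T) (n : ℕ) : ∀ z ∈ splittingSpan σ c n,
    shiftSeq t (z []) = contractPrefix (firstLetter σ c t) z := by
  induction n with
  | zero =>
    intro z hz
    have : z = 0 := by simpa [splittingSpan] using hz
    simp [this]
  | succ n ih =>
    intro z hz
    let A : (List (Test T 1) →₀ TestSeq T) →ₗ[ℝ] TestSeq T :=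
      shiftSeq t ∘ₗ Finsupp.lapply []
    have : splittingSpan σ c (n + 1) ≤ LinearMap.eqLocus A (contractPrefix (firstLetter σ c t)) := by
      rw [splittingSpan, Submodule.span_le]
      rintro _ ⟨l, hl, rfl⟩
      change shiftSeq t (splitting σ c l []) = _
      rw [splitting_nil_apply]
      cases l with
      | nil => simp [splitting, contractPrefix_single, firstLetter, wordVec, shiftSeq_vacuum]
      | cons χ l =>
        have hl' : splitting σ c l ∈ splittingSpan σ c (n + 1) :=
          Submodule.subset_span ⟨l, by
            have : l.length + 1 < n + 1 := hl
            exact (by omega : l.length < n + 1), rfl⟩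
        have h1 := ih _ (annihilate_mem_splittingSpan σ c n χ _ hl')
        rw [Finsupp.mapRange.linearMap_apply, Finsupp.mapRange_apply, splitting_nil_apply] at h1
        -- creation and neutral part do not contribute to vacuum expectations
        have h2 (z : List (Test T 1) →₀ TestSeq T) (y : List (Test T 1) → TestSeq T) :
            contractPrefix y (Finsupp.mapRange.linearMap (wordCore σ c 1 χ) z) =
              contractPrefix y (Finsupp.mapRange.linearMap (annihilateCore σ χ) z) := by
          induction z using Finsupp.induction_linear with
          | zero => simp
          | add f g hf hg => rw [map_add, map_add, map_add, map_add, hf, hg]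
          | single l p => simp [contractPrefix_single, vacuumCoeff_wordCore]
        rw [wordVec, wordCore_one_apply, map_add, map_add, shiftSeq_createCore,
          shiftSeq_neutralCore, splitting, map_add, h2, contractPrefix_single, vacuumCoeff_vacuum,
          one_smul, ← smul_add, firstLetter]
        congr 1
    exact this hz

end GlobalWords

/-! ### Density of elementary tensors -/

noncomputable section Density

variable {T : Type*} [TopologicalSpace T] [T2Space T]
  [SecondCountableTopology T] [LocallyCompactSpace T] [MeasurableSpace T] [BorelSpace T]
  (σ : Measure T) [IsFiniteMeasureOnCompacts σ] (c : C(T, ℝ))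

/-- The function `χ_1 ⊗ ⋯ ⊗ χ_n`. -/
def prodKernel {n : ℕ} (χ : Fin n → Test T 1) : Test T n where
  toFun x := ∏ i, χ i fun _ => x i
  continuous_toFun := by fun_prop
  hasCompactSupport' := by
    refine HasCompactSupport.intro (K := Set.univ.pi fun i => (fun y : Fin 1 → T => y 0) ''
      tsupport (χ i)) (isCompact_univ_pi fun i =>
        (χ i).hasCompactSupport.isCompact.image (by fun_prop)) fun x hx => ?_
    by_contra h0
    refine hx fun i _ => ⟨fun _ => x i, subset_tsupport _ ?_, rfl⟩
    exact Finset.prod_ne_zero_iff.1 h0 i (Finset.mem_univ i)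

theorem prodKernel_apply {n : ℕ} (χ : Fin n → Test T 1) (x : Fin n → T) :
    prodKernel χ x = ∏ i, χ i fun _ => x i := rfl

theorem lof_prodKernel {n : ℕ} (χ : Fin n → Test T 1) :
    DirectSum.lof ℝ ℕ (fun n => Test T n) n (prodKernel χ) = pureTensor (List.ofFn χ) := by
  rw [pureTensor_eq_lof]
  refine (lof_congr (by simp) fun x => ?_).symm
  have h : n = (List.ofFn χ).length := by simp
  rw [pureKernel_apply, prodKernel_apply,
    ← Fin.prod_congr' (fun i => (List.ofFn χ).get i fun _ => x (Fin.cast h.symm i)) h]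
  refine Finset.prod_congr rfl fun i _ => ?_
  simp

/-- The product of a continuous function and a test function. -/
def mulTest {n : ℕ} (a : C(Fin n → T, ℝ)) : Test T n →ₗ[ℝ] Test T n where
  toFun f :=
    { toFun := fun x => a x * f x
      continuous_toFun := by fun_prop
      hasCompactSupport' := f.hasCompactSupport.mul_left }
  map_add' f g := by ext x; simp [mul_add]
  map_smul' r f := by ext x; simp; ring

theorem mulTest_apply {n : ℕ} (a : C(Fin n → T, ℝ)) (f : Test T n) (x : Fin n → T) :
    mulTest a f x = a x * f x := rfl

variable (T) in
/-- The span of the functions `χ_1 ⊗ ⋯ ⊗ χ_n`. -/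
def prodSpan (n : ℕ) : Submodule ℝ (Test T n) := Submodule.span ℝ (Set.range prodKernel)

variable (T) in
/-- The continuous functions that preserve `prodSpan T n` as multipliers. -/
def multipliers (n : ℕ) : Subalgebra ℝ C(Fin n → T, ℝ) where
  carrier := {a | ∀ f ∈ prodSpan T n, mulTest a f ∈ prodSpan T n}
  mul_mem' {a b} ha hb f hf := by
    have : mulTest (a * b) f = mulTest a (mulTest b f) := by
      ext x; simp [mulTest_apply, mul_assoc]
    rw [this]
    exact ha _ (hb _ hf)
  add_mem' {a b} ha hb f hf := by
    have : mulTest (a + b) f = mulTest a f + mulTest b f := by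
      ext x; simp [mulTest_apply, add_mul]
    rw [this]
    exact Submodule.add_mem _ (ha _ hf) (hb _ hf)
  algebraMap_mem' r f hf := by
    have : mulTest (algebraMap ℝ C(Fin n → T, ℝ) r) f = r • f := by
      ext x; simp [mulTest_apply]
    rw [this]
    exact Submodule.smul_mem _ _ hf

theorem coord_mem_multipliers {n : ℕ} (g : C(T, ℝ)) (i : Fin n) :
    (⟨fun x => g (x i), by fun_prop⟩ : C(Fin n → T, ℝ)) ∈ multipliers T n := by
  set a : C(Fin n → T, ℝ) := ⟨fun x => g (x i), by fun_prop⟩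
  have : prodSpan T n ≤ (prodSpan T n).comap (mulTest a) := by
    rw [prodSpan, Submodule.span_le]
    rintro _ ⟨χ, rfl⟩
    refine Submodule.subset_span ⟨Function.update χ i
      (mulTest ⟨fun y => g (y 0), by fun_prop⟩ (χ i)), ?_⟩
    ext x
    rw [mulTest_apply, prodKernel_apply, prodKernel_apply,
      ← Finset.mul_prod_erase _ _ (Finset.mem_univ i),
      ← Finset.mul_prod_erase _ _ (Finset.mem_univ i), Function.update_self, mulTest_apply,
      mul_assoc]
    refine congrArg _ (congrArg _ ?_)
    refine Finset.prod_congr rfl fun j hj => ?_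
    rw [Function.update_of_ne (Finset.ne_of_mem_erase hj)]
  exact this

theorem separatesPoints_multipliers (n : ℕ) : (multipliers T n).SeparatesPoints := by
  intro x y hxy
  obtain ⟨i, hi⟩ := Function.ne_iff.1 hxy
  obtain ⟨g, h1, h0, -, -⟩ := exists_continuous_one_zero_of_isCompact
    (isCompact_singleton (x := x i)) (isClosed_singleton (x := y i))
    (Set.disjoint_singleton.2 hi)
  refine ⟨_, ⟨_, coord_mem_multipliers g i, rfl⟩, ?_⟩
  simp [h1 rfl, h0 rfl]

theorem exists_cutoff {K : Set T} (hK : IsCompact K) : ∃ (χ : Test T 1) (K' : Set T), IsCompact K' ∧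
    (∀ s, 0 ≤ χ fun _ => s) ∧ (∀ s, (χ fun _ => s) ≤ 1) ∧ (∀ s ∈ K, (χ fun _ => s) = 1) ∧
    ∀ s ∉ K', (χ fun _ => s) = 0 := by
  obtain ⟨χ₀, h1, -, hc, h01⟩ :=
    exists_continuous_one_zero_of_isCompact hK isClosed_empty (Set.disjoint_empty K)
  have hχ : HasCompactSupport fun x : Fin 1 → T => χ₀ (x 0) := by
    simpa using hasCompactSupport_of_leftInverse (⟨χ₀, hc⟩ : C_c(T, ℝ))
      (fun x : Fin 1 → T => x 0) (fun s _ => s) (by fun_prop)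
      (fun x => by funext i; rw [Subsingleton.elim i 0]) fun _ => 1
  exact ⟨{ toFun := fun x => χ₀ (x 0), hasCompactSupport' := hχ }, tsupport χ₀, hc.isCompact,
    fun s => (h01 s).1, fun s => (h01 s).2, fun s hs => h1 hs,
    fun s hs => image_eq_zero_of_notMem_tsupport (f := χ₀) hs⟩

/-- Test functions are uniform limits of combinations of products, with supports in a fixed compact
set (Stone–Weierstrass). -/
theorem exists_prodSpan_near {n : ℕ} (f : Test T n) : ∃ K : Set T, IsCompact K ∧
    ∀ ε : ℝ, 0 < ε → ∃ h ∈ prodSpan T n, (∀ x, |(f - h) x| ≤ ε) ∧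
      ∀ x, (f - h) x ≠ 0 → ∀ i, x i ∈ K := by
  obtain ⟨K₀, -, hK₀, -, -, hf⟩ := exists_compact_bound f
  obtain ⟨χ, K, hK, hχ0, hχ1, hχK₀, hχK⟩ := exists_cutoff hK₀
  refine ⟨K, hK, fun ε hε => ?_⟩
  obtain ⟨a, ha, hfa⟩ :=
    ContinuousMap.exists_mem_subalgebra_near_continuous_of_isCompact_of_separatesPoints
      (separatesPoints_multipliers (T := T) n) ⟨f, f.continuous⟩
      (isCompact_univ_pi fun _ : Fin n => hK) hε
  set η : Test T n := prodKernel fun _ => χ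
  have hη (x : Fin n → T) : η x = ∏ i, χ fun _ => x i := rfl
  have hη0 (x : Fin n → T) : 0 ≤ η x := by
    rw [hη]; exact Finset.prod_nonneg fun i _ => hχ0 _
  have hη1 (x : Fin n → T) : η x ≤ 1 := by
    rw [hη]; exact Finset.prod_le_one (fun i _ => hχ0 _) fun i _ => hχ1 _
  have hηf (x : Fin n → T) : f x = η x * f x := by
    by_cases h0 : f x = 0
    · rw [h0, mul_zero]
    · rw [hη, Finset.prod_eq_one fun i _ => hχK₀ _ (hf x h0 i), one_mul]
  have hdiff (x : Fin n → T) : (f - mulTest a η) x = η x * (f x - a x) := by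
    rw [CompactlySupportedContinuousMap.sub_apply, mulTest_apply, mul_sub, ← hηf, mul_comm]
  have hsupp (x : Fin n → T) (hx : η x ≠ 0) (i : Fin n) : x i ∈ K := by
    by_contra h
    rw [hη] at hx
    exact Finset.prod_ne_zero_iff.1 hx i (Finset.mem_univ i) (hχK _ h)
  refine ⟨mulTest a η, ha _ (Submodule.subset_span ⟨_, rfl⟩), fun x => ?_, fun x hx => ?_⟩
  · rw [hdiff, abs_mul, abs_of_nonneg (hη0 x)]
    by_cases h0 : η x = 0
    · rw [h0, zero_mul]; exact hε.le
    · have h1 := hfa x fun i _ => hsupp x h0 i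
      rw [Real.norm_eq_abs, abs_sub_comm] at h1
      exact (mul_le_of_le_one_left (abs_nonneg _) (hη1 x)).trans h1.le
  · rw [hdiff] at hx
    exact hsupp x (left_ne_zero_of_mul hx)

/-- Continuity of a linear functional on test functions with respect to uniform convergence with
supports in a fixed compact set. -/
def IsRegular {n : ℕ} (φ : Test T n →ₗ[ℝ] ℝ) : Prop :=
  ∀ K : Set T, IsCompact K → ∃ C, ∀ (f : Test T n) (M : ℝ), 0 ≤ M → (∀ x, |f x| ≤ M) →
    (∀ x, f x ≠ 0 → ∀ i, x i ∈ K) → |φ f| ≤ C * M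

/-- Continuity of a linear functional on finite sequences of test functions, for every component. -/
def IsRegularSeq (φ : TestSeq T →ₗ[ℝ] ℝ) : Prop :=
  ∀ n, IsRegular (φ ∘ₗ DirectSum.lof ℝ ℕ (fun n => Test T n) n)

theorem IsRegular.eq_zero {n : ℕ} {φ : Test T n →ₗ[ℝ] ℝ} (hφ : IsRegular φ)
    (h : ∀ χ, φ (prodKernel χ) = 0) : φ = 0 := by
  have h0 : prodSpan T n ≤ LinearMap.ker φ := by
    rw [prodSpan, Submodule.span_le]
    rintro _ ⟨χ, rfl⟩
    exact h χ
  ext f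
  obtain ⟨K, hK, happ⟩ := exists_prodSpan_near f
  obtain ⟨C, hC⟩ := hφ K hK
  have key (ε : ℝ) (hε : 0 < ε) : |φ f| ≤ C * ε := by
    obtain ⟨g, hg, h1, h2⟩ := happ ε hε
    have := hC _ ε hε.le h1 h2
    rwa [map_sub, show φ g = 0 from h0 hg, sub_zero] at this
  have hlim : Filter.Tendsto (fun ε : ℝ => C * ε) (nhdsWithin 0 (Set.Ioi 0)) (nhds 0) := by
    have : Filter.Tendsto (fun ε : ℝ => C * ε) (nhds 0) (nhds (C * 0)) :=
      (continuous_const.mul continuous_id).tendsto 0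
    rw [mul_zero] at this
    exact this.mono_left nhdsWithin_le_nhds
  have := ge_of_tendsto hlim (eventually_nhdsWithin_of_forall fun ε hε => key ε hε)
  exact abs_eq_zero.1 (le_antisymm this (abs_nonneg _))

/-- A regular functional is determined by its values on elementary tensors. -/
theorem IsRegularSeq.eq_zero {φ : TestSeq T →ₗ[ℝ] ℝ} (hφ : IsRegularSeq φ)
    (h : ∀ l, φ (pureTensor l) = 0) : φ = 0 := by
  refine DirectSum.linearMap_ext ℝ fun n => ?_
  rw [(hφ n).eq_zero fun χ => by rw [LinearMap.comp_apply, lof_prodKernel, h], LinearMap.zero_comp]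

theorem IsRegularSeq.zero : IsRegularSeq (0 : TestSeq T →ₗ[ℝ] ℝ) :=
  fun n K _ => ⟨0, fun f M _ _ _ => by simp⟩

theorem IsRegularSeq.add {φ ψ : TestSeq T →ₗ[ℝ] ℝ} (hφ : IsRegularSeq φ) (hψ : IsRegularSeq ψ) :
    IsRegularSeq (φ + ψ) := by
  intro n K hK
  obtain ⟨C, hC⟩ := hφ n K hK
  obtain ⟨D, hD⟩ := hψ n K hK
  refine ⟨C + D, fun f M hM h1 h2 => ?_⟩
  rw [add_mul]
  exact (abs_add_le _ _).trans (add_le_add (hC f M hM h1 h2) (hD f M hM h1 h2))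

theorem IsRegularSeq.smul {φ : TestSeq T →ₗ[ℝ] ℝ} (hφ : IsRegularSeq φ) (r : ℝ) :
    IsRegularSeq (r • φ) := by
  intro n K hK
  obtain ⟨C, hC⟩ := hφ n K hK
  refine ⟨|r| * C, fun f M hM h1 h2 => ?_⟩
  rw [LinearMap.smul_comp, LinearMap.smul_apply, smul_eq_mul, abs_mul, mul_assoc]
  exact mul_le_mul_of_nonneg_left (hC f M hM h1 h2) (abs_nonneg r)

theorem IsRegularSeq.sum {ι : Type*} {s : Finset ι} {φ : ι → TestSeq T →ₗ[ℝ] ℝ}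
    (hφ : ∀ i ∈ s, IsRegularSeq (φ i)) : IsRegularSeq (∑ i ∈ s, φ i) := by
  classical
  induction s using Finset.induction_on with
  | empty => simpa using IsRegularSeq.zero
  | insert a s ha ih =>
    rw [Finset.sum_insert ha]
    exact (hφ a (by simp)).add (ih fun i hi => hφ i (by simp [hi]))

theorem IsRegularSeq.comp_shiftSeq {φ : TestSeq T →ₗ[ℝ] ℝ} (hφ : IsRegularSeq φ) (t : T) :
    IsRegularSeq (φ ∘ₗ shiftSeq t) := by
  intro n K hK
  cases n with
  | zero => exact ⟨0, fun f M _ _ _ => by simp [shiftSeq_lof_zero]⟩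
  | succ n =>
    obtain ⟨C, hC⟩ := hφ n K hK
    refine ⟨C, fun f M hM h1 h2 => ?_⟩
    rw [LinearMap.comp_apply, LinearMap.comp_apply, shiftSeq_lof_succ]
    refine hC (slice t n f) M hM (fun x => h1 _) fun x hx i => ?_
    simpa using h2 _ hx i.succ

theorem blockContract_bound {n k N : ℕ} (ζ : Finpartition (Finset.univ : Finset (Fin n)))
    (h : N = k + n) {K : Set T} (hK : IsCompact K) : ∃ C, 0 ≤ C ∧ ∀ (f : Test T N) (M : ℝ), 0 ≤ M →
      (∀ x, |f x| ≤ M) → (∀ x, f x ≠ 0 → ∀ i, x i ∈ K) →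
      (∀ x, |blockContract σ c ζ h f x| ≤ C * M) ∧
        ∀ x, blockContract σ c ζ h f x ≠ 0 → ∀ i, x i ∈ K := by
  set Q : Set (ζ.parts → T) := Set.univ.pi fun _ => K
  have hQ : IsCompact Q := isCompact_univ_pi fun _ => hK
  have hint : Integrable (Q.indicator fun s => |weight c ζ s|) (Measure.pi fun _ => σ) :=
    ((continuous_weight c ζ).abs.continuousOn.integrableOn_compact hQ).integrable_indicator
      hQ.measurableSet
  refine ⟨∫ s, Q.indicator (fun s => |weight c ζ s|) s ∂Measure.pi fun _ => σ,
    integral_nonneg fun s => Set.indicator_nonneg (fun _ _ => abs_nonneg _) s,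
    fun f M hM h1 h2 => ⟨fun x => ?_, fun x hx i => ?_⟩⟩
  · rw [← integral_mul_const]
    change ‖∫ s : ζ.parts → T, weight c ζ s *
      f (prepend h (fun i => s (block ζ i)) x) ∂Measure.pi fun _ => σ‖ ≤ _
    refine norm_integral_le_of_norm_le (hint.mul_const M) (Filter.Eventually.of_forall fun s => ?_)
    rw [Real.norm_eq_abs, abs_mul]
    by_cases h0 : f (prepend h (fun i => s (block ζ i)) x) = 0
    · rw [h0, abs_zero, mul_zero]
      exact mul_nonneg (Set.indicator_nonneg (fun _ _ => abs_nonneg _) s) hM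
    · have hs : s ∈ Q := fun B _ => by
        rw [← congrFun (unblock_prepend ζ h s x) B]
        exact h2 _ h0 _
      rw [Set.indicator_of_mem hs]
      exact mul_le_mul_of_nonneg_left (h1 _) (abs_nonneg _)
  · obtain ⟨s, hs⟩ : ∃ s : ζ.parts → T, f (prepend h (fun i => s (block ζ i)) x) ≠ 0 := by
      by_contra! hall
      refine hx ?_
      change ∫ s : ζ.parts → T, weight c ζ s * f (prepend h (fun i => s (block ζ i)) x) ∂_ = 0
      simp [hall]
    rw [← congrFun (prepend_snd h (fun i => s (block ζ i)) x) i]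
    exact h2 _ hs _

theorem IsRegularSeq.comp_blockSeq {φ : TestSeq T →ₗ[ℝ] ℝ} (hφ : IsRegularSeq φ) {n : ℕ}
    (ζ : Finpartition (Finset.univ : Finset (Fin n))) : IsRegularSeq (φ ∘ₗ blockSeq σ c ζ) := by
  intro N K hK
  by_cases h : n ≤ N
  · obtain ⟨C, hC0, hC⟩ := blockContract_bound σ c ζ (by omega : N = (N - n) + n) hK
    obtain ⟨D, hD⟩ := hφ (N - n) K hK
    refine ⟨D * C, fun f M hM h1 h2 => ?_⟩
    obtain ⟨h3, h4⟩ := hC f M hM h1 h2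
    rw [LinearMap.comp_apply, LinearMap.comp_apply, blockSeq_lof, dif_pos h, mul_assoc]
    exact hD _ _ (mul_nonneg hC0 hM) h3 h4
  · refine ⟨0, fun f M _ _ _ => ?_⟩
    rw [LinearMap.comp_apply, LinearMap.comp_apply, blockSeq_lof, dif_neg h]
    simp

theorem IsRegularSeq.comp_globalSeq {φ : TestSeq T →ₗ[ℝ] ℝ} (hφ : IsRegularSeq φ) :
    IsRegularSeq (φ ∘ₗ globalSeq σ c) := by
  intro N
  have h := (hφ.add (IsRegularSeq.sum (s := Finset.Icc 2 N) fun n _ =>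
    IsRegularSeq.sum (s := NC₂ n) fun ζ _ => hφ.comp_blockSeq σ c ζ)) N
  convert h using 1
  ext f
  simp [globalSeq]

/-- The vector that a polynomial, given by its coefficients with respect to the monomials, yields
when applied to the vacuum. -/
def vacuumRep : TestSeq T →ₗ[ℝ] TestSeq T :=
  DirectSum.toModule ℝ ℕ _ fun n => act σ c n (0 + n) ∘ₗ (tensor 0 n).flip oneTest

theorem vacuumRep_lof (n : ℕ) (f : Test T n) :
    vacuumRep σ c (DirectSum.lof ℝ ℕ (fun n => Test T n) n f) = wordCore σ c n f vacuum := by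
  rw [vacuum, wordCore_lof]
  simp [vacuumRep]

theorem isRegularSeq_vacuumRep (m : ℕ) (x : Fin m → T) :
    ∃ φ : TestSeq T →ₗ[ℝ] ℝ, (∀ p, φ p = vacuumRep σ c p m x) ∧ IsRegularSeq φ := by
  refine ⟨{ toFun := fun p => vacuumRep σ c p m x
            map_add' := fun p q => by simp
            map_smul' := fun r p => by rw [map_smul]; rfl }, fun p => rfl, fun n K hK => ?_⟩
  obtain ⟨χ, -, -, hχ0, -, hχ1, -⟩ := exists_cutoff hK
  have hχ (y : Fin 1 → T) : χ y = χ fun _ => y 0 :=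
    congrArg χ (funext fun i => by rw [Subsingleton.elim i 0])
  refine ⟨act σ |c| n (0 + n) (tensorPow χ 0 oneTest n) m x, fun f M hM h1 h2 => ?_⟩
  change |vacuumRep σ c (DirectSum.lof ℝ ℕ (fun n => Test T n) n f) m x| ≤ _
  rw [vacuumRep_lof, vacuum, wordCore_lof]
  refine (act_absLe σ c n (0 + n) _ (M • tensorPow χ 0 oneTest n) (fun y => ?_) m x).trans_eq ?_
  · rw [tensor_apply, oneTest_apply, mul_one, CompactlySupportedContinuousMap.smul_apply,
      tensorPow_apply, oneTest_apply, mul_one, smul_eq_mul]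
    by_cases h0 : f (fun i => y ⟨i, by omega⟩) = 0
    · rw [h0, abs_zero]
      exact mul_nonneg hM (Finset.prod_nonneg fun i _ => hχ0 _)
    · rw [Finset.prod_eq_one fun i _ => hχ1 _ (h2 _ h0 i), mul_one]
      exact h1 _
  · rw [map_smul, mul_comm]
    rfl

theorem polynomial_vacuum (p : TestSeq T) :
    polynomial σ c p (toFock σ vacuum) = toFock σ (vacuumRep σ c p) := by
  induction p using DirectSum.induction_on with
  | zero => simp
  | add p q hp hq => simp [hp, hq]
  | of n f =>
    rw [← DirectSum.lof_eq_of ℝ, polynomial_lof, vacuumRep_lof, monomial_toFock]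

variable [σ.IsOpenPosMeasure]

theorem vacuumRep_createCore (χ : Test T 1) (p : TestSeq T) :
    vacuumRep σ c (createCore χ p) = wordCore σ c 1 χ (vacuumRep σ c p) := by
  induction p using DirectSum.induction_on with
  | zero => simp
  | add p q hp hq => simp [hp, hq]
  | of n f =>
    rw [← DirectSum.lof_eq_of ℝ, createCore, DirectSum.toModule_lof, LinearMap.comp_apply,
      vacuumRep_lof, vacuumRep_lof]
    apply toFock_injective σ
    rw [← monomial_toFock, ← monomial_toFock, ← monomial_toFock, monomial_tensor]
    rfl

theorem vacuumRep_pureTensor (l : List (Test T 1)) :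
    vacuumRep σ c (pureTensor l) = wordVec σ c l := by
  induction l with
  | nil =>
    rw [pureTensor, vacuum, vacuumRep_lof]
    apply toFock_injective σ
    rw [← monomial_toFock, monomial_zero]
    simp [wordVec]
  | cons χ l ih => rw [pureTensor, vacuumRep_createCore, ih, wordVec]

end Density

/-! ### Locally nilpotent operators -/

section LocallyNilpotent

variable {V : Type*} [AddCommGroup V] [Module ℝ V] {N D : Module.End ℝ V} {r : ℝ}

theorem mul_one_sub_smul_eq {W : Type*} {e : W → V} (he : Function.Surjective e) {n : W → W}
    (hN : ∀ p, N (e p) = e (n p)) (hD : ∀ p, D (e p - r • e (n p)) = e (n p)) :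
    D * (1 - r • N) = N := by
  refine LinearMap.ext fun A => ?_
  obtain ⟨p, rfl⟩ := he A
  have h : (1 - r • N) (e p) = e p - r • e (n p) := by
    rw [LinearMap.sub_apply, LinearMap.smul_apply, hN, Module.End.one_apply]
  rw [Module.End.mul_apply, h, hD, hN]

theorem one_sub_smul_mul_sum (N : Module.End ℝ V) (r : ℝ) (K : ℕ) :
    (1 - r • N) * ∑ k ∈ Finset.range K, r ^ k • N ^ k = 1 - r ^ K • N ^ K := by
  have h := mul_neg_geom_sum (r • N) K
  simpa only [smul_pow] using h

/-- If `D (1 - r N) = N`, then `1 + r D` is inverse to `1 - r N`. -/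
theorem isUnit_one_sub_smul (hN : ∀ A, ∃ K : ℕ, ∀ k, K ≤ k → (N ^ k) A = 0)
    (hD : D * (1 - r • N) = N) : IsUnit (1 - r • N) := by
  rw [Module.End.isUnit_iff]
  constructor
  · have h : (1 + r • D) * (1 - r • N) = 1 := by
      rw [add_mul, one_mul, smul_mul_assoc, hD, sub_add_cancel]
    exact Function.LeftInverse.injective (g := (1 + r • D : Module.End ℝ V)) fun A =>
      LinearMap.congr_fun h A
  · intro A
    obtain ⟨K, hK⟩ := hN A
    refine ⟨(∑ k ∈ Finset.range K, r ^ k • N ^ k : Module.End ℝ V) A, ?_⟩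
    rw [← Module.End.mul_apply, one_sub_smul_mul_sum, LinearMap.sub_apply, LinearMap.smul_apply,
      hK K le_rfl, smul_zero, sub_zero]
    rfl

theorem eq_mul_inverse_of_mul_eq (hU : IsUnit (1 - r • N)) (hD : D * (1 - r • N) = N) :
    D = N * Ring.inverse (1 - r • N) := by
  have h := Ring.mul_inverse_cancel_right (1 - r • N) D hU
  rw [hD] at h
  exact h.symm

theorem eq_of_mul_eq (hr : r = 0) (hD : D * (1 - r • N) = N) : D = N := by
  simpa [hr] using hD

theorem eq_sum_range_of_mul_eq (hD : D * (1 - r • N) = N) {A : V} {K : ℕ} (hK : (N ^ K) A = 0) :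
    D A = ∑ k ∈ Finset.range K, r ^ k • (N ^ (k + 1)) A := by
  have h : D * (1 - r ^ K • N ^ K) = N * ∑ k ∈ Finset.range K, r ^ k • N ^ k := by
    rw [← one_sub_smul_mul_sum, ← mul_assoc, hD]
  have h' := LinearMap.congr_fun h A
  rw [Module.End.mul_apply, LinearMap.sub_apply, LinearMap.smul_apply, hK, smul_zero,
    sub_zero, Finset.mul_sum, LinearMap.sum_apply] at h'
  refine h'.trans (Finset.sum_congr rfl fun k _ => ?_)
  rw [mul_smul_comm, ← pow_succ', LinearMap.smul_apply]

theorem eq_finsum_of_mul_eq (hN : ∀ A, ∃ K : ℕ, ∀ k, K ≤ k → (N ^ k) A = 0)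
    (hD : D * (1 - r • N) = N) (A : V) :
    D A = ∑ᶠ k ∈ Set.Ici 1, r ^ (k - 1) • (N ^ k) A := by
  obtain ⟨K, hK⟩ := hN A
  rw [eq_sum_range_of_mul_eq hD (hK K le_rfl),
    finsum_mem_eq_sum_of_inter_support_eq (t := Finset.Icc 1 K)]
  · refine Finset.sum_bij' (fun k _ => k + 1) (fun k _ => k - 1) ?_ ?_ ?_ ?_ ?_
    · intro k hk; simp at hk ⊢; omega
    · intro k hk; simp at hk ⊢; omega
    · intro k _; simp
    · intro k hk; simp at hk; omega
    · intro k _; simp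
  · ext k
    simp only [Set.mem_inter_iff, Set.mem_Ici, Function.mem_support, Finset.coe_Icc, Set.mem_Icc]
    refine ⟨fun h => ⟨⟨h.1, ?_⟩, h.2⟩, fun h => ⟨h.1.1, h.2⟩⟩
    by_contra hk
    exact h.2 (by rw [hK k (by omega), smul_zero])

end LocallyNilpotent

/-! ### The relation between annihilation operator and free derivative -/

noncomputable section Transfer

variable {T : Type*} [TopologicalSpace T] [T2Space T]
  [SecondCountableTopology T] [LocallyCompactSpace T] [MeasurableSpace T] [BorelSpace T]
  (σ : Measure T) [IsFiniteMeasureOnCompacts σ] (c : C(T, ℝ))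

theorem act_congr {j M N : ℕ} (h : M = N) {f : Test T M} {g : Test T N}
    (hfg : ∀ x : Fin N → T, f (fun k => x (Fin.cast h k)) = g x) :
    act σ c j M f = act σ c j N g := by
  subst h
  congr 1
  ext x
  exact hfg x

theorem monomial_vacuum (n : ℕ) (f : Test T n) :
    monomial σ c n f (toFock σ vacuum) = toFock σ (act σ c n n f) := by
  rw [monomial_toFock, vacuum, wordCore_lof]
  congr 1
  refine act_congr σ c (by omega) fun x => ?_
  rw [tensor_apply, oneTest_apply, mul_one]
  rfl

/-- `⟨ω^{⊗ j} ⊗ P^{(r)}(ω), f⟩ Ω`: the kernels `P^{(r)}(ω)` are replaced by vectors of the Fock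
space. -/
theorem mixed_vacuum : ∀ (r j N : ℕ) (f : Test T N), N = j + r →
    mixed σ c r j N f (toFock σ vacuum) = toFock σ (act σ c j N f)
  | 0, j, N, f, h => by
    obtain rfl : N = j := h
    rw [show mixed σ c 0 N N f = monomial σ c N f by rw [mixed]; simp, monomial_vacuum]
  | 1, 0, N, f, h => by
    obtain rfl : N = 1 := by omega
    rw [show mixed σ c 1 0 1 f = monomial σ c 1 f by rw [mixed]; simp, monomial_vacuum]
    rfl
  | 1, j + 1, N, f, h => by
    obtain rfl : N = j + 2 := by omega
    rw [show mixed σ c 1 (j + 1) (j + 2) f = monomial σ c (j + 2) f by rw [mixed]; simp,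
      monomial_vacuum, act_succ, dif_neg (by omega), add_zero]
  | r + 2, j, 0, f, h => by omega
  | r + 2, j, 1, f, h => by omega
  | r + 2, j, N + 2, f, h => by
    have hj : j < N + 1 := by omega
    rw [mixed, dif_pos hj]
    simp only [LinearMap.sub_apply, LinearMap.add_apply, LinearMap.comp_apply, _root_.sub_apply,
      _root_.add_apply]
    rw [mixed_vacuum (r + 1) (j + 1) (N + 2) f (by omega),
      mixed_vacuum (r + 1) j (N + 1) _ (by omega), mixed_vacuum r j N _ (by omega), act_succ,
      dif_pos hj, map_add, map_add]
    abel

/-- `⟨P^{(n)}(ω), f⟩ Ω = f` -/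
theorem orthPolynomial_vacuum (q : TestSeq T) :
    orthPolynomial σ c q (toFock σ vacuum) = toFock σ q := by
  induction q using DirectSum.induction_on with
  | zero => simp
  | add p q hp hq => simp [hp, hq]
  | of n f =>
    rw [← DirectSum.lof_eq_of ℝ, orthPolynomial_lof, mixed_vacuum σ c n 0 n f (by omega), act_zero]

variable [σ.IsOpenPosMeasure]

/-- Passing from monomial to orthogonal coefficients means applying the polynomial to the vacuum. -/
theorem orthPolynomialEquiv_vacuumRep (p : TestSeq T) :
    orthPolynomialEquiv σ c (vacuumRep σ c p) = polynomialEquiv σ c p := by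
  obtain ⟨q, hq⟩ := (orthPolynomialEquiv σ c).surjective (polynomialEquiv σ c p)
  rw [← hq]
  congr 1
  apply toFock_injective σ
  rw [← polynomial_vacuum, ← orthPolynomial_vacuum σ c q]
  exact congrArg (fun A : CP σ c => (A : Fock σ →L[ℝ] Fock σ) (toFock σ vacuum)) hq.symm

/-- `D_t 𝔾` on the coefficients with respect to the monomials -/
def globalShift (t : T) : TestSeq T →ₗ[ℝ] TestSeq T := shiftSeq t ∘ₗ globalSeq σ c

theorem globalOp_apply (p : TestSeq T) :
    globalOp σ c (polynomialEquiv σ c p) = polynomialEquiv σ c (globalSeq σ c p) :=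
  globalFun_polynomial σ c p

theorem freeDeriv_mul_globalOp (t : T) (p : TestSeq T) :
    (freeDeriv σ c t * globalOp σ c) (polynomialEquiv σ c p) =
      polynomialEquiv σ c (globalShift σ c t p) := by
  rw [Module.End.mul_apply, globalOp_apply, freeDeriv_monomial]
  rfl

theorem annihilation_polynomial (t : T) (p : TestSeq T) :
    annihilation σ c t (polynomialEquiv σ c p) =
      orthPolynomialEquiv σ c (shiftSeq t (vacuumRep σ c p)) := by
  rw [← orthPolynomialEquiv_vacuumRep, annihilation_orth]

/-- The relation `∂_t (1 - λ(t) D_t 𝔾) = D_t 𝔾` on words. -/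
theorem shift_vacuumRep_pureTensor (t : T) (l : List (Test T 1)) :
    shiftSeq t (vacuumRep σ c (pureTensor l - c t • globalShift σ c t (pureTensor l))) =
      vacuumRep σ c (globalShift σ c t (pureTensor l)) := by
  have h1 := shiftSeq_of_mem_splittingSpan σ c t (l.length + 1) (splitting σ c l)
    (Submodule.subset_span ⟨l, Nat.lt_succ_self l.length, rfl⟩)
  rw [splitting_nil_apply] at h1
  have h2 : globalShift σ c t (pureTensor l) =
      contractPrefix (fun l => shiftSeq t (pureTensor l)) (splitting σ c l) := by
    rw [globalShift, LinearMap.comp_apply, globalSeq_pureTensor, map_contractPrefix]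
  have h3 : firstLetter σ c t = fun l => (vacuumRep σ c +
      c t • (shiftSeq t ∘ₗ vacuumRep σ c) : TestSeq T →ₗ[ℝ] TestSeq T)
        (shiftSeq t (pureTensor l)) := by
    funext l
    cases l with
    | nil => rw [pureTensor, shiftSeq_vacuum, map_zero]; rfl
    | cons χ l =>
      rw [pureTensor, shiftSeq_createCore, map_smul, firstLetter]
      simp [vacuumRep_pureTensor]
  rw [h3, ← map_contractPrefix, ← h2] at h1
  rw [map_sub, map_sub, map_smul, map_smul, vacuumRep_pureTensor, h1]
  exact sub_eq_iff_eq_add.2 rfl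

/-- The relation `∂_t (1 - λ(t) D_t 𝔾) = D_t 𝔾` on coefficients. -/
theorem shift_vacuumRep (t : T) (p : TestSeq T) :
    shiftSeq t (vacuumRep σ c (p - c t • globalShift σ c t p)) =
      vacuumRep σ c (globalShift σ c t p) := by
  refine seq_ext fun m x => ?_
  obtain ⟨φ, hφ, hφr⟩ := isRegularSeq_vacuumRep σ c m x
  obtain ⟨φ', hφ', hφr'⟩ := isRegularSeq_vacuumRep σ c (m + 1) (Fin.cons t x)
  have hφS (q : TestSeq T) : φ' q = shiftSeq t (vacuumRep σ c q) m x := by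
    rw [hφ', shiftSeq_apply, slice_apply]
  have hreg : IsRegularSeq (φ' + (-(c t)) • (φ' ∘ₗ globalShift σ c t) +
      (-1 : ℝ) • (φ ∘ₗ globalShift σ c t)) :=
    (hφr'.add (((hφr'.comp_shiftSeq t).comp_globalSeq σ c).smul _)).add
      (((hφr.comp_shiftSeq t).comp_globalSeq σ c).smul _)
  have hval (q : TestSeq T) : (φ' + (-(c t)) • (φ' ∘ₗ globalShift σ c t) +
      (-1 : ℝ) • (φ ∘ₗ globalShift σ c t)) q =
      shiftSeq t (vacuumRep σ c (q - c t • globalShift σ c t q)) m x -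
        vacuumRep σ c (globalShift σ c t q) m x := by
    rw [← hφS, ← hφ, map_sub, map_smul]
    simp
    ring
  have h0 := hreg.eq_zero fun l => by
    rw [hval, shift_vacuumRep_pureTensor, sub_self]
  have := hval p
  rw [h0, LinearMap.zero_apply] at this
  exact (sub_eq_zero.1 this.symm)

theorem annihilation_mul (t : T) :
    annihilation σ c t * (1 - c t • (freeDeriv σ c t * globalOp σ c)) =
      freeDeriv σ c t * globalOp σ c := by
  refine mul_one_sub_smul_eq (polynomialEquiv σ c).surjective
    (freeDeriv_mul_globalOp σ c t) fun p => ?_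
  rw [← map_smul, ← map_sub, annihilation_polynomial, shift_vacuumRep, orthPolynomialEquiv_vacuumRep]

theorem globalSeq_degree (N : ℕ) (p : TestSeq T) (hp : ∀ m, N ≤ m → p m = 0) :
    ∀ m, N ≤ m → globalSeq σ c p m = 0 := by
  intro m hm
  rw [globalSeq_eq σ c N p fun k hk => hp k hk.le, DirectSum.add_apply, hp m hm, zero_add,
    DFinsupp.finsetSum_apply, Finset.sum_eq_zero]
  intro n _
  rw [DFinsupp.finsetSum_apply, Finset.sum_eq_zero]
  intro ζ _
  rw [eq_sum_lof p (Finset.range N) fun k hk => hp k (by simpa using hk), map_sum,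
    DFinsupp.finsetSum_apply, Finset.sum_eq_zero]
  intro k hk
  rw [Finset.mem_range] at hk
  rw [blockSeq_lof]
  split_ifs
  · rw [lof_apply, dif_neg (by omega)]
  · rfl

/-- `D_t 𝔾` lowers the degree. -/
theorem pow_freeDeriv_mul_globalOp (t : T) (N : ℕ) : ∀ p : TestSeq T, (∀ m, N ≤ m → p m = 0) →
    ((freeDeriv σ c t * globalOp σ c) ^ N) (polynomialEquiv σ c p) = 0 := by
  induction N with
  | zero =>
    intro p hp
    obtain rfl : p = 0 := DFinsupp.ext fun m => hp m (by omega)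
    simp
  | succ N ih =>
    intro p hp
    rw [pow_succ, Module.End.mul_apply, freeDeriv_mul_globalOp]
    refine ih _ fun m hm => ?_
    rw [globalShift, LinearMap.comp_apply, shiftSeq_apply,
      globalSeq_degree σ c (N + 1) p hp (m + 1) (by omega), map_zero]

theorem exists_pow_eq_zero (t : T) (A : CP σ c) : ∃ K : ℕ, ∀ k, K ≤ k →
    ((freeDeriv σ c t * globalOp σ c) ^ k) A = 0 := by
  obtain ⟨p, rfl⟩ := (polynomialEquiv σ c).surjective A
  obtain ⟨K, hK⟩ := exists_degree p
  exact ⟨K, fun k hk => pow_freeDeriv_mul_globalOp σ c t k p fun m hm => hK m (hk.trans hm)⟩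

end Transfer

/-! ### The inverse power series -/

noncomputable section Series

/-- The series `z / (1 - l z) = ∑_{k ≥ 1} l^{k-1} z^k`. -/
def psiInv (l : ℝ) : PowerSeries ℝ := PowerSeries.mk fun k => if k = 0 then 0 else l ^ (k - 1)

theorem coeff_psiInv (l : ℝ) (k : ℕ) :
    PowerSeries.coeff k (psiInv l) = if k = 0 then 0 else l ^ (k - 1) :=
  PowerSeries.coeff_mk _ _

theorem constantCoeff_psiInv (l : ℝ) : PowerSeries.constantCoeff (psiInv l) = 0 := by
  rw [← PowerSeries.coeff_zero_eq_constantCoeff_apply, coeff_psiInv, if_pos rfl]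

theorem psiInv_mul (l : ℝ) : psiInv l * (1 - PowerSeries.C l * PowerSeries.X) = PowerSeries.X := by
  ext k
  have h : psiInv l * (1 - PowerSeries.C l * PowerSeries.X) =
      psiInv l - PowerSeries.C l * (psiInv l * PowerSeries.X) := by ring
  rw [h, map_sub, PowerSeries.coeff_C_mul]
  rcases k with - | - | k
  · simp [constantCoeff_psiInv]
  · rw [PowerSeries.coeff_succ_mul_X]
    simp [coeff_psiInv]
  · rw [PowerSeries.coeff_succ_mul_X]
    simp [coeff_psiInv, PowerSeries.coeff_X, pow_succ']

theorem psi_mul (l : ℝ) : psi l 0 * (1 + PowerSeries.C l * PowerSeries.X) = PowerSeries.X := by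
  have h : (1 + PowerSeries.C l * PowerSeries.X : PowerSeries ℝ) ≠ 0 := fun h => by
    have := congrArg PowerSeries.constantCoeff h
    simp at this
  rw [psi, map_zero, zero_mul, add_zero, mul_assoc, PowerSeries.inv_mul_cancel, mul_one]
  simp

theorem constantCoeff_psi (l e : ℝ) : PowerSeries.constantCoeff (psi l e) = 0 := by
  simp [psi]

theorem subst_C {a : PowerSeries ℝ} (ha : PowerSeries.HasSubst a) (r : ℝ) :
    PowerSeries.subst a (PowerSeries.C r) = PowerSeries.C r := by
  rw [← PowerSeries.coe_substAlgHom ha]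
  exact (PowerSeries.substAlgHom ha).commutes r

theorem subst_psi_psiInv (l : ℝ) : PowerSeries.subst (psi l 0) (psiInv l) = PowerSeries.X := by
  have ha := PowerSeries.HasSubst.of_constantCoeff_zero' (constantCoeff_psi l 0)
  have h := congrArg (PowerSeries.substAlgHom ha) (psiInv_mul l)
  rw [map_mul, map_sub, map_one, map_mul, PowerSeries.coe_substAlgHom, subst_C ha,
    PowerSeries.subst_X ha] at h
  have h1 := psi_mul l
  -- `(1 - l Ψ) (1 + l z) = 1`
  have h2 : (1 - PowerSeries.C l * psi l 0) * (1 + PowerSeries.C l * PowerSeries.X) = 1 := by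
    linear_combination (-PowerSeries.C l) * h1
  calc PowerSeries.subst (psi l 0) (psiInv l)
      = (PowerSeries.subst (psi l 0) (psiInv l) * (1 - PowerSeries.C l * psi l 0)) *
          (1 + PowerSeries.C l * PowerSeries.X) := by rw [mul_assoc, h2, mul_one]
    _ = PowerSeries.X := by rw [h, h1]

theorem subst_psiInv_psi (l : ℝ) : PowerSeries.subst (psiInv l) (psi l 0) = PowerSeries.X := by
  have ha := PowerSeries.HasSubst.of_constantCoeff_zero' (constantCoeff_psiInv l)
  have h := congrArg (PowerSeries.substAlgHom ha) (psi_mul l)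
  rw [map_mul, map_add, map_one, map_mul, PowerSeries.coe_substAlgHom, subst_C ha,
    PowerSeries.subst_X ha] at h
  have h1 := psiInv_mul l
  have h2 : (1 + PowerSeries.C l * psiInv l) * (1 - PowerSeries.C l * PowerSeries.X) = 1 := by
    linear_combination PowerSeries.C l * h1
  calc PowerSeries.subst (psiInv l) (psi l 0)
      = (PowerSeries.subst (psiInv l) (psi l 0) * (1 + PowerSeries.C l * psiInv l)) *
          (1 - PowerSeries.C l * PowerSeries.X) := by rw [mul_assoc, h2, mul_one]
    _ = PowerSeries.X := by rw [h, h1]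

theorem applySeries_psiInv {V : Type*} [AddCommGroup V] [Module ℝ V] (l : ℝ)
    (N : Module.End ℝ V) (A : V) :
    applySeries (psiInv l) N A = ∑ᶠ k ∈ Set.Ici 1, l ^ (k - 1) • (N ^ k) A := by
  unfold applySeries
  refine finsum_congr fun k => ?_
  rw [coeff_psiInv]
  by_cases hk : k = 0
  · simp [hk]
  · rw [if_neg hk, finsum_eq_if, if_pos (by simp; omega)]

end Series

end FreeMeixner

theorem theorem4p1 {T : Type*} [TopologicalSpace T] [PolishSpace T] [LocallyCompactSpace T]
    [MeasurableSpace T] [BorelSpace T] (σ : Measure T) [IsFiniteMeasureOnCompacts σ] [NullSingletonClass σ]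
    [σ.IsOpenPosMeasure] (lam : C(T, ℝ)) (t : T) :
    (∀ A : FreeMeixner.CP σ lam, ∃ K : ℕ, ∀ k : ℕ, K ≤ k →
      ((FreeMeixner.freeDeriv σ lam t * FreeMeixner.globalOp σ lam) ^ k) A = 0) ∧
    (∃ R : PowerSeries ℝ, PowerSeries.constantCoeff R = 0 ∧
      PowerSeries.subst (FreeMeixner.psi (lam t) 0) R = PowerSeries.X ∧
      PowerSeries.subst R (FreeMeixner.psi (lam t) 0) = PowerSeries.X ∧
      ∀ A : FreeMeixner.CP σ lam, FreeMeixner.annihilation σ lam t A =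
        FreeMeixner.applySeries R
          (FreeMeixner.freeDeriv σ lam t * FreeMeixner.globalOp σ lam) A) ∧
    (IsUnit (1 - lam t • (FreeMeixner.freeDeriv σ lam t * FreeMeixner.globalOp σ lam)) ∧
      FreeMeixner.annihilation σ lam t =
        (FreeMeixner.freeDeriv σ lam t * FreeMeixner.globalOp σ lam) *
          Ring.inverse
            (1 - lam t • (FreeMeixner.freeDeriv σ lam t * FreeMeixner.globalOp σ lam))) ∧
    (∀ A : FreeMeixner.CP σ lam, FreeMeixner.annihilation σ lam t A =
      ∑ᶠ k ∈ Set.Ici 1, lam t ^ (k - 1) •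
        ((FreeMeixner.freeDeriv σ lam t * FreeMeixner.globalOp σ lam) ^ k) A) ∧
    (lam t = 0 → FreeMeixner.annihilation σ lam t =
      FreeMeixner.freeDeriv σ lam t * FreeMeixner.globalOp σ lam) := by
  have hN := FreeMeixner.exists_pow_eq_zero σ lam t
  have hD := FreeMeixner.annihilation_mul σ lam t
  have hU := FreeMeixner.isUnit_one_sub_smul hN hD
  have hsum := FreeMeixner.eq_finsum_of_mul_eq hN hD
  refine ⟨hN, ⟨FreeMeixner.psiInv (lam t), FreeMeixner.constantCoeff_psiInv _,
    FreeMeixner.subst_psi_psiInv _, FreeMeixner.subst_psiInv_psi _, fun A => ?_⟩,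
    ⟨hU, FreeMeixner.eq_mul_inverse_of_mul_eq hU hD⟩, hsum,
    fun h0 => FreeMeixner.eq_of_mul_eq h0 hD⟩
  rw [FreeMeixner.applySeries_psiInv, hsum A]
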